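/- Let $M$ be a complex manifold of complex dimension $n$ with canonical complex structure $J$ on its real tangent bundle $T_{\mathbb R}M$. Identify $T_{\mathbb R}M$ with the holomorphic tangent bundle $T^{1,0}M$ by $y\mapsto \frac12(y-iJy)$; in local holomorphic coordinates $z^\alpha=x^\alpha+ix^{\alpha+n}$ the fibre coordinates are $v^\alpha=y^\alpha+iy^{\alpha+n}$. Let $\tilde M$ be the complement of the zero section, $\mathbf J$ the canonical complex structure of the complex manifold $T^{1,0}M$. Greek indices run over $1,\dots,n$, Latin ones over $1,\dots,2n$, and repeated indices are summed. Let $F:T^{1,0}M\to[0,\infty)$ be a strongly convex complex Finsler metric: $F$ is positive and $C^\infty$ on $\tilde M$, $F(z;\lambda v)=|\lambda|F(z;v)$ for $\lambda\in\mathbb C$, and $g_{jk}=\frac12\frac{\partial^2F^2}{\partial y^j\partial y^k}$ is positive definite on $\tilde M$. Put $\hat{\mathbb G}^k=\frac14g^{kl}\bigl(\frac{\partial^2F^2}{\partial x^a\partial y^l}y^a-\frac{\partial F^2}{\partial x^l}\bigr)$, $\hat\Gamma^k_j=\frac{\partial\hat{\mathbb G}^k}{\partial y^j}$, $\frac{\delta}{\delta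 x^j}=\frac{\partial}{\partial x^j}-\hat\Gamma^k_j\frac{\partial}{\partial y^k}$, $\delta y^j=dy^j+\hat\Gamma^j_kdx^k$; let $\mathcal H_{\mathbb R}\subset T_{\mathbb R}\tilde M$ be the span of the $\frac{\delta}{\delta x^j}$ and $\mathcal V_{\mathbb R}$ the span of the $\frac{\partial}{\partial y^j}$. The Cartan connection $\nabla$ on $\mathcal V_{\mathbb R}$ is $\nabla_X\frac{\partial}{\partial y^j}=\hat\omega^k_j(X)\frac{\partial}{\partial y^k}$ with $\hat\omega_j^k=\hat\Gamma^k_{j;l}dx^l+\hat\Gamma^k_{jl}\delta y^l$, $$\hat\Gamma^k_{j;l}=\tfrac12g^{ks}\Bigl(\frac{\delta g_{sj}}{\delta x^l}-\frac{\delta g_{jl}}{\delta x^s}+\frac{\delta g_{ls}}{\delta x^j}\Bigr),\qquad \hat\Gamma^k_{jl}=\tfrac14g^{ks}\frac{\partial^3F^2}{\partial y^j\partial y^l\partial y^s}.$$ For a smooth regular curve $\sigma:[0,1]\to M$, a real vector field $V$ along $\sigma$ is parallel (with respect to $\nabla$) if locally $\dot V^k+V^l\hat\Gamma^k_{l;j}(\sigma;\dot\sigma)\dot\sigma^j=0$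 for all $k$; a field $X+iY$ of complexified tangent vectors along $\sigma$ is parallel if $X$ and $Y$ are. Put $G_\alpha=\frac{\partial F^2}{\partial v^\alpha}$, $G_{\alpha\bar\beta}=\frac{\partial^2F^2}{\partial v^\alpha\partial\bar v^\beta}$ with inverse $(G^{\bar\tau\alpha})$, $G_{\beta\bar\tau}G^{\bar\tau\alpha}=\delta_\beta^\alpha$, and $$\Gamma^\alpha_{;\mu}=G^{\bar\tau\alpha}\frac{\partial^2F^2}{\partial z^\mu\partial\bar v^\tau},\quad \delta_\mu=\frac{\partial}{\partial z^\mu}-\Gamma^\alpha_{;\mu}\frac{\partial}{\partial v^\alpha},\quad \Gamma^\alpha_{\beta;\mu}=G^{\bar\tau\alpha}\delta_\mu(G_{\beta\bar\tau}).$$ $F$ is weakly Kähler–Finsler if $G_\alpha(\Gamma^\alpha_{\beta;\mu}-\Gamma^\alpha_{\mu;\beta})v^\beta=0$ on $\tilde M$ for all $\mu$. It is a strongly convex Kähler–Berwald metric if it is strongly convex, $\Gamma^\alpha_{\beta;\mu}=\Gamma^\alpha_{\mu;\beta}$, and every $\Gamma^\alpha_{\beta;\mu}$ depends only on the base point $z$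 (in all holomorphic coordinates). Theorem. Let $F$ be a strongly convex weakly Kähler–Finsler metric on a complex manifold $M$. Then the following assertions are equivalent: (1) $F$ is a strongly convex Kähler–Berwald metric; (2) for every smooth regular curve $\sigma:[0,1]\to M$, the types of complexified tangent vectors are preserved under parallel transport along $\sigma$ with respect to $\nabla$: a parallel field of complexified tangent vectors along $\sigma$ that has type $(1,0)$ (resp. $(0,1)$) at one point of $[0,1]$ has that type at every point of $[0,1]$; (3) for every smooth regular curve $\sigma:[0,1]\to M$ and every real vector field $V$ parallel along $\sigma$ with respect to $\nabla$, the field $JV$ is also parallel along $\sigma$ with respect to $\nabla$; (4) $\nabla_X\mathbf J=0$ for all $X\in\mathcal H_{\mathbb R}$, that is, $\nabla_X(\mathbf JY)=\mathbf J(\nabla_XY)$ for all $X\in\mathcal H_{\mathbb R}$ and all smooth local sections $Y$ of $\mathcal V_{\mathbb R}$. -/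

import Mathlib

open scoped Manifold ContDiff TensorProduct
open Set

namespace ComplexFinsler

noncomputable section

/-- The model space `ℂⁿ` of an `n`-dimensional complex manifold. -/
abbrev Model (n : ℕ) : Type := EuclideanSpace ℂ (Fin n)

/-! ### Real coordinates

A real index `j ∈ {1, …, 2n}` is an element of `Fin n ⊕ Fin n`: `Sum.inl α` is the index `α`, and
`Sum.inr α` is the index `α* = α + n`; thus `z^α = x^α + i x^{α*}` and `v^α = y^α + i y^{α*}`. -/

/-- The real basis vector `∂/∂x^j` of `ℂⁿ`. -/
def basisVec {n : ℕ} : Fin n ⊕ Fin n → Model n :=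
  Sum.elim (fun α => EuclideanSpace.single α 1) (fun α => EuclideanSpace.single α Complex.I)

/-- The real coordinates of a vector of `ℂⁿ`. -/
def coord {n : ℕ} (v : Model n) : Fin n ⊕ Fin n → ℝ :=
  Sum.elim (fun α => (v α).re) (fun α => (v α).im)

/-- The vector `c^j ∂/∂x^j` of `ℂⁿ` with the real coordinates `c`. -/
def ofCoord {n : ℕ} (c : Fin n ⊕ Fin n → ℝ) : Model n := ∑ j, c j • basisVec j

section Local

/-! ### Local objects

Here `F : ℂⁿ × ℂⁿ → ℝ` is the expression `F(z;v) = F(x;y)` of a metric in local coordinates,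
and `u = (z;v) = (x;y)` is a point of the coordinate domain with `v ≠ 0`. -/

variable {n : ℕ}

/-- `∂f/∂x^j`, for `f` with values in a real normed space. -/
def dX {A : Type} [NormedAddCommGroup A] [NormedSpace ℝ A] (j : Fin n ⊕ Fin n)
    (f : Model n × Model n → A) (u : Model n × Model n) : A :=
  fderiv ℝ f u (basisVec j, 0)

/-- `∂f/∂y^j`. -/
def dY {A : Type} [NormedAddCommGroup A] [NormedSpace ℝ A] (j : Fin n ⊕ Fin n)
    (f : Model n × Model n → A) (u : Model n × Model n) : A :=
  fderiv ℝ f u (0, basisVec j)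

/-! #### The real side: spray, nonlinear connection, Cartan connection -/

/-- The function `F²`. -/
def sqF (F : Model n × Model n → ℝ) (u : Model n × Model n) : ℝ := F u ^ 2

/-- The real fundamental tensor `g_{jk} = ½ ∂²F²/∂y^j∂y^k`. -/
def realTensor (F : Model n × Model n → ℝ) (u : Model n × Model n) :
    Matrix (Fin n ⊕ Fin n) (Fin n ⊕ Fin n) ℝ :=
  Matrix.of fun j k => (1 / 2) * dY j (dY k (sqF F)) u

/-- The real spray coefficients `Ĝ^k = ¼ g^{kl} (∂²F²/∂x^a∂y^l y^a - ∂F²/∂x^l)`. -/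
def realSpray (F : Model n × Model n → ℝ) (k : Fin n ⊕ Fin n) (u : Model n × Model n) : ℝ :=
  (1 / 4) * ∑ l, (realTensor F u)⁻¹ k l *
    ((∑ a, dX a (dY l (sqF F)) u * coord u.2 a) - dX l (sqF F) u)

/-- The real nonlinear connection coefficients `Γ̂^k_j = ∂Ĝ^k/∂y^j`. -/
def realNonlin (F : Model n × Model n → ℝ) (k j : Fin n ⊕ Fin n) (u : Model n × Model n) : ℝ :=
  dY j (realSpray F k) u

/-- The horizontal vector `δ/δx^j = ∂/∂x^j - Γ̂^k_j ∂/∂y^k` at the point `u`. -/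
def deltaVec (F : Model n × Model n → ℝ) (u : Model n × Model n) (j : Fin n ⊕ Fin n) :
    Model n × Model n :=
  (basisVec j, -ofCoord fun k => realNonlin F k j u)

/-- The fibre at `u` of the real horizontal bundle `H_ℝ`. -/
def horizontalSpace (F : Model n × Model n → ℝ) (u : Model n × Model n) :
    Submodule ℝ (Model n × Model n) :=
  Submodule.span ℝ (range (deltaVec F u))

/-- `δf/δx^j`. -/
def deltaX (F : Model n × Model n → ℝ) (j : Fin n ⊕ Fin n) (f : Model n × Model n → ℝ)
    (u : Model n × Model n) : ℝ :=
  dX j f u - ∑ k, realNonlin F k j u * dY k f u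

/-- The horizontal Cartan connection coefficients
`Γ̂^k_{j;l} = ½ g^{ks} (δg_{sj}/δx^l - δg_{jl}/δx^s + δg_{ls}/δx^j)`. -/
def cartanHor (F : Model n × Model n → ℝ) (k j l : Fin n ⊕ Fin n) (u : Model n × Model n) : ℝ :=
  (1 / 2) * ∑ s, (realTensor F u)⁻¹ k s *
    (deltaX F l (fun w => realTensor F w s j) u
      - deltaX F s (fun w => realTensor F w j l) u
      + deltaX F j (fun w => realTensor F w l s) u)

/-- The vertical Cartan connection coefficients `Γ̂^k_{jl} = ¼ g^{ks} ∂³F²/∂y^j∂y^l∂y^s`. -/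
def cartanVert (F : Model n × Model n → ℝ) (k j l : Fin n ⊕ Fin n) (u : Model n × Model n) : ℝ :=
  (1 / 4) * ∑ s, (realTensor F u)⁻¹ k s * dY j (dY l (dY s (sqF F))) u

/-- `δy^l(X) = dy^l(X) + Γ̂^l_m dx^m(X)` for a real tangent vector `X` at `u`. -/
def deltaY (F : Model n × Model n → ℝ) (u X : Model n × Model n) (l : Fin n ⊕ Fin n) : ℝ :=
  coord X.2 l + ∑ m, realNonlin F l m u * coord X.1 m

/-- The connection form `ω̂^k_j(X) = Γ̂^k_{j;l} dx^l(X) + Γ̂^k_{jl} δy^l(X)`. -/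
def cartanForm (F : Model n × Model n → ℝ) (k j : Fin n ⊕ Fin n) (u X : Model n × Model n) : ℝ :=
  ∑ l, (cartanHor F k j l u * coord X.1 l + cartanVert F k j l u * deltaY F u X l)

/-- The Cartan covariant derivative `∇_X Y` at `u` of a vertical vector field `Y = Y^j ∂/∂y^j`,
`(∇_X Y)^k = X(Y^k) + Y^j ω̂^k_j(X)`. -/
def cartanCov (F : Model n × Model n → ℝ) (u X : Model n × Model n)
    (Y : Model n × Model n → Model n) : Model n :=
  ofCoord fun k => fderiv ℝ (fun w => coord (Y w) k) u X + ∑ j, coord (Y u) j * cartanForm F k j u X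

/-! #### The complex side: Chern–Finsler connection -/

/-- `∂f/∂z^α`. -/
def dZ (α : Fin n) (f : Model n × Model n → ℂ) (u : Model n × Model n) : ℂ :=
  (1 / 2) * (dX (Sum.inl α) f u - Complex.I * dX (Sum.inr α) f u)

/-- `∂f/∂v^α`. -/
def dV (α : Fin n) (f : Model n × Model n → ℂ) (u : Model n × Model n) : ℂ :=
  (1 / 2) * (dY (Sum.inl α) f u - Complex.I * dY (Sum.inr α) f u)

/-- `∂f/∂v̄^α`. -/
def dVbar (α : Fin n) (f : Model n × Model n → ℂ) (u : Model n × Model n) : ℂ :=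
  (1 / 2) * (dY (Sum.inl α) f u + Complex.I * dY (Sum.inr α) f u)

/-- The function `F²`, as a complex-valued function. -/
def sqFC (F : Model n × Model n → ℝ) (u : Model n × Model n) : ℂ := ((F u ^ 2 : ℝ) : ℂ)

/-- The complex fundamental tensor `G_{αβ̄} = ∂²F²/∂v^α∂v̄^β`. Its inverse `(G^{τ̄α})` satisfies
`G_{βτ̄} G^{τ̄α} = δ^α_β`. -/
def complexTensor (F : Model n × Model n → ℝ) (u : Model n × Model n) :
    Matrix (Fin n) (Fin n) ℂ :=
  Matrix.of fun α β => dV α (dVbar β (sqFC F)) u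

/-- The complex nonlinear connection coefficients `Γ^α_{;μ} = G^{τ̄α} ∂²F²/∂z^μ∂v̄^τ`. -/
def chernNonlin (F : Model n × Model n → ℝ) (α μ : Fin n) (u : Model n × Model n) : ℂ :=
  ∑ τ, (complexTensor F u)⁻¹ τ α * dZ μ (dVbar τ (sqFC F)) u

/-- `δ_μ f = ∂f/∂z^μ - Γ^α_{;μ} ∂f/∂v^α`. -/
def deltaZ (F : Model n × Model n → ℝ) (μ : Fin n) (f : Model n × Model n → ℂ)
    (u : Model n × Model n) : ℂ :=
  dZ μ f u - ∑ α, chernNonlin F α μ u * dV α f u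

/-- The horizontal Chern–Finsler connection coefficients `Γ^α_{β;μ} = G^{τ̄α} δ_μ(G_{βτ̄})`. -/
def chernHor (F : Model n × Model n → ℝ) (α β μ : Fin n) (u : Model n × Model n) : ℂ :=
  ∑ τ, (complexTensor F u)⁻¹ τ α * deltaZ F μ (fun w => complexTensor F w β τ) u

end Local

section Global

/-! ### Objects on a complex manifold

For a complex manifold `M`, the holomorphic tangent bundle `T^{1,0}M` is Mathlib's complex tangent
bundle. Through the real isomorphism `y ↦ ½(y - iJy)` the same spaces are the real tangent
spaces of `M`, with multiplication by `i` as the complex structure `J`; in holomorphic coordinates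
this identifies `y^j ∂/∂x^j` with `v^α = y^α + i y^{α*}`. -/

variable {n : ℕ} {M : Type*} [TopologicalSpace M] [ChartedSpace (Model n) M]

/-- The holomorphic charts of `M`. -/
def holCharts (n : ℕ) (M : Type*) [TopologicalSpace M] [ChartedSpace (Model n) M] :
    Set (OpenPartialHomeomorph M (Model n)) :=
  IsManifold.maximalAtlas 𝓘(ℂ, Model n) ω M

/-- The domain of the coordinates `(z;v)` on `T^{1,0}M` minus the zero section that are induced by
a chart. -/
def slitDomain (e : OpenPartialHomeomorph M (Model n)) : Set (Model n × Model n) :=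
  e.target ×ˢ {v | v ≠ 0}

/-- The expression of `F` in the coordinates `(z;v)` induced by a chart. -/
def localExpr (F : TangentBundle 𝓘(ℂ, Model n) M → ℝ) (e : OpenPartialHomeomorph M (Model n))
    (u : Model n × Model n) : ℝ :=
  F ⟨e.symm u.1, mfderiv 𝓘(ℂ, Model n) 𝓘(ℂ, Model n) e.symm u.1 u.2⟩

/-- The components `v^α`, that is `y^j`, of a tangent vector of `M` in a chart. -/
def comp (e : OpenPartialHomeomorph M (Model n)) (p : M) (v : TangentSpace 𝓘(ℂ, Model n) p) :
    Model n :=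
  mfderiv 𝓘(ℂ, Model n) 𝓘(ℂ, Model n) e p v

/-- A strongly convex complex Finsler metric `F : T^{1,0}M → [0, ∞)`: it is positive and smooth
outside the zero section, absolutely homogeneous over `ℂ`, and its real fundamental tensor is
positive definite. -/
structure IsStronglyConvex (F : TangentBundle 𝓘(ℂ, Model n) M → ℝ) : Prop where
  nonneg : ∀ v, 0 ≤ F v
  pos : ∀ (p : M) (v : TangentSpace 𝓘(ℂ, Model n) p), v ≠ 0 → 0 < F ⟨p, v⟩
  smooth : ∀ e ∈ holCharts n M, ContDiffOn ℝ ∞ (localExpr F e) (slitDomain e)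
  homog : ∀ (p : M) (c : ℂ) (v : TangentSpace 𝓘(ℂ, Model n) p), F ⟨p, c • v⟩ = ‖c‖ * F ⟨p, v⟩
  posDef : ∀ e ∈ holCharts n M, ∀ u ∈ slitDomain e, (realTensor (localExpr F e) u).PosDef

/-- `F` is a weakly Kähler–Finsler metric: `G_α (Γ^α_{β;μ} - Γ^α_{μ;β}) v^β = 0`, where
`G_α = ∂F²/∂v^α`. -/
def IsWeaklyKahler (F : TangentBundle 𝓘(ℂ, Model n) M → ℝ) : Prop :=
  ∀ e ∈ holCharts n M, ∀ u ∈ slitDomain e, ∀ μ : Fin n,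
    ∑ α, ∑ β, dV α (sqFC (localExpr F e)) u *
      (chernHor (localExpr F e) α β μ u - chernHor (localExpr F e) α μ β u) * u.2 β = 0

/-- `F` is a Kähler–Finsler metric: `Γ^α_{β;μ} = Γ^α_{μ;β}`. -/
def IsKahlerFinsler (F : TangentBundle 𝓘(ℂ, Model n) M → ℝ) : Prop :=
  ∀ e ∈ holCharts n M, ∀ u ∈ slitDomain e, ∀ α β μ : Fin n,
    chernHor (localExpr F e) α β μ u = chernHor (localExpr F e) α μ β u

/-- `F` is a complex Berwald metric: each `Γ^α_{β;μ}(z;v)` depends only on `z`. -/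
def IsComplexBerwald (F : TangentBundle 𝓘(ℂ, Model n) M → ℝ) : Prop :=
  ∀ e ∈ holCharts n M, ∀ z ∈ e.target, ∀ v w : Model n, v ≠ 0 → w ≠ 0 → ∀ α β μ : Fin n,
    chernHor (localExpr F e) α β μ (z, v) = chernHor (localExpr F e) α β μ (z, w)

/-- `F` is a strongly convex Kähler–Berwald metric. -/
def IsStronglyConvexKahlerBerwald (F : TangentBundle 𝓘(ℂ, Model n) M → ℝ) : Prop :=
  IsStronglyConvex F ∧ IsKahlerFinsler F ∧ IsComplexBerwald F

/-- The velocity `σ̇(t)`, `t ∈ [0,1]`, in a chart around `σ(t)`. -/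
def velocity (e : OpenPartialHomeomorph M (Model n)) (σ : ℝ → M) (t : ℝ) : Model n :=
  derivWithin (fun s => e (σ s)) (Icc 0 1) t

/-- The restriction of `σ` to `[0,1]` is a smooth regular curve. -/
structure IsRegularCurve (n : ℕ) {M : Type*} [TopologicalSpace M] [ChartedSpace (Model n) M]
    (σ : ℝ → M) : Prop where
  smooth : ContMDiffOn 𝓘(ℝ, ℝ) 𝓘(ℝ, Model n) ∞ σ (Icc 0 1)
  regular : ∀ e ∈ holCharts n M, ∀ t ∈ Icc (0 : ℝ) 1, σ t ∈ e.source → velocity e σ t ≠ 0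

/-- The real vector field `V` along `σ` is parallel for the Cartan connection: in local coordinates
`dV^k/dt + V^l Γ̂^k_{l;j}(σ;σ̇) σ̇^j = 0`. -/
def IsParallel (F : TangentBundle 𝓘(ℂ, Model n) M → ℝ) (σ : ℝ → M)
    (V : ∀ t, TangentSpace 𝓘(ℂ, Model n) (σ t)) : Prop :=
  ∀ e ∈ holCharts n M, ∀ t ∈ Icc (0 : ℝ) 1, σ t ∈ e.source → ∀ k,
    HasDerivWithinAt (fun s => coord (comp e (σ s) (V s)) k)
      (-∑ l, ∑ j, coord (comp e (σ t) (V t)) l *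
        cartanHor (localExpr F e) k l j (e (σ t), velocity e σ t) * coord (velocity e σ t) j)
      (Icc 0 1) t

/-- The complex structure `J` on a real tangent space of `M`. -/
def complexJ (p : M) :
    TangentSpace 𝓘(ℂ, Model n) p →ₗ[ℝ] TangentSpace 𝓘(ℂ, Model n) p :=
  (LinearMap.lsmul ℂ (TangentSpace 𝓘(ℂ, Model n) p) Complex.I).restrictScalars ℝ

/-- The complexification of the real tangent space of `M` at `p`. -/
abbrev ComplexTangent (n : ℕ) {M : Type*} [TopologicalSpace M] [ChartedSpace (Model n) M]
    (p : M) : Type :=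
  ℂ ⊗[ℝ] TangentSpace 𝓘(ℂ, Model n) p

/-- The complexified vector `w` has type `(1,0)`: `Jw = iw`, with `J` extended `ℂ`-linearly. -/
def IsType10 (p : M) (w : ComplexTangent n p) : Prop :=
  (complexJ (n := n) p).baseChange ℂ w = Complex.I • w

/-- The complexified vector `w` has type `(0,1)`: `Jw = -iw`. -/
def IsType01 (p : M) (w : ComplexTangent n p) : Prop :=
  (complexJ (n := n) p).baseChange ℂ w = -(Complex.I • w)

/-- The field `W = X + iY` of complexified vectors along `σ` is parallel for the `ℂ`-linear extension
of the Cartan connection. -/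
def IsParallelComplex (F : TangentBundle 𝓘(ℂ, Model n) M → ℝ) (σ : ℝ → M)
    (W : ∀ t, ComplexTangent n (σ t)) : Prop :=
  ∃ X Y : ∀ t, TangentSpace 𝓘(ℂ, Model n) (σ t), IsParallel F σ X ∧ IsParallel F σ Y ∧
    ∀ t ∈ Icc (0 : ℝ) 1, W t = (1 : ℂ) ⊗ₜ[ℝ] X t + Complex.I ⊗ₜ[ℝ] Y t

/-- Cartan parallel transport along `σ` preserves the types of complexified vectors. -/
def PreservesTypes (F : TangentBundle 𝓘(ℂ, Model n) M → ℝ) (σ : ℝ → M) : Prop :=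
  ∀ W : ∀ t, ComplexTangent n (σ t), IsParallelComplex F σ W →
    ∀ s ∈ Icc (0 : ℝ) 1, ∀ t ∈ Icc (0 : ℝ) 1,
      (IsType10 (σ s) (W s) → IsType10 (σ t) (W t)) ∧ (IsType01 (σ s) (W s) → IsType01 (σ t) (W t))

/-- `∇_X 𝐉 = 0` for all real horizontal `X`: for each vertical vector field `Y` over the slit domain
of a chart, `∇_X(𝐉Y) = 𝐉(∇_X Y)`. In the coordinates `(z;v)`, the canonical complex structure `𝐉` of
`T^{1,0}M` acts on vertical vectors as multiplication by `i`. -/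
def IsHorizontallyParallelJ (F : TangentBundle 𝓘(ℂ, Model n) M → ℝ) : Prop :=
  ∀ e ∈ holCharts n M, ∀ u ∈ slitDomain e, ∀ X ∈ horizontalSpace (localExpr F e) u,
    ∀ Y : Model n × Model n → Model n, ContDiffOn ℝ ∞ Y (slitDomain e) →
      cartanCov (localExpr F e) u X (fun w => Complex.I • Y w)
        = Complex.I • cartanCov (localExpr F e) u X Y

end Global

end

end ComplexFinsler

open ComplexFinsler

/-! In a chart let G be the spray of F² and let N(a) = `dirD (0, a) G` be its nonlinear connection,
which depends on the fibre point y. All four assertions are equivalent to one local condition,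
`HasComplexNonlin`: N(a) is complex linear in a, that is, the spray is holomorphic along the
punctured fibres.

Parallel transport and N. Contracting the horizontal Cartan coefficients with y gives N
(`christoffel_snd`, `parallel_term`). Along σ the parallel equation therefore reads V' + N(V) = 0
with N taken at σ'. If N is complex linear, J maps solutions to solutions, and uniqueness for this
linear equation turns that into preservation of types. Conversely, solutions with arbitrary initial
value exist along short coordinate lines; preservation of types, differentiated at the initial time,
gives N(ia) = iN(a). The condition ∇J = 0, evaluated on the horizontal lift of y itself, gives the
same identity.

From complex linearity to Kähler–Berwald. F² is constant along the real horizontal directions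
(`horizontal_deriv`). Complex linearity turns this into N^α_μ G_α = ∂F²/∂z^μ. Since N is holomorphic
on the fibres, ∂/∂v̄^τ passes through its coefficients, so N is the Chern–Finsler nonlinear
connection. A further ∂/∂v^β identifies Γ^α_{β;μ} with the second fibre derivative of G^α in the
directions β and μ (`chernHor_of_complexNonlin`). It is thus symmetric in β and μ, and also
holomorphic and homogeneous of degree zero on the punctured fibre, so constant there by Liouville
(`constant_of_homogeneous_zero`).

From Kähler–Berwald to complex linearity. The Γ^α_{β;μ} at a base point are the coefficients of a
symmetric complex bilinear map B, and F² is constant along the horizontal directions that B defines.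
Uniqueness of the spray forces G = ½B(y,y), N(a) = B(y,a), and makes B the horizontal Cartan
connection (`nonlin_eq_bilinear`, `christoffel_eq_bilinear`). This gives assertions (3) and (4). -/

namespace ComplexFinsler

/-! ### Directional derivatives -/

section DirectionalDerivative

variable {X Y A B : Type*} [NormedAddCommGroup X] [NormedSpace ℝ X] [NormedAddCommGroup Y]
  [NormedSpace ℝ Y] [NormedAddCommGroup A] [NormedSpace ℝ A] [NormedAddCommGroup B]
  [NormedSpace ℝ B]

/-- The derivative of `f` in the constant direction `p`. -/
noncomputable def dirD (p : X) (f : X → A) (u : X) : A := fderiv ℝ f u p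

theorem dirD_add_dir (p q : X) (f : X → A) (u : X) :
    dirD (p + q) f u = dirD p f u + dirD q f u := map_add _ _ _

theorem dirD_sub_dir (p q : X) (f : X → A) (u : X) :
    dirD (p - q) f u = dirD p f u - dirD q f u := map_sub _ _ _

theorem dirD_neg_dir (p : X) (f : X → A) (u : X) : dirD (-p) f u = -dirD p f u := map_neg _ _

theorem dirD_smul_dir (c : ℝ) (p : X) (f : X → A) (u : X) :
    dirD (c • p) f u = c • dirD p f u := map_smul _ _ _

theorem dirD_zero_dir (f : X → A) (u : X) : dirD 0 f u = 0 := map_zero _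

theorem dirD_sum_dir {ι : Type*} (s : Finset ι) (p : ι → X) (f : X → A) (u : X) :
    dirD (∑ i ∈ s, p i) f u = ∑ i ∈ s, dirD (p i) f u := map_sum _ _ _

theorem dirD_congr {f g : X → A} {S : Set X} (hS : IsOpen S) (h : EqOn f g S) {u : X}
    (hu : u ∈ S) (p : X) : dirD p f u = dirD p g u := by
  have : f =ᶠ[nhds u] g := Filter.eventuallyEq_of_mem (hS.mem_nhds hu) h
  simp only [dirD, this.fderiv_eq]

theorem diffAt_of_smooth {f : X → A} {S : Set X} (hS : IsOpen S) (hf : ContDiffOn ℝ ∞ f S)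
    {u : X} (hu : u ∈ S) : DifferentiableAt ℝ f u :=
  (hf.contDiffAt (hS.mem_nhds hu)).differentiableAt (by simp)

theorem smooth_fderiv {f : X → A} {S : Set X} (hS : IsOpen S) (hf : ContDiffOn ℝ ∞ f S) :
    ContDiffOn ℝ ∞ (fderiv ℝ f) S :=
  hf.fderiv_of_isOpen hS (by simp)

theorem smooth_dirD {f : X → A} {S : Set X} (hS : IsOpen S) (hf : ContDiffOn ℝ ∞ f S) (p : X) :
    ContDiffOn ℝ ∞ (dirD p f) S :=
  (smooth_fderiv hS hf).clm_apply contDiffOn_const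

theorem dirD_dirD_eq {f : X → A} {S : Set X} (hS : IsOpen S) (hf : ContDiffOn ℝ ∞ f S) {u : X}
    (hu : u ∈ S) (p q : X) : dirD p (dirD q f) u = fderiv ℝ (fderiv ℝ f) u p q := by
  have h := (diffAt_of_smooth hS (smooth_fderiv hS hf) hu).hasFDerivAt.clm_apply
    (hasFDerivAt_const q u)
  have h' : fderiv ℝ (dirD q f) u = _ := h.fderiv
  simp [dirD, h']

theorem dirD_comm {f : X → A} {S : Set X} (hS : IsOpen S) (hf : ContDiffOn ℝ ∞ f S) {u : X}
    (hu : u ∈ S) (p q : X) : dirD p (dirD q f) u = dirD q (dirD p f) u := by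
  rw [dirD_dirD_eq hS hf hu, dirD_dirD_eq hS hf hu]
  exact (hf.contDiffAt (hS.mem_nhds hu)).isSymmSndFDerivAt
    (by rw [minSmoothness_of_isRCLikeNormedField]; exact WithTop.coe_le_coe.2 le_top) p q

theorem dirD_comp {f : Y → A} {φ : X → Y} {u : X} (hf : DifferentiableAt ℝ f (φ u))
    (hφ : DifferentiableAt ℝ φ u) (p : X) :
    dirD p (fun w => f (φ w)) u = dirD (dirD p φ u) f (φ u) := by
  have := (hf.hasFDerivAt.comp u hφ.hasFDerivAt).fderiv
  simp only [dirD]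
  rw [show fderiv ℝ (fun w => f (φ w)) u = _ from this]
  rfl

/-- Differentiation of a derivative taken in a variable direction. -/
theorem dirD_comp_var {f : Y → A} {S : Set Y} (hS : IsOpen S) (hf : ContDiffOn ℝ ∞ f S)
    {φ : X → Y} {V : X → Y} {u : X} (hu : φ u ∈ S) (hφ : DifferentiableAt ℝ φ u)
    (hV : DifferentiableAt ℝ V u) (p : X) :
    dirD p (fun w => dirD (V w) f (φ w)) u
      = dirD (dirD p φ u) (dirD (V u) f) (φ u) + dirD (dirD p V u) f (φ u) := by
  have h1 := (diffAt_of_smooth hS (smooth_fderiv hS hf) hu).hasFDerivAt.comp u hφ.hasFDerivAt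
  have h := h1.clm_apply hV.hasFDerivAt
  rw [dirD_dirD_eq hS hf hu]
  simp only [dirD]
  rw [show fderiv ℝ (fun w => fderiv ℝ f (φ w) (V w)) u = _ from h.fderiv]
  simp [add_comm]

theorem dirD_var {f : X → A} {S : Set X} (hS : IsOpen S) (hf : ContDiffOn ℝ ∞ f S)
    {V : X → X} {u : X} (hu : u ∈ S) (hV : DifferentiableAt ℝ V u) (p : X) :
    dirD p (fun w => dirD (V w) f w) u
      = dirD p (dirD (V u) f) u + dirD (dirD p V u) f u := by
  have := dirD_comp_var hS hf (φ := fun w => w) hu differentiableAt_id hV p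
  have e : dirD p (fun w : X => w) u = p := by simp [dirD]
  rwa [e] at this

theorem dirD_add {f g : X → A} {u : X} (hf : DifferentiableAt ℝ f u)
    (hg : DifferentiableAt ℝ g u) (p : X) :
    dirD p (fun w => f w + g w) u = dirD p f u + dirD p g u := by
  simp only [dirD]; rw [fderiv_fun_add hf hg]; rfl

theorem dirD_sub {f g : X → A} {u : X} (hf : DifferentiableAt ℝ f u)
    (hg : DifferentiableAt ℝ g u) (p : X) :
    dirD p (fun w => f w - g w) u = dirD p f u - dirD p g u := by
  simp only [dirD]; rw [fderiv_fun_sub hf hg]; rfl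

theorem dirD_const_smul {f : X → A} {u : X} (hf : DifferentiableAt ℝ f u) (c : ℝ) (p : X) :
    dirD p (fun w => c • f w) u = c • dirD p f u := by
  simp only [dirD]; rw [fderiv_fun_const_smul hf]; rfl

theorem dirD_const_mul {f : X → ℝ} {u : X} (hf : DifferentiableAt ℝ f u) (c : ℝ) (p : X) :
    dirD p (fun w => c * f w) u = c * dirD p f u :=
  dirD_const_smul hf c p

theorem dirD_const (a : A) (p u : X) : dirD p (fun _ => a) u = 0 := by
  simp [dirD]

theorem dirD_clm (L : X →L[ℝ] A) (p u : X) : dirD p (fun w => L w) u = L p := by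
  simp [dirD]

theorem dirD_clm_comp (L : A →L[ℝ] B) {f : X → A} {u : X} (hf : DifferentiableAt ℝ f u) (p : X) :
    dirD p (fun w => L (f w)) u = L (dirD p f u) := by
  simp only [dirD]
  rw [show fderiv ℝ (fun w => L (f w)) u = _ from (L.hasFDerivAt.comp u hf.hasFDerivAt).fderiv]
  rfl

theorem dirD_snd (p u : X × Y) : dirD p (fun w : X × Y => w.2) u = p.2 :=
  dirD_clm (ContinuousLinearMap.snd ℝ X Y) p u

theorem dirD_fst (p u : X × Y) : dirD p (fun w : X × Y => w.1) u = p.1 :=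
  dirD_clm (ContinuousLinearMap.fst ℝ X Y) p u

/-- A vertical derivative depends only on the restriction to the fibre. -/
theorem dirD_vert_eq {f : X × Y → A} {u : X × Y} (hf : DifferentiableAt ℝ f u) (c : Y) :
    dirD ((0, c) : X × Y) f u = dirD c (fun y => f (u.1, y)) u.2 := by
  have h2 : HasFDerivAt (fun y : Y => ((u.1, y) : X × Y)) (ContinuousLinearMap.inr ℝ X Y) u.2 :=
    hasFDerivAt_prodMk_right u.1 u.2
  have := (HasFDerivAt.comp u.2 (g := f) (f := fun y : Y => ((u.1, y) : X × Y))
    hf.hasFDerivAt h2).fderiv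
  simp only [dirD]
  rw [show fderiv ℝ (fun y => f (u.1, y)) u.2 = _ from this]
  rfl

/-- Allows vertical differentiation of an identity known on a single fibre only; the Berwald
condition provides its bilinear map one base point at a time. -/
theorem dirD_vert_congr {f g : X × Y → A} {u : X × Y} (hf : DifferentiableAt ℝ f u)
    (hg : DifferentiableAt ℝ g u) {T : Set Y} (hT : IsOpen T) (hu : u.2 ∈ T)
    (h : ∀ y ∈ T, f (u.1, y) = g (u.1, y)) (c : Y) :
    dirD ((0, c) : X × Y) f u = dirD ((0, c) : X × Y) g u := by
  rw [dirD_vert_eq hf, dirD_vert_eq hg]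
  exact dirD_congr hT h hu c

end DirectionalDerivative

/-! ### Sprays of homogeneous functions -/

section Spray

variable {E A : Type*} [NormedAddCommGroup E] [NormedSpace ℝ E]
  [NormedAddCommGroup A] [NormedSpace ℝ A]

/-- Euler's identity for functions that are positively homogeneous in the fibre variable. -/
theorem dirD_euler {f : E × E → A} {u : E × E} (hf : DifferentiableAt ℝ f u) (k : ℕ)
    (h : ∀ c : ℝ, 0 < c → f (u.1, c • u.2) = c ^ k • f u) :
    dirD (0, u.2) f u = (k : ℝ) • f u := by
  have h1 : HasDerivAt (fun c : ℝ => ((u.1, c • u.2) : E × E)) (0, u.2) 1 := by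
    have := (hasDerivAt_const (1 : ℝ) u.1).prodMk ((hasDerivAt_id (1 : ℝ)).smul_const u.2)
    simpa using this
  have e : ((u.1, (1 : ℝ) • u.2) : E × E) = u := by simp
  have h2 : HasDerivAt (fun c : ℝ => f (u.1, c • u.2)) (fderiv ℝ f u (0, u.2)) 1 := by
    refine HasFDerivAt.comp_hasDerivAt (l := f) (f := fun c : ℝ => ((u.1, c • u.2) : E × E))
      (1 : ℝ) ?_ h1
    rw [e]; exact hf.hasFDerivAt
  have h3 : HasDerivAt (fun c : ℝ => c ^ k • f u) ((k : ℝ) • f u) 1 := by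
    have := (hasDerivAt_pow k (1 : ℝ)).smul_const (f u)
    simpa using this
  have h4 : (fun c : ℝ => f (u.1, c • u.2)) =ᶠ[nhds 1] fun c : ℝ => c ^ k • f u := by
    filter_upwards [lt_mem_nhds (zero_lt_one' ℝ)] with c hc using h c hc
  exact h2.unique (h3.congr_of_eventuallyEq h4)

/-- The fibrewise scaling by `c`. -/
noncomputable def fibreScale (c : ℝ) : E × E →L[ℝ] E × E :=
  (ContinuousLinearMap.fst ℝ E E).prod (c • ContinuousLinearMap.snd ℝ E E)

theorem fibreScale_apply (c : ℝ) (u : E × E) : fibreScale c u = (u.1, c • u.2) := rfl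

/-- Chain rule along the linear map `fibreScale c`. It scales vertical directions and fixes
horizontal ones, so each vertical derivative lowers the degree of homogeneity by one. -/
theorem dirD_fibreScale {f : E × E → A} {S : Set (E × E)} (hS : IsOpen S)
    (hf : ContDiffOn ℝ ∞ f S) {c l : ℝ} (h : ∀ w ∈ S, f (fibreScale c w) = l • f w) {u : E × E}
    (hu : u ∈ S) (hcu : fibreScale c u ∈ S) (p : E × E) :
    dirD (fibreScale c p) f (fibreScale c u) = l • dirD p f u := by
  have h1 := dirD_comp (f := f) (φ := fun w => fibreScale c w) (u := u)
    (diffAt_of_smooth hS hf hcu) (fibreScale (E := E) c).differentiableAt p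
  rw [dirD_clm] at h1
  rw [← h1, ← dirD_const_smul (diffAt_of_smooth hS hf hu)]
  exact dirD_congr hS h hu p

/-- `G` is the spray of the function `H`, homogeneous of degree two on the fibres and with
nondegenerate fibre Hessian on the conic open set `S`. -/
structure IsSpray (S : Set (E × E)) (H : E × E → ℝ) (G : E × E → E) : Prop where
  isOpen : IsOpen S
  cone : ∀ u ∈ S, ∀ c : ℝ, 0 < c → fibreScale c u ∈ S
  smooth : ContDiffOn ℝ ∞ H S
  smoothG : ContDiffOn ℝ ∞ G S
  homog : ∀ u ∈ S, ∀ c : ℝ, 0 < c → H (fibreScale c u) = c ^ 2 * H u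
  eqn : ∀ u ∈ S, ∀ c, 2 * dirD (0, G u) (dirD (0, c) H) u
    = dirD (u.2, 0) (dirD (0, c) H) u - dirD (c, 0) H u
  nondeg : ∀ u ∈ S, ∀ w, (∀ c, dirD (0, w) (dirD (0, c) H) u = 0) → w = 0

variable {S : Set (E × E)} {H : E × E → ℝ} {G : E × E → E}

omit [NormedSpace ℝ E] in
theorem split_dir (b a : E) : ((b, a) : E × E) = (b, 0) + (0, a) := by simp

namespace IsSpray

theorem smooth1 (h : IsSpray S H G) (p : E × E) : ContDiffOn ℝ ∞ (dirD p H) S :=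
  smooth_dirD h.isOpen h.smooth p

theorem smooth2 (h : IsSpray S H G) (p q : E × E) : ContDiffOn ℝ ∞ (dirD p (dirD q H)) S :=
  smooth_dirD h.isOpen (h.smooth1 q) p

theorem diff {f : E × E → A} (h : IsSpray S H G) (hf : ContDiffOn ℝ ∞ f S) {u : E × E}
    (hu : u ∈ S) : DifferentiableAt ℝ f u := diffAt_of_smooth h.isOpen hf hu

theorem comm (h : IsSpray S H G) {u : E × E} (hu : u ∈ S) (p q : E × E) :
    dirD p (dirD q H) u = dirD q (dirD p H) u := dirD_comm h.isOpen h.smooth hu p q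

theorem comm12 (h : IsSpray S H G) {u : E × E} (hu : u ∈ S) (p q r : E × E) :
    dirD p (dirD q (dirD r H)) u = dirD q (dirD p (dirD r H)) u :=
  dirD_comm h.isOpen (h.smooth1 r) hu p q

theorem comm23 (h : IsSpray S H G) {u : E × E} (hu : u ∈ S) (p q r : E × E) :
    dirD p (dirD q (dirD r H)) u = dirD p (dirD r (dirD q H)) u :=
  dirD_congr h.isOpen (fun _ hw => h.comm hw q r) hu p

/-- Nondegeneracy of the fibre Hessian: formulas for the spray are proved with the index lowered,
without ever inverting the Hessian. -/
theorem eq_of_pairing (h : IsSpray S H G) {u : E × E} (hu : u ∈ S) {a b : E}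
    (hab : ∀ c, dirD (0, a) (dirD (0, c) H) u = dirD (0, b) (dirD (0, c) H) u) : a = b := by
  refine sub_eq_zero.1 (h.nondeg u hu _ fun c => ?_)
  have : ((0, a - b) : E × E) = (0, a) - (0, b) := by simp
  rw [this, dirD_sub_dir, hab, sub_self]

theorem euler (h : IsSpray S H G) {u : E × E} (hu : u ∈ S) : dirD (0, u.2) H u = 2 * H u := by
  have := dirD_euler (h.diff h.smooth hu) 2 fun c hc => h.homog u hu c hc
  simpa using this

/-- The derivative of Euler's identity. -/
theorem euler1 (h : IsSpray S H G) {u : E × E} (hu : u ∈ S) (p : E × E) :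
    dirD (0, u.2) (dirD p H) u = 2 * dirD p H u - dirD (0, p.2) H u := by
  have h1 := dirD_var h.isOpen h.smooth (V := fun w => (0, w.2)) hu (by fun_prop) p
  have h2 : dirD p (fun w : E × E => ((0, w.2) : E × E)) u = (0, p.2) :=
    dirD_clm ((0 : E × E →L[ℝ] E).prod (ContinuousLinearMap.snd ℝ E E)) p u
  have h3 : dirD p (fun w => dirD ((0, w.2) : E × E) H w) u = 2 * dirD p H u := by
    rw [← dirD_const_mul (h.diff h.smooth hu)]
    exact dirD_congr h.isOpen (fun w hw => h.euler hw) hu p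
  rw [h.comm hu, ← h3, h1, h2]; simp

theorem euler_vert (h : IsSpray S H G) {u : E × E} (hu : u ∈ S) (a : E) :
    dirD (0, u.2) (dirD (0, a) H) u = dirD (0, a) H u := by
  rw [h.euler1 hu]; ring

theorem euler_hor (h : IsSpray S H G) {u : E × E} (hu : u ∈ S) (b : E) :
    dirD (0, u.2) (dirD (b, 0) H) u = 2 * dirD (b, 0) H u := by
  rw [h.euler1 hu]
  have := dirD_zero_dir H u
  simp only [Prod.zero_eq_mk] at this
  simp [this]

/-- The direction `u.2` is frozen here, whereas in Euler's identity it moves with the point; the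
subtracted term is the derivative of that moving direction. -/
theorem euler2 (h : IsSpray S H G) {u : E × E} (hu : u ∈ S) (p : E × E) (a : E) :
    dirD p (dirD (0, u.2) (dirD (0, a) H)) u
      = dirD p (dirD (0, a) H) u - dirD (0, p.2) (dirD (0, a) H) u := by
  have h1 := dirD_var h.isOpen (h.smooth1 (0, a)) (V := fun w => (0, w.2)) hu (by fun_prop) p
  have h2 : dirD p (fun w : E × E => ((0, w.2) : E × E)) u = (0, p.2) :=
    dirD_clm ((0 : E × E →L[ℝ] E).prod (ContinuousLinearMap.snd ℝ E E)) p u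
  have h3 : dirD p (fun w => dirD ((0, w.2) : E × E) (dirD (0, a) H) w) u
      = dirD p (dirD (0, a) H) u :=
    dirD_congr h.isOpen (fun w hw => h.euler_vert hw a) hu p
  rw [← h3, h1, h2]; simp

theorem scale1 (h : IsSpray S H G) {u : E × E} (hu : u ∈ S) {c : ℝ} (hc : 0 < c) (p : E × E) :
    dirD (fibreScale c p) H (fibreScale c u) = c ^ 2 * dirD p H u :=
  dirD_fibreScale h.isOpen h.smooth (l := c ^ 2) (fun w hw => h.homog w hw c hc) hu
    (h.cone u hu c hc) p

theorem scale2 (h : IsSpray S H G) {u : E × E} (hu : u ∈ S) {c : ℝ} (hc : 0 < c)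
    (p q : E × E) :
    dirD (fibreScale c q) (dirD (fibreScale c p) H) (fibreScale c u)
      = c ^ 2 * dirD q (dirD p H) u := by
  have h1 := dirD_comp (f := dirD (fibreScale c p) H) (φ := fun w => fibreScale c w) (u := u)
    (h.diff (h.smooth1 _) (h.cone u hu c hc)) (fibreScale (E := E) c).differentiableAt q
  rw [dirD_clm] at h1
  rw [← h1, ← dirD_const_mul (h.diff (h.smooth1 p) hu)]
  exact dirD_congr h.isOpen (fun w hw => h.scale1 hw hc p) hu q

theorem dir_vert_smul (c : ℝ) (a : E) : ((0, c • a) : E × E) = c • (0, a) := by simp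

theorem dir_hor_smul (c : ℝ) (a : E) : ((c • a, 0) : E × E) = c • (a, 0) := by simp

/-- The spray is positively homogeneous of degree two. -/
theorem spray_homog (h : IsSpray S H G) {u : E × E} (hu : u ∈ S) {c : ℝ} (hc : 0 < c) :
    G (fibreScale c u) = c ^ 2 • G u := by
  have hcu := h.cone u hu c hc
  have hc0 : c ≠ 0 := hc.ne'
  have vert : ∀ a b, dirD (0, a) (dirD (0, b) H) (fibreScale c u)
      = dirD (0, a) (dirD (0, b) H) u := by
    intro a b
    -- The directions are divided by c so that the scaling returns a and b; the two factors c⁻¹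
    -- cancel c², so the fibre Hessian has degree zero.
    have := h.scale2 hu hc (0, c⁻¹ • b) (0, c⁻¹ • a)
    simp only [fibreScale_apply, smul_smul, mul_inv_cancel₀ hc0, one_smul] at this
    rw [fibreScale_apply, this, dir_vert_smul, dirD_smul_dir, h.comm hu, dir_vert_smul,
      dirD_smul_dir, h.comm hu]
    simp only [smul_eq_mul]
    field_simp
  refine h.eq_of_pairing hcu fun e => ?_
  have e1 := h.eqn _ hcu e
  have e2 := h.eqn u hu e
  have e3 := h.scale2 hu hc (0, c⁻¹ • e) (u.2, 0)
  have e4 := h.scale1 hu hc (e, 0)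
  simp only [fibreScale_apply, smul_smul, mul_inv_cancel₀ hc0, one_smul, smul_zero] at e3 e4
  simp only [fibreScale_apply] at e1 vert ⊢
  rw [vert, dir_hor_smul, dirD_smul_dir, e3, e4, h.comm hu (u.2, 0), dir_vert_smul c⁻¹,
    dirD_smul_dir, h.comm hu _ (u.2, 0)] at e1
  rw [vert, vert, dir_vert_smul (c ^ 2), dirD_smul_dir]
  simp only [smul_eq_mul] at e1 ⊢
  field_simp at e1
  linear_combination (1 / 2) * e1 - c ^ 2 / 2 * e2

/-- Euler's identity for the spray. -/
theorem nonlin_euler (h : IsSpray S H G) {u : E × E} (hu : u ∈ S) :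
    dirD (0, u.2) G u = (2 : ℝ) • G u := by
  have := dirD_euler (h.diff h.smoothG hu) 2 fun c hc => h.spray_homog hu hc
  simpa using this

theorem nonlin_homog (h : IsSpray S H G) {u : E × E} (hu : u ∈ S) {c : ℝ} (hc : 0 < c) (a : E) :
    dirD (0, a) G (fibreScale c u) = c • dirD (0, a) G u := by
  have := dirD_fibreScale h.isOpen h.smoothG (fun w hw => h.spray_homog hw hc) hu
    (h.cone u hu c hc) (0, c⁻¹ • a)
  simp only [fibreScale_apply, smul_smul, mul_inv_cancel₀ hc.ne', one_smul] at this
  rw [fibreScale_apply, this, dir_vert_smul, dirD_smul_dir, smul_smul]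
  congr 1
  field_simp

/-- The fibre Hessian of the spray is positively homogeneous of degree zero. -/
theorem berwald_homog (h : IsSpray S H G) {u : E × E} (hu : u ∈ S) {c : ℝ} (hc : 0 < c)
    (a b : E) : dirD (0, b) (dirD (0, a) G) (fibreScale c u) = dirD (0, b) (dirD (0, a) G) u := by
  have := dirD_fibreScale h.isOpen (smooth_dirD h.isOpen h.smoothG (0, a))
    (fun w hw => h.nonlin_homog hw hc a) hu (h.cone u hu c hc) (0, c⁻¹ • b)
  simp only [fibreScale_apply, smul_smul, mul_inv_cancel₀ hc.ne', one_smul] at this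
  rw [fibreScale_apply, this, dir_vert_smul, dirD_smul_dir, smul_smul, mul_inv_cancel₀ hc.ne',
    one_smul]

/-- The fibre derivative of the spray equation. -/
theorem nonlin_eqn (h : IsSpray S H G) {u : E × E} (hu : u ∈ S) (a c : E) :
    2 * dirD (0, a) (dirD (0, G u) (dirD (0, c) H)) u
        + 2 * dirD (0, dirD (0, a) G u) (dirD (0, c) H) u
      = dirD (a, 0) (dirD (0, c) H) u + dirD (0, a) (dirD (u.2, 0) (dirD (0, c) H)) u
        - dirD (0, a) (dirD (c, 0) H) u := by
  have dG : DifferentiableAt ℝ G u := h.diff h.smoothG hu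
  have d1 : DifferentiableAt ℝ (fun w => ((0, G w) : E × E)) u :=
    (differentiableAt_const _).prodMk dG
  have d2 : DifferentiableAt ℝ (fun w : E × E => ((w.2, 0) : E × E)) u := by fun_prop
  have h1 := dirD_var h.isOpen (h.smooth1 (0, c)) (V := fun w => (0, G w)) hu d1 (0, a)
  have h2 := dirD_var h.isOpen (h.smooth1 (0, c)) (V := fun w => (w.2, 0)) hu d2 (0, a)
  have e1 : dirD (0, a) (fun w => ((0, G w) : E × E)) u = (0, dirD (0, a) G u) :=
    dirD_clm_comp (ContinuousLinearMap.inr ℝ E E) dG _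
  have e2 : dirD (0, a) (fun w : E × E => ((w.2, 0) : E × E)) u = (a, 0) :=
    dirD_clm ((ContinuousLinearMap.snd ℝ E E).prod (0 : E × E →L[ℝ] E)) _ u
  rw [e1] at h1
  rw [e2] at h2
  have f1 : DifferentiableAt ℝ (fun w => dirD ((0, G w) : E × E) (dirD (0, c) H) w) u :=
    DifferentiableAt.clm_apply (h.diff (smooth_fderiv h.isOpen (h.smooth1 (0, c))) hu) d1
  have f2 : DifferentiableAt ℝ (fun w => dirD ((w.2, 0) : E × E) (dirD (0, c) H) w) u :=
    DifferentiableAt.clm_apply (h.diff (smooth_fderiv h.isOpen (h.smooth1 (0, c))) hu) d2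
  have key := dirD_congr h.isOpen (fun w hw => h.eqn w hw c) hu (0, a)
  rw [dirD_const_mul f1, dirD_sub f2 (h.diff (h.smooth1 _) hu), h1, h2] at key
  linarith

/-- The function is constant along the horizontal directions. -/
theorem horizontal_deriv (h : IsSpray S H G) {u : E × E} (hu : u ∈ S) (a : E) :
    dirD (a, 0) H u = dirD (0, dirD (0, a) G u) H u := by
  -- Pairing with the fibre variable itself: Euler's identity then reduces every second derivative
  -- to a first one or cancels it.
  have key := h.nonlin_eqn hu a u.2
  have i1 : dirD (0, dirD (0, a) G u) (dirD (0, u.2) H) u = dirD (0, dirD (0, a) G u) H u := by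
    rw [h.comm hu, h.euler_vert hu]
  have i2 : dirD (a, 0) (dirD (0, u.2) H) u = 2 * dirD (a, 0) H u := by
    rw [h.comm hu, h.euler_hor hu]
  have i3 : dirD (0, a) (dirD (0, G u) (dirD (0, u.2) H)) u = 0 := by
    rw [h.comm23 hu, h.euler2 hu, sub_self]
  have i4 : dirD (0, a) (dirD (u.2, 0) (dirD (0, u.2) H)) u = dirD (0, a) (dirD (u.2, 0) H) u := by
    have z : dirD ((0, 0) : E × E) (dirD (0, a) H) u = 0 := dirD_zero_dir _ u
    rw [h.comm12 hu, h.comm23 hu, h.euler2 hu, h.comm hu, z, sub_zero]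
  rw [i1, i2, i3, i4] at key
  linarith

/-- The right-hand side of the Christoffel formula for the horizontal Cartan connection. -/
noncomputable def christoffel (H : E × E → ℝ) (G : E × E → E) (u : E × E) (a b c : E) : ℝ :=
  dirD (b, -dirD (0, b) G u) (dirD (0, c) (dirD (0, a) H)) u
    - dirD (c, -dirD (0, c) G u) (dirD (0, a) (dirD (0, b) H)) u
    + dirD (a, -dirD (0, a) G u) (dirD (0, b) (dirD (0, c) H)) u

/-- The Cartan coefficients contracted with the fibre variable are the nonlinear connection. -/
theorem christoffel_snd (h : IsSpray S H G) {u : E × E} (hu : u ∈ S) (a c : E) :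
    christoffel H G u a u.2 c = 2 * dirD (0, dirD (0, a) G u) (dirD (0, c) H) u := by
  have key := h.nonlin_eqn hu a c
  have hz : ∀ x y : E, dirD (x, -y) (dirD (0, u.2) (dirD (0, c) H)) u
      = dirD (x, 0) (dirD (0, c) H) u := by
    intro x y
    rw [h.euler2 hu, split_dir, dirD_add_dir]; simp
  have hz' : dirD (c, -dirD (0, c) G u) (dirD (0, a) (dirD (0, u.2) H)) u
      = dirD (c, 0) (dirD (0, a) H) u := by
    rw [h.comm23 hu, h.euler2 hu, split_dir, dirD_add_dir]; simp
  have h3 : dirD (u.2, -dirD (0, u.2) G u) (dirD (0, c) (dirD (0, a) H)) u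
      = dirD (0, a) (dirD (u.2, 0) (dirD (0, c) H)) u
        - 2 * dirD (0, a) (dirD (0, G u) (dirD (0, c) H)) u := by
    -- The horizontal lift of the fibre variable is the spray direction (y, -2G), because G has
    -- degree two.
    have : ((u.2, -dirD (0, u.2) G u) : E × E) = (u.2, 0) - (2 : ℝ) • (0, G u) := by
      rw [h.nonlin_euler hu]; simp
    rw [this, dirD_sub_dir, dirD_smul_dir, h.comm23 hu (u.2, 0), h.comm23 hu (0, G u),
      h.comm12 hu (0, a), h.comm12 hu (0, a), smul_eq_mul]
  rw [christoffel, hz, hz', h3, h.comm hu (c, 0)]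
  linarith

/-! ### Sprays of functions that are constant along a fibrewise linear symmetric connection -/

section Berwald

variable {z : E} {T : Set E} {B : E →L[ℝ] E →L[ℝ] E}

theorem bilinear_deriv (h : IsSpray S H G) (hT : IsOpen T) (hTS : ∀ y ∈ T, (z, y) ∈ S)
    (hB : ∀ y ∈ T, ∀ b, dirD (b, 0) H (z, y) = dirD (0, B y b) H (z, y)) {y : E} (hy : y ∈ T)
    (b c : E) : dirD (0, c) (dirD (b, 0) H) (z, y)
      = dirD (0, B y b) (dirD (0, c) H) (z, y) + dirD (0, B c b) H (z, y) := by
  have hu := hTS y hy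
  have dB : DifferentiableAt ℝ (fun w : E × E => ((0, B w.2 b) : E × E)) (z, y) := by fun_prop
  have d2 : DifferentiableAt ℝ (fun w : E × E => dirD ((0, B w.2 b) : E × E) H w) (z, y) :=
    DifferentiableAt.clm_apply (h.diff (smooth_fderiv h.isOpen h.smooth) hu) dB
  rw [dirD_vert_congr (h.diff (h.smooth1 _) hu) d2 hT hy (fun x hx => hB x hx b) c,
    dirD_var h.isOpen h.smooth hu dB, h.comm hu]
  congr 2
  exact dirD_clm ((0 : E × E →L[ℝ] E).prod
    ((ContinuousLinearMap.flip B b).comp (ContinuousLinearMap.snd ℝ E E))) _ _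

/-- If `H` is constant along the horizontal directions of a symmetric fibrewise linear
connection, then its spray is the one of that connection. -/
theorem spray_eq_bilinear (h : IsSpray S H G) (hT : IsOpen T) (hTS : ∀ y ∈ T, (z, y) ∈ S)
    (hsymm : ∀ a b, B a b = B b a)
    (hB : ∀ y ∈ T, ∀ b, dirD (b, 0) H (z, y) = dirD (0, B y b) H (z, y)) {y : E} (hy : y ∈ T) :
    G (z, y) = (1 / 2 : ℝ) • B y y := by
  have hu := hTS y hy
  refine h.eq_of_pairing hu fun c => ?_
  have e1 := h.eqn _ hu c
  have e2 := h.bilinear_deriv hT hTS hB hy y c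
  have e3 := hB y hy c
  rw [h.comm hu] at e2
  rw [hsymm y c] at e3
  rw [dir_vert_smul, dirD_smul_dir, smul_eq_mul]
  simp only at e1
  linarith

/-- The derivative of ½B(y,y) in the direction a is ½(B(y,a) + B(a,y)); symmetry merges the two
halves. -/
theorem nonlin_eq_bilinear (h : IsSpray S H G) (hT : IsOpen T) (hTS : ∀ y ∈ T, (z, y) ∈ S)
    (hsymm : ∀ a b, B a b = B b a)
    (hB : ∀ y ∈ T, ∀ b, dirD (b, 0) H (z, y) = dirD (0, B y b) H (z, y)) {y : E} (hy : y ∈ T)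
    (a : E) : dirD (0, a) G (z, y) = B y a := by
  have hu := hTS y hy
  have d : DifferentiableAt ℝ (fun w : E × E => B w.2 w.2) (z, y) := by fun_prop
  rw [dirD_vert_congr (h.diff h.smoothG hu) (d.fun_const_smul (1 / 2 : ℝ)) hT hy
    (fun x hx => h.spray_eq_bilinear hT hTS hsymm hB hx) a, dirD_const_smul d, dirD_vert_eq d]
  have k := ((B.hasFDerivAt (x := y)).clm_apply (hasFDerivAt_id y)).fderiv
  simp only [dirD]
  rw [show fderiv ℝ (fun x => B x x) y = _ from k]
  simp [hsymm a y, ← two_smul ℝ (B y a), smul_smul]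

/-- Two fibre derivatives of `hB` say that B is compatible with the fibre Hessian. In the
Christoffel combination the symmetry of B cancels four of the six resulting terms, as in the
uniqueness of the Levi-Civita connection. -/
theorem christoffel_eq_bilinear (h : IsSpray S H G) (hT : IsOpen T)
    (hTS : ∀ y ∈ T, (z, y) ∈ S) (hsymm : ∀ a b, B a b = B b a)
    (hB : ∀ y ∈ T, ∀ b, dirD (b, 0) H (z, y) = dirD (0, B y b) H (z, y)) {y : E} (hy : y ∈ T)
    (a b c : E) :
    christoffel H G (z, y) a b c = 2 * dirD (0, B a b) (dirD (0, c) H) (z, y) := by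
  have hu := hTS y hy
  have key : ∀ a b c, dirD (b, -dirD (0, b) G (z, y)) (dirD (0, a) (dirD (0, c) H)) (z, y)
      = dirD (0, B a b) (dirD (0, c) H) (z, y) + dirD (0, B c b) (dirD (0, a) H) (z, y) := by
    intro a b c
    have dB : DifferentiableAt ℝ (fun w : E × E => ((0, B w.2 b) : E × E)) (z, y) := by fun_prop
    have d2 : DifferentiableAt ℝ
        (fun w : E × E => dirD ((0, B w.2 b) : E × E) (dirD (0, c) H) w) (z, y) :=
      DifferentiableAt.clm_apply (h.diff (smooth_fderiv h.isOpen (h.smooth1 _)) hu) dB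
    have d3 : DifferentiableAt ℝ (dirD (0, B c b) H) (z, y) := h.diff (h.smooth1 _) hu
    have e := dirD_vert_congr (h.diff (h.smooth2 (0, c) (b, 0)) hu) (d2.fun_add d3) hT hy
      (fun x hx => h.bilinear_deriv hT hTS hB hx b c) a
    have e' : dirD (0, a) (fun w : E × E => ((0, B w.2 b) : E × E)) (z, y) = (0, B a b) :=
      dirD_clm ((0 : E × E →L[ℝ] E).prod
        ((ContinuousLinearMap.flip B b).comp (ContinuousLinearMap.snd ℝ E E))) _ _
    rw [dirD_add d2 d3, dirD_var h.isOpen (h.smooth1 _) hu dB, e', h.comm23 hu, h.comm12 hu,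
      h.comm12 hu (0, a) (0, B y b), h.comm hu (0, a) (0, B c b)] at e
    have sp : ((b, -dirD (0, b) G (z, y)) : E × E) = (b, 0) - (0, B y b) := by
      rw [h.nonlin_eq_bilinear hT hTS hsymm hB hy]; simp
    rw [sp, dirD_sub_dir]
    linarith
  rw [christoffel, key, key, key, hsymm b a, hsymm c a, hsymm c b,
    h.comm hu (0, B a b) (0, c)]
  rw [h.comm hu (0, c)]
  ring

end Berwald

/-- Needed to restrict to the overlap of two charts, where the transformation laws are applied. -/
theorem mono (h : IsSpray S H G) {S' : Set (E × E)} (hS' : IsOpen S') (hsub : S' ⊆ S)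
    (hcone : ∀ u ∈ S', ∀ c : ℝ, 0 < c → fibreScale c u ∈ S') : IsSpray S' H G where
  isOpen := hS'
  cone := hcone
  smooth := h.smooth.mono hsub
  smoothG := h.smoothG.mono hsub
  homog u hu := h.homog u (hsub hu)
  eqn u hu := h.eqn u (hsub hu)
  nondeg u hu := h.nondeg u (hsub hu)

end IsSpray

/-- The map of tangent vectors induced by a change of coordinates. -/
noncomputable def tangentLift (φ : E → E) (w : E × E) : E × E := (φ w.1, dirD w.2 φ w.1)

theorem differentiableAt_dirD_fst {φ : E → E} {Ω : Set E} (hΩ : IsOpen Ω)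
    (hφ : ContDiffOn ℝ ∞ φ Ω) {u : E × E} (hu : u.1 ∈ Ω) {V : E × E → E}
    (hV : DifferentiableAt ℝ V u) : DifferentiableAt ℝ (fun w => dirD (V w) φ w.1) u :=
  DifferentiableAt.clm_apply
    ((diffAt_of_smooth hΩ (smooth_fderiv hΩ hφ) hu).comp u differentiableAt_fst) hV

theorem dirD_dirD_fst {φ : E → E} {Ω : Set E} (hΩ : IsOpen Ω) (hφ : ContDiffOn ℝ ∞ φ Ω)
    {u : E × E} (hu : u.1 ∈ Ω) {V : E × E → E} (hV : DifferentiableAt ℝ V u) (p : E × E) :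
    dirD p (fun w => dirD (V w) φ w.1) u
      = dirD p.1 (dirD (V u) φ) u.1 + dirD (dirD p V u) φ u.1 := by
  have := dirD_comp_var hΩ hφ (φ := fun w : E × E => w.1) hu differentiableAt_fst hV p
  rwa [dirD_fst] at this

theorem dirD_prodMk {X B : Type*} [NormedAddCommGroup X] [NormedSpace ℝ X] [NormedAddCommGroup B]
    [NormedSpace ℝ B] {f : X → A} {g : X → B} {u : X} (hf : DifferentiableAt ℝ f u)
    (hg : DifferentiableAt ℝ g u) (p : X) :
    dirD p (fun w => (f w, g w)) u = (dirD p f u, dirD p g u) := by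
  simp only [dirD]; rw [hf.fderiv_prodMk hg]; rfl

theorem differentiableAt_tangentLift {φ : E → E} {Ω : Set E} (hΩ : IsOpen Ω)
    (hφ : ContDiffOn ℝ ∞ φ Ω) {u : E × E} (hu : u.1 ∈ Ω) :
    DifferentiableAt ℝ (tangentLift φ) u :=
  ((diffAt_of_smooth hΩ hφ hu).comp u differentiableAt_fst).prodMk
    (differentiableAt_dirD_fst hΩ hφ hu differentiableAt_snd)

theorem dirD_tangentLift {φ : E → E} {Ω : Set E} (hΩ : IsOpen Ω) (hφ : ContDiffOn ℝ ∞ φ Ω)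
    {u : E × E} (hu : u.1 ∈ Ω) (p : E × E) :
    dirD p (tangentLift φ) u
      = (dirD p.1 φ u.1, dirD p.1 (dirD u.2 φ) u.1 + dirD p.2 φ u.1) := by
  have h1 := dirD_prodMk (u := u) ((diffAt_of_smooth hΩ hφ hu).comp u differentiableAt_fst)
    (differentiableAt_dirD_fst hΩ hφ hu differentiableAt_snd) p
  have h2 := dirD_comp (f := φ) (φ := fun w : E × E => w.1) (u := u)
    (diffAt_of_smooth hΩ hφ hu) differentiableAt_fst p
  have h3 := dirD_dirD_fst hΩ hφ hu (V := fun w => w.2) differentiableAt_snd p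
  rw [dirD_fst] at h2
  rw [dirD_snd] at h3
  refine h1.trans ?_
  rw [h3]
  exact congrArg (fun x => (x, _)) h2

/-! ### Transformation laws under changes of coordinates -/

section Transform

variable {S' : Set (E × E)} {H' : E × E → ℝ} {G' : E × E → E} {φ : E → E} {Ω : Set E}

/-- Transformation of the spray under a change of coordinates. -/
theorem IsSpray.transform (h : IsSpray S H G) (h' : IsSpray S' H' G') (hΩ : IsOpen Ω)
    (hφ : ContDiffOn ℝ ∞ φ Ω) (hS : ∀ u ∈ S, u.1 ∈ Ω) (hT : ∀ u ∈ S, tangentLift φ u ∈ S')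
    (hH : ∀ u ∈ S, H u = H' (tangentLift φ u))
    (hsurj : ∀ u ∈ S, Function.Surjective fun a => dirD a φ u.1) {u : E × E} (hu : u ∈ S) :
    G' (tangentLift φ u) = dirD (G u) φ u.1 - (1 / 2 : ℝ) • dirD u.2 (dirD u.2 φ) u.1 := by
  have hz := hS u hu
  have a1 : ∀ w ∈ S, ∀ p, dirD p H w = dirD (dirD p (tangentLift φ) w) H' (tangentLift φ w) := by
    intro w hw p
    rw [← dirD_comp (h'.diff h'.smooth (hT w hw)) (differentiableAt_tangentLift hΩ hφ (hS w hw))]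
    exact dirD_congr h.isOpen hH hw p
  have a2 : ∀ q c, dirD q (dirD (0, c) H) u
      = dirD (dirD q (tangentLift φ) u) (dirD (0, dirD c φ u.1) H') (tangentLift φ u)
        + dirD (0, dirD q.1 (dirD c φ) u.1) H' (tangentLift φ u) := by
    intro q c
    have dV : DifferentiableAt ℝ (fun w : E × E => dirD c φ w.1) u :=
      differentiableAt_dirD_fst hΩ hφ hz (differentiableAt_const c)
    have e0 : EqOn (dirD (0, c) H)
        (fun w => dirD ((0, dirD c φ w.1) : E × E) H' (tangentLift φ w)) S := by
      intro w hw
      rw [a1 w hw, dirD_tangentLift hΩ hφ (hS w hw)]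
      simp [dirD_zero_dir]
    rw [dirD_congr h.isOpen e0 hu, dirD_comp_var h'.isOpen h'.smooth (hT u hu)
      (differentiableAt_tangentLift hΩ hφ hz) ((differentiableAt_const 0).prodMk dV),
      dirD_prodMk (differentiableAt_const _) dV, dirD_const,
      dirD_dirD_fst hΩ hφ hz (differentiableAt_const c), dirD_const, dirD_zero_dir, add_zero]
  refine h'.eq_of_pairing (hT u hu) fun c' => ?_
  -- Every test direction in the new coordinates is the image of an old one, so the two spray
  -- equations can be compared.
  obtain ⟨c, rfl⟩ := hsurj u hu c'
  have e1 := h'.eqn _ (hT u hu) (dirD c φ u.1)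
  have e2 := h.eqn u hu c
  rw [a2, a2, a1 u hu, dirD_tangentLift hΩ hφ hz, dirD_tangentLift hΩ hφ hz,
    dirD_tangentLift hΩ hφ hz] at e2
  simp only [dirD_zero_dir, zero_add, add_zero] at e2
  rw [dirD_comm hΩ hφ hz c u.2, split_dir (dirD u.2 φ u.1), dirD_add_dir,
    split_dir (dirD c φ u.1), dirD_add_dir] at e2
  have z : dirD ((0, 0) : E × E) H' (tangentLift φ u) = 0 := dirD_zero_dir _ _
  rw [z] at e2
  have e3 : ((0, dirD (G u) φ u.1 - (1 / 2 : ℝ) • dirD u.2 (dirD u.2 φ) u.1) : E × E)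
      = (0, dirD (G u) φ u.1) - (1 / 2 : ℝ) • (0, dirD u.2 (dirD u.2 φ) u.1) := by simp
  rw [e3, dirD_sub_dir, dirD_smul_dir, smul_eq_mul]
  have e4 : (tangentLift φ u).2 = dirD u.2 φ u.1 := rfl
  rw [e4] at e1
  linarith

/-- Transformation of the nonlinear connection under a change of coordinates. -/
theorem IsSpray.transform_nonlin (h : IsSpray S H G) (h' : IsSpray S' H' G') (hΩ : IsOpen Ω)
    (hφ : ContDiffOn ℝ ∞ φ Ω) (hS : ∀ u ∈ S, u.1 ∈ Ω) (hT : ∀ u ∈ S, tangentLift φ u ∈ S')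
    (hH : ∀ u ∈ S, H u = H' (tangentLift φ u))
    (hsurj : ∀ u ∈ S, Function.Surjective fun a => dirD a φ u.1) {u : E × E} (hu : u ∈ S)
    (a : E) :
    dirD (0, dirD a φ u.1) G' (tangentLift φ u)
      = dirD (dirD (0, a) G u) φ u.1 - dirD u.2 (dirD a φ) u.1 := by
  have hz := hS u hu
  have dG := h.diff h.smoothG hu
  have e1 : dirD (0, a) (fun w => G' (tangentLift φ w)) u
      = dirD (0, dirD a φ u.1) G' (tangentLift φ u) := by
    rw [dirD_comp (h'.diff h'.smoothG (hT u hu)) (differentiableAt_tangentLift hΩ hφ hz),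
      dirD_tangentLift hΩ hφ hz]
    simp [dirD_zero_dir]
  rw [← e1, dirD_congr h.isOpen (fun w hw => h.transform h' hΩ hφ hS hT hH hsurj hw) hu]
  have d1 : DifferentiableAt ℝ (fun w : E × E => dirD (G w) φ w.1) u :=
    differentiableAt_dirD_fst hΩ hφ hz dG
  have e2 : dirD (0, a) (fun w : E × E => dirD w.2 (dirD w.2 φ) w.1) u
      = (2 : ℝ) • dirD u.2 (dirD a φ) u.1 := by
    -- Written with the second Fréchet derivative, the expression is visibly quadratic in the fibre
    -- variable; its symmetry yields the factor 2, which cancels the ½ in the spray law.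
    have eq : EqOn (fun w : E × E => dirD w.2 (dirD w.2 φ) w.1)
        (fun w : E × E => fderiv ℝ (fderiv ℝ φ) w.1 w.2 w.2) (Ω ×ˢ univ) :=
      fun w hw => dirD_dirD_eq hΩ hφ hw.1 _ _
    rw [dirD_congr (hΩ.prod isOpen_univ) eq ⟨hz, trivial⟩]
    have k1 : DifferentiableAt ℝ (fun w : E × E => fderiv ℝ (fderiv ℝ φ) w.1) u :=
      (diffAt_of_smooth hΩ (smooth_fderiv hΩ (smooth_fderiv hΩ hφ)) hz).comp u
        differentiableAt_fst
    have k0 := dirD_vert_eq (f := fun w : E × E => fderiv ℝ (fderiv ℝ φ) w.1 w.2 w.2)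
      (u := u) ((k1.clm_apply differentiableAt_snd).clm_apply differentiableAt_snd) a
    rw [k0]
    have k2 := (((fderiv ℝ (fderiv ℝ φ) u.1).hasFDerivAt (x := u.2)).clm_apply
      (hasFDerivAt_id u.2)).fderiv
    simp only [dirD]
    rw [show fderiv ℝ (fun y => fderiv ℝ (fderiv ℝ φ) u.1 y y) u.2 = _ from k2]
    have k3 : fderiv ℝ (fun z => fderiv ℝ φ z a) u.1 u.2
        = fderiv ℝ (fderiv ℝ φ) u.1 u.2 a := dirD_dirD_eq hΩ hφ hz u.2 a
    have k4 : fderiv ℝ (fderiv ℝ φ) u.1 a u.2 = fderiv ℝ (fderiv ℝ φ) u.1 u.2 a := by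
      rw [← dirD_dirD_eq hΩ hφ hz, ← dirD_dirD_eq hΩ hφ hz, dirD_comm hΩ hφ hz]
    have k5 : fderiv ℝ (dirD a φ) u.1 u.2 = fderiv ℝ (fderiv ℝ φ) u.1 u.2 a := k3
    simp [k4, k5, two_smul]
  have d2 : DifferentiableAt ℝ (fun w : E × E => dirD w.2 (dirD w.2 φ) w.1) u := by
    have eq : (fun w : E × E => dirD w.2 (dirD w.2 φ) w.1) =ᶠ[nhds u]
        (fun w : E × E => fderiv ℝ (fderiv ℝ φ) w.1 w.2 w.2) :=
      Filter.eventuallyEq_of_mem ((hΩ.prod isOpen_univ).mem_nhds ⟨hz, trivial⟩)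
        fun w hw => dirD_dirD_eq hΩ hφ hw.1 _ _
    have k1 : DifferentiableAt ℝ (fun w : E × E => fderiv ℝ (fderiv ℝ φ) w.1) u :=
      (diffAt_of_smooth hΩ (smooth_fderiv hΩ (smooth_fderiv hΩ hφ)) hz).comp u
        differentiableAt_fst
    exact ((k1.clm_apply differentiableAt_snd).clm_apply
      differentiableAt_snd).congr_of_eventuallyEq eq
  rw [dirD_sub d1 (d2.fun_const_smul _), dirD_const_smul d2, e2, dirD_dirD_fst hΩ hφ hz dG]
  simp [dirD_zero_dir]

end Transform

end Spray

/-! ### Functions with complex linear derivative -/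

section Holomorphic

variable {E A : Type*} [NormedAddCommGroup E] [NormedSpace ℝ E] [NormedSpace ℂ E]
  [IsScalarTower ℝ ℂ E] [NormedAddCommGroup A] [NormedSpace ℝ A] [NormedSpace ℂ A]
  [IsScalarTower ℝ ℂ A]

theorem smul_eq_re_add_im (c : ℂ) (x : E) : c • x = c.re • x + c.im • (Complex.I • x) := by
  conv_lhs => rw [← Complex.re_add_im c, add_smul, mul_smul]
  have h : ∀ (r : ℝ) (y : E), ((r : ℂ)) • y = r • y := fun r y => by
    rw [show (r : ℂ) = r • (1 : ℂ) by simp, smul_assoc, one_smul]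
  rw [h, h]

/-- A real linear map that commutes with multiplication by `i` is complex linear. -/
theorem map_complex_smul (L : E →ₗ[ℝ] A) (hL : ∀ x, L (Complex.I • x) = Complex.I • L x)
    (c : ℂ) (x : E) : L (c • x) = c • L x := by
  rw [smul_eq_re_add_im c x, map_add, map_smul, map_smul, hL, smul_eq_re_add_im c (L x)]

/-- The Cauchy–Riemann equations make the real derivative complex linear, hence a complex
derivative. -/
theorem differentiableAt_complex {f : E → A} {v : E} (hf : DifferentiableAt ℝ f v)
    (h : ∀ c, dirD (Complex.I • c) f v = Complex.I • dirD c f v) : DifferentiableAt ℂ f v := by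
  let L : E →L[ℂ] A :=
    { toFun := fderiv ℝ f v
      map_add' := map_add _
      map_smul' := map_complex_smul (fderiv ℝ f v : E →ₗ[ℝ] A) h
      cont := (fderiv ℝ f v).cont }
  have : HasFDerivAt f L v :=
    hasFDerivAt_of_restrictScalars ℝ hf.hasFDerivAt (ContinuousLinearMap.ext fun _ => rfl)
  exact this.differentiableAt

theorem dirD_const_I_smul {X : Type*} [NormedAddCommGroup X] [NormedSpace ℝ X] {f : X → A} {v : X}
    (hf : DifferentiableAt ℝ f v) (p : X) :
    dirD p (fun w => Complex.I • f w) v = Complex.I • dirD p f v :=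
  dirD_clm_comp ((Complex.I • ContinuousLinearMap.id ℂ A).restrictScalars ℝ) hf p

/-- The derivatives of a function whose derivative in the direction `q'` is `i` times the one in
the direction `q` have the same property. -/
theorem dirD_hol {X : Type*} [NormedAddCommGroup X] [NormedSpace ℝ X] {f : X → A} {T : Set X}
    (hT : IsOpen T) (hf : ContDiffOn ℝ ∞ f T) {q q' : X}
    (h : ∀ v ∈ T, dirD q' f v = Complex.I • dirD q f v) {v : X} (hv : v ∈ T)
    (b : X) : dirD q' (dirD b f) v = Complex.I • dirD q (dirD b f) v := by
  rw [dirD_comm hT hf hv, dirD_congr hT h hv,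
    dirD_const_I_smul (diffAt_of_smooth hT (smooth_dirD hT hf q) hv), dirD_comm hT hf hv]

/-- A holomorphic function on the complement of the origin that is positively homogeneous of
degree zero is constant. -/
theorem constant_of_homogeneous_zero [ProperSpace E] {f : E → A}
    (hf : ContDiffOn ℝ ∞ f {v | v ≠ 0})
    (h : ∀ v ≠ 0, ∀ c, dirD (Complex.I • c) f v = Complex.I • dirD c f v)
    (h0 : ∀ v ≠ 0, ∀ c : ℝ, 0 < c → f (c • v) = f v) {v w : E} (hv : v ≠ 0) (hw : w ≠ 0) :
    f v = f w := by
  have hd : ∀ x : E, x ≠ 0 → DifferentiableAt ℂ f x := fun x hx =>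
    differentiableAt_complex (diffAt_of_smooth isOpen_ne hf hx) (h x hx)
  -- By degree-zero homogeneity, a bound on the unit sphere bounds f on the whole punctured space.
  obtain ⟨C, hC⟩ := (isCompact_sphere (0 : E) 1).exists_bound_of_continuousOn
    (f := f) (hf.continuousOn.mono fun x hx => by
      rintro rfl; simp at hx)
  have hb : ∀ x : E, x ≠ 0 → ‖f x‖ ≤ C := by
    intro x hx
    rw [← h0 x hx ‖x‖⁻¹ (by positivity)]
    refine hC _ ?_
    rw [mem_sphere_zero_iff_norm, norm_smul, norm_inv, norm_norm, inv_mul_cancel₀ (by simpa)]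
  -- Liouville's theorem along any entire curve that avoids the origin; it remains to join v and w
  -- by such a curve.
  have liou : ∀ g : ℂ → E, Differentiable ℂ g → (∀ s, g s ≠ 0) → ∀ s t, f (g s) = f (g t) := by
    intro g hg hg0 s t
    have d : Differentiable ℂ (fun s => f (g s)) := fun s => (hd _ (hg0 s)).comp s (hg s)
    refine d.apply_eq_apply_of_bounded ?_ s t
    refine isBounded_iff_forall_norm_le.2 ⟨C, ?_⟩
    rintro _ ⟨s, rfl⟩
    exact hb _ (hg0 s)
  -- If w is a multiple of v, the affine line joining them may meet the origin, so the curve exp(s)v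
  -- is used; otherwise the complex affine line through v and w avoids the origin.
  by_cases hl : ∃ l : ℂ, w = l • v
  · obtain ⟨l, rfl⟩ := hl
    have hl0 : l ≠ 0 := by rintro rfl; simp at hw
    have := liou (fun s => Complex.exp s • v) (by fun_prop)
      (fun s => smul_ne_zero (Complex.exp_ne_zero s) hv) 0 (Complex.log l)
    simpa [Complex.exp_log hl0] using this
  · have := liou (fun s => v + s • (w - v)) (by fun_prop) (fun s hs => ?_) 0 1
    · simpa using this
    · by_cases hs0 : s = 0
      · subst hs0; simp at hs; exact hv hs
      · refine hl ⟨1 - s⁻¹, ?_⟩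
        have : w - v = -(s⁻¹ • v) := by
          rw [eq_neg_iff_add_eq_zero, ← smul_right_injective E hs0 |>.eq_iff]
          simp only [smul_add, smul_zero, smul_inv_smul₀ hs0]
          rw [add_comm]; exact hs
        rw [sub_smul, one_smul, sub_eq_add_neg, ← this]; abel

end Holomorphic

/-! ### Wirtinger derivatives -/

section Wirtinger

variable {X : Type*} [NormedAddCommGroup X] [NormedSpace ℝ X] [NormedSpace ℂ X]
  [IsScalarTower ℝ ℂ X]

/-- The `(1,0)` part of the derivative of `f` in the direction `p`. -/
noncomputable def wirt (p : X) (f : X → ℂ) (u : X) : ℂ :=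
  (1 / 2) * (dirD p f u - Complex.I * dirD (Complex.I • p) f u)

/-- The `(0,1)` part of the derivative of `f` in the direction `p`. -/
noncomputable def wirtBar (p : X) (f : X → ℂ) (u : X) : ℂ :=
  (1 / 2) * (dirD p f u + Complex.I * dirD (Complex.I • p) f u)

omit [IsScalarTower ℝ ℂ X] in
theorem dirD_I_smul_I_smul {A : Type*} [NormedAddCommGroup A] [NormedSpace ℝ A] (p : X)
    (f : X → A) (u : X) : dirD (Complex.I • Complex.I • p) f u = -dirD p f u := by
  rw [smul_smul, Complex.I_mul_I, neg_one_smul, dirD_neg_dir]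

theorem wirt_smul_dir (c : ℂ) (p : X) (f : X → ℂ) (u : X) :
    wirt (c • p) f u = c * wirt p f u := by
  simp only [wirt]
  rw [smul_comm Complex.I c p, smul_eq_re_add_im c p, smul_eq_re_add_im c (Complex.I • p)]
  simp only [dirD_add_dir, dirD_smul_dir, dirD_I_smul_I_smul, Complex.real_smul]
  conv_rhs => rw [← Complex.re_add_im c]
  ring_nf
  rw [Complex.I_sq]
  ring

theorem wirtBar_smul_dir (c : ℂ) (p : X) (f : X → ℂ) (u : X) :
    wirtBar (c • p) f u = starRingEnd ℂ c * wirtBar p f u := by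
  simp only [wirtBar]
  rw [smul_comm Complex.I c p, smul_eq_re_add_im c p, smul_eq_re_add_im c (Complex.I • p)]
  simp only [dirD_add_dir, dirD_smul_dir, dirD_I_smul_I_smul, Complex.real_smul]
  have : starRingEnd ℂ c = c.re - c.im * Complex.I := by
    apply Complex.ext <;> simp
  rw [this]
  ring_nf
  rw [Complex.I_sq]
  ring

omit [IsScalarTower ℝ ℂ X]

theorem wirt_add_dir (p q : X) (f : X → ℂ) (u : X) :
    wirt (p + q) f u = wirt p f u + wirt q f u := by
  simp only [wirt, smul_add, dirD_add_dir]; ring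

theorem wirt_neg_dir (p : X) (f : X → ℂ) (u : X) : wirt (-p) f u = -wirt p f u := by
  simp only [wirt, smul_neg, dirD_neg_dir]; ring

theorem wirt_sum_dir {ι : Type*} (s : Finset ι) (p : ι → X) (f : X → ℂ) (u : X) :
    wirt (∑ i ∈ s, p i) f u = ∑ i ∈ s, wirt (p i) f u := by
  simp only [wirt, Finset.smul_sum, dirD_sum_dir, Finset.mul_sum, ← Finset.sum_sub_distrib]

theorem wirtBar_sum_dir {ι : Type*} (s : Finset ι) (p : ι → X) (f : X → ℂ) (u : X) :
    wirtBar (∑ i ∈ s, p i) f u = ∑ i ∈ s, wirtBar (p i) f u := by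
  simp only [wirtBar, Finset.smul_sum, dirD_sum_dir, Finset.mul_sum, ← Finset.sum_add_distrib]

/-! ### Calculus rules for Wirtinger derivatives -/

section Rules

variable {S : Set X} (hS : IsOpen S) {f g : X → ℂ} {u : X}
include hS

theorem smooth_wirt (hf : ContDiffOn ℝ ∞ f S) (p : X) : ContDiffOn ℝ ∞ (wirt p f) S :=
  contDiffOn_const.mul ((smooth_dirD hS hf p).sub
    (contDiffOn_const.mul (smooth_dirD hS hf (Complex.I • p))))

theorem smooth_wirtBar (hf : ContDiffOn ℝ ∞ f S) (p : X) : ContDiffOn ℝ ∞ (wirtBar p f) S :=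
  contDiffOn_const.mul ((smooth_dirD hS hf p).add
    (contDiffOn_const.mul (smooth_dirD hS hf (Complex.I • p))))

theorem wirt_congr (h : EqOn f g S) (hu : u ∈ S) (p : X) : wirt p f u = wirt p g u := by
  simp only [wirt, dirD_congr hS h hu]

theorem wirtBar_congr (h : EqOn f g S) (hu : u ∈ S) (p : X) :
    wirtBar p f u = wirtBar p g u := by
  simp only [wirtBar, dirD_congr hS h hu]

omit hS [NormedSpace ℂ X] in
theorem dirD_mul_complex (hf : DifferentiableAt ℝ f u) (hg : DifferentiableAt ℝ g u) (p : X) :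
    dirD p (fun w => f w * g w) u = dirD p f u * g u + f u * dirD p g u := by
  simp only [dirD]
  rw [fderiv_fun_mul hf hg]
  simp [mul_comm, add_comm]

omit hS [NormedSpace ℂ X] in
theorem dirD_sum_complex {ι : Type*} {s : Finset ι} {f : ι → X → ℂ}
    (hf : ∀ i ∈ s, DifferentiableAt ℝ (f i) u) (p : X) :
    dirD p (fun w => ∑ i ∈ s, f i w) u = ∑ i ∈ s, dirD p (f i) u := by
  simp only [dirD]
  rw [fderiv_fun_sum hf]
  simp

omit hS in
/-- Leibniz rule for a sum of products. -/
theorem wirt_sum_mul {ι : Type*} {s : Finset ι} {f g : ι → X → ℂ}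
    (hf : ∀ i ∈ s, DifferentiableAt ℝ (f i) u) (hg : ∀ i ∈ s, DifferentiableAt ℝ (g i) u)
    (p : X) : wirt p (fun w => ∑ i ∈ s, f i w * g i w) u
      = ∑ i ∈ s, (wirt p (f i) u * g i u + f i u * wirt p (g i) u) := by
  simp only [wirt]
  rw [dirD_sum_complex (fun i hi => (hf i hi).fun_mul (hg i hi)),
    dirD_sum_complex (fun i hi => (hf i hi).fun_mul (hg i hi)), Finset.mul_sum,
    ← Finset.sum_sub_distrib, Finset.mul_sum]
  refine Finset.sum_congr rfl fun i hi => ?_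
  rw [dirD_mul_complex (hf i hi) (hg i hi), dirD_mul_complex (hf i hi) (hg i hi)]
  ring

omit hS in
theorem wirtBar_sum_mul {ι : Type*} {s : Finset ι} {f g : ι → X → ℂ}
    (hf : ∀ i ∈ s, DifferentiableAt ℝ (f i) u) (hg : ∀ i ∈ s, DifferentiableAt ℝ (g i) u)
    (p : X) : wirtBar p (fun w => ∑ i ∈ s, f i w * g i w) u
      = ∑ i ∈ s, (wirtBar p (f i) u * g i u + f i u * wirtBar p (g i) u) := by
  simp only [wirtBar]
  rw [dirD_sum_complex (fun i hi => (hf i hi).fun_mul (hg i hi)),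
    dirD_sum_complex (fun i hi => (hf i hi).fun_mul (hg i hi)), Finset.mul_sum,
    ← Finset.sum_add_distrib, Finset.mul_sum]
  refine Finset.sum_congr rfl fun i hi => ?_
  rw [dirD_mul_complex (hf i hi) (hg i hi), dirD_mul_complex (hf i hi) (hg i hi)]
  ring

omit hS [NormedSpace ℂ X] in
theorem dirD_lin_comb (c d : ℂ) (hf : DifferentiableAt ℝ f u) (hg : DifferentiableAt ℝ g u)
    (p : X) : dirD p (fun w => c * (f w + d * g w)) u = c * (dirD p f u + d * dirD p g u) := by
  simp only [dirD]
  rw [fderiv_const_mul (hf.fun_add (hg.const_mul d)), fderiv_fun_add hf (hg.const_mul d),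
    fderiv_const_mul hg]
  simp [mul_add]

theorem dirD_wirt (hf : ContDiffOn ℝ ∞ f S) (hu : u ∈ S) (p q : X) :
    dirD q (wirt p f) u
      = (1 / 2) * (dirD q (dirD p f) u - Complex.I * dirD q (dirD (Complex.I • p) f) u) := by
  have e : wirt p f = fun w => (1 / 2) * (dirD p f w + (-Complex.I) * dirD (Complex.I • p) f w) := by
    funext w; simp only [wirt]; ring
  rw [e, dirD_lin_comb _ _ (diffAt_of_smooth hS (smooth_dirD hS hf _) hu)
    (diffAt_of_smooth hS (smooth_dirD hS hf _) hu)]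
  ring

theorem dirD_wirtBar (hf : ContDiffOn ℝ ∞ f S) (hu : u ∈ S) (p q : X) :
    dirD q (wirtBar p f) u
      = (1 / 2) * (dirD q (dirD p f) u + Complex.I * dirD q (dirD (Complex.I • p) f) u) :=
  dirD_lin_comb _ _ (diffAt_of_smooth hS (smooth_dirD hS hf _) hu)
    (diffAt_of_smooth hS (smooth_dirD hS hf _) hu) q

theorem wirt_wirtBar_comm (hf : ContDiffOn ℝ ∞ f S) (hu : u ∈ S) (p q : X) :
    wirt p (wirtBar q f) u = wirtBar q (wirt p f) u := by
  rw [wirt, wirtBar, dirD_wirt hS hf hu, dirD_wirt hS hf hu, dirD_wirtBar hS hf hu,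
    dirD_wirtBar hS hf hu, dirD_comm hS hf hu p, dirD_comm hS hf hu p,
    dirD_comm hS hf hu (Complex.I • p), dirD_comm hS hf hu (Complex.I • p)]
  ring

theorem wirt_comm (hf : ContDiffOn ℝ ∞ f S) (hu : u ∈ S) (p q : X) :
    wirt p (wirt q f) u = wirt q (wirt p f) u := by
  rw [wirt, wirt, dirD_wirt hS hf hu, dirD_wirt hS hf hu, dirD_wirt hS hf hu,
    dirD_wirt hS hf hu, dirD_comm hS hf hu p, dirD_comm hS hf hu p,
    dirD_comm hS hf hu (Complex.I • p), dirD_comm hS hf hu (Complex.I • p)]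
  ring

end Rules

omit [NormedSpace ℂ X] in
theorem dirD_ofReal {f : X → ℝ} {u : X} (hf : DifferentiableAt ℝ f u) (p : X) :
    dirD p (fun w => ((f w : ℝ) : ℂ)) u = ((dirD p f u : ℝ) : ℂ) :=
  dirD_clm_comp Complex.ofRealCLM hf p

theorem wirt_ofReal {f : X → ℝ} {u : X} (hf : DifferentiableAt ℝ f u) (p : X) :
    wirt p (fun w => ((f w : ℝ) : ℂ)) u
      = (1 / 2) * (dirD p f u - Complex.I * dirD (Complex.I • p) f u) := by
  rw [wirt, dirD_ofReal hf, dirD_ofReal hf]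

theorem wirtBar_ofReal {f : X → ℝ} {u : X} (hf : DifferentiableAt ℝ f u) (p : X) :
    wirtBar p (fun w => ((f w : ℝ) : ℂ)) u
      = (1 / 2) * (dirD p f u + Complex.I * dirD (Complex.I • p) f u) := by
  rw [wirtBar, dirD_ofReal hf, dirD_ofReal hf]

/-- A real function with vanishing `(1,0)` derivative in the direction `p` has vanishing
derivatives in the directions `p` and `ip`. -/
theorem wirt_ofReal_eq_zero {f : X → ℝ} {u : X} (hf : DifferentiableAt ℝ f u) (p : X) :
    wirt p (fun w => ((f w : ℝ) : ℂ)) u = 0 ↔ dirD p f u = 0 ∧ dirD (Complex.I • p) f u = 0 := by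
  rw [wirt_ofReal hf]
  constructor
  · intro h
    have h1 := congrArg Complex.re h
    have h2 := congrArg Complex.im h
    simp at h1 h2
    exact ⟨h1, h2⟩
  · rintro ⟨h1, h2⟩
    simp [h1, h2]

theorem wirt_of_hol {f : X → ℂ} {u p : X}
    (h : dirD (Complex.I • p) f u = Complex.I * dirD p f u) : wirt p f u = dirD p f u := by
  rw [wirt, h, ← mul_assoc, Complex.I_mul_I]; ring

theorem wirtBar_of_hol {f : X → ℂ} {u p : X}
    (h : dirD (Complex.I • p) f u = Complex.I * dirD p f u) : wirtBar p f u = 0 := by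
  rw [wirtBar, h, ← mul_assoc, Complex.I_mul_I]; ring

theorem wirt_of_antihol {f : X → ℂ} {u p : X}
    (h : dirD (Complex.I • p) f u = -(Complex.I * dirD p f u)) : wirt p f u = 0 := by
  rw [wirt, h, mul_neg, ← mul_assoc, Complex.I_mul_I]; ring

end Wirtinger

/-! ### Real coordinates and the spray of a metric -/

section Coordinates

variable {n : ℕ}

theorem basisVec_inr (α : Fin n) :
    (basisVec (Sum.inr α) : Model n) = Complex.I • basisVec (Sum.inl α) := by
  ext β
  by_cases h : β = α <;> simp [basisVec, h]

theorem basisVec_inl_apply (α β : Fin n) :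
    (basisVec (Sum.inl α) : Model n) β = if β = α then 1 else 0 := by
  simp [basisVec]

/-- A real coordinate as a continuous linear form. -/
noncomputable def coordCLM (k : Fin n ⊕ Fin n) : Model n →L[ℝ] ℝ :=
  Sum.elim
    (fun α => Complex.reCLM.comp ((EuclideanSpace.proj (𝕜 := ℂ) α).restrictScalars ℝ))
    (fun α => Complex.imCLM.comp ((EuclideanSpace.proj (𝕜 := ℂ) α).restrictScalars ℝ)) k

theorem coordCLM_apply (k : Fin n ⊕ Fin n) (v : Model n) : coordCLM k v = coord v k := by
  rcases k with α | α <;> rfl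

theorem sum_smul_basisVec_inl (v : Model n) : ∑ α, v α • (basisVec (Sum.inl α) : Model n) = v := by
  ext β
  simp [basisVec_inl_apply]

theorem ofCoord_coord (v : Model n) : ofCoord (coord v) = v := by
  rw [ofCoord, Fintype.sum_sum_type, ← Finset.sum_add_distrib]
  conv_rhs => rw [← sum_smul_basisVec_inl v]
  refine Finset.sum_congr rfl fun α _ => ?_
  rw [basisVec_inr, smul_eq_re_add_im (v α)]
  rfl

theorem coord_basisVec (j k : Fin n ⊕ Fin n) :
    coord (basisVec j : Model n) k = if k = j then 1 else 0 := by
  rcases j with j | j <;> rcases k with k | k <;>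
    simp [coord, basisVec] <;> split_ifs <;> simp_all

theorem coord_ofCoord (c : Fin n ⊕ Fin n → ℝ) : coord (ofCoord c : Model n) = c := by
  funext k
  rw [← coordCLM_apply, ofCoord, map_sum]
  simp [coordCLM_apply, coord_basisVec]

theorem coord_injective {v w : Model n} (h : ∀ k, coord v k = coord w k) : v = w := by
  rw [← ofCoord_coord v, ← ofCoord_coord w, funext h]

theorem sum_coord_smul (v : Model n) : v = ∑ j, coord v j • basisVec j := (ofCoord_coord v).symm

theorem vert_expand (c : Model n) :
    ((0, c) : Model n × Model n) = ∑ j, coord c j • ((0, basisVec j) : Model n × Model n) := by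
  have h := congrArg (LinearMap.inr ℝ (Model n) (Model n)) (sum_coord_smul c)
  rw [map_sum] at h
  simpa using h

theorem hor_expand (c : Model n) :
    ((c, 0) : Model n × Model n) = ∑ j, coord c j • ((basisVec j, 0) : Model n × Model n) := by
  have h := congrArg (LinearMap.inl ℝ (Model n) (Model n)) (sum_coord_smul c)
  rw [map_sum] at h
  simpa using h

theorem dirD_vert_expand {A : Type*} [NormedAddCommGroup A] [NormedSpace ℝ A] (c : Model n)
    (f : Model n × Model n → A) (u : Model n × Model n) :
    dirD (0, c) f u = ∑ j, coord c j • dirD (0, basisVec j) f u := by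
  rw [vert_expand c, dirD_sum_dir]
  simp only [dirD_smul_dir]

theorem dirD_hor_expand {A : Type*} [NormedAddCommGroup A] [NormedSpace ℝ A] (c : Model n)
    (f : Model n × Model n → A) (u : Model n × Model n) :
    dirD (c, 0) f u = ∑ j, coord c j • dirD (basisVec j, 0) f u := by
  rw [hor_expand c, dirD_sum_dir]
  simp only [dirD_smul_dir]

/-- The entries of the inverse of a smooth family of invertible matrices are smooth. -/
theorem contDiffOn_inv_entry {ι X : Type*} [Fintype ι] [DecidableEq ι] [NormedAddCommGroup X]
    [NormedSpace ℝ X] {S : Set X} {A : X → Matrix ι ι ℝ}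
    (hA : ∀ i j, ContDiffOn ℝ ∞ (fun w => A w i j) S) (hdet : ∀ w ∈ S, (A w).det ≠ 0) (i j : ι) :
    ContDiffOn ℝ ∞ (fun w => (A w)⁻¹ i j) S := by
  have hd : ∀ B : X → Matrix ι ι ℝ, (∀ i j, ContDiffOn ℝ ∞ (fun w => B w i j) S) →
      ContDiffOn ℝ ∞ (fun w => (B w).det) S := by
    intro B hB
    simp only [Matrix.det_apply]
    refine ContDiffOn.sum fun σ _ => ?_
    refine ContDiffOn.const_smul _ ?_
    exact contDiffOn_prod fun k _ => hB _ _
  -- Cramer's rule: each entry of the inverse is a quotient of determinants, which are polynomial in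
  -- the entries.
  have e : (fun w => (A w)⁻¹ i j)
      = fun w => (A w).det⁻¹ * ((A w).updateRow j (Pi.single i 1)).det := by
    funext w
    rw [Matrix.inv_def, Matrix.smul_apply, Matrix.adjugate_apply, Ring.inverse_eq_inv', smul_eq_mul]
  rw [e]
  refine ((hd A hA).inv hdet).mul (hd _ fun k l => ?_)
  by_cases hk : k = j
  · subst hk; simpa using contDiffOn_const
  · simpa [Matrix.updateRow_ne hk] using hA k l

/-- The data of a strongly convex complex Finsler metric in coordinates over `Ω`. -/
structure IsLocalMetric (Ω : Set (Model n)) (F : Model n × Model n → ℝ) : Prop where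
  isOpen : IsOpen Ω
  smooth : ContDiffOn ℝ ∞ F (Ω ×ˢ {v | v ≠ 0})
  homog : ∀ z ∈ Ω, ∀ (c : ℂ) (v : Model n), F (z, c • v) = ‖c‖ * F (z, v)
  posDef : ∀ u ∈ Ω ×ˢ {v : Model n | v ≠ 0}, (realTensor F u).PosDef

/-- The spray as a vector. -/
noncomputable def sprayVec (F : Model n × Model n → ℝ) (u : Model n × Model n) : Model n :=
  ofCoord fun k => realSpray F k u

variable {Ω : Set (Model n)} {F : Model n × Model n → ℝ}

theorem realTensor_apply (F : Model n × Model n → ℝ) (u : Model n × Model n)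
    (j k : Fin n ⊕ Fin n) :
    realTensor F u j k = (1 / 2) * dirD (0, basisVec j) (dirD (0, basisVec k) (sqF F)) u := rfl

namespace IsLocalMetric

theorem isOpen_slit (h : IsLocalMetric Ω F) : IsOpen (Ω ×ˢ {v : Model n | v ≠ 0}) :=
  h.isOpen.prod isOpen_ne

theorem smooth_sq (h : IsLocalMetric Ω F) : ContDiffOn ℝ ∞ (sqF F) (Ω ×ˢ {v | v ≠ 0}) :=
  h.smooth.pow 2

variable {u : Model n × Model n}

theorem hess_comm (h : IsLocalMetric Ω F) (hu : u ∈ Ω ×ˢ {v : Model n | v ≠ 0})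
    (p q : Model n × Model n) :
    dirD p (dirD q (sqF F)) u = dirD q (dirD p (sqF F)) u :=
  dirD_comm h.isOpen_slit h.smooth_sq hu p q

theorem hess_expand (h : IsLocalMetric Ω F) (hu : u ∈ Ω ×ˢ {v : Model n | v ≠ 0})
    (p : Model n × Model n) (c : Model n) :
    dirD p (dirD (0, c) (sqF F)) u
      = ∑ l, coord c l * dirD p (dirD (0, basisVec l) (sqF F)) u := by
  rw [h.hess_comm hu, dirD_vert_expand]
  exact Finset.sum_congr rfl fun l _ => by rw [h.hess_comm hu p, smul_eq_mul]

theorem realTensor_det_ne_zero (h : IsLocalMetric Ω F) (hu : u ∈ Ω ×ˢ {v : Model n | v ≠ 0}) :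
    (realTensor F u).det ≠ 0 := (h.posDef u hu).det_pos.ne'

theorem hess_pos (h : IsLocalMetric Ω F) (hu : u ∈ Ω ×ˢ {v : Model n | v ≠ 0}) {a : Model n}
    (ha : a ≠ 0) : 0 < dirD (0, a) (dirD (0, a) (sqF F)) u := by
  have hne : coord a ≠ 0 := by
    intro h0
    apply ha
    rw [← ofCoord_coord a, h0]; simp [ofCoord]
  have := (h.posDef u hu).dotProduct_mulVec_pos hne
  rw [dirD_vert_expand]
  simp only [dotProduct, Matrix.mulVec, realTensor_apply, Pi.star_apply, star_trivial] at this
  refine lt_of_lt_of_eq (mul_pos two_pos this) ?_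
  rw [Finset.mul_sum]
  refine Finset.sum_congr rfl fun j _ => ?_
  rw [h.hess_expand hu, smul_eq_mul, Finset.mul_sum, Finset.mul_sum, Finset.mul_sum]
  exact Finset.sum_congr rfl fun k _ => by ring

/-- Lowering the index of a vector given by raising an index. -/
theorem hess_raise (h : IsLocalMetric Ω F) (hu : u ∈ Ω ×ˢ {v : Model n | v ≠ 0}) (r : ℝ)
    (R : Fin n ⊕ Fin n → ℝ) (l : Fin n ⊕ Fin n) :
    dirD (0, ofCoord fun k => r * ∑ m, (realTensor F u)⁻¹ k m * R m)
      (dirD (0, basisVec l) (sqF F)) u = 2 * r * R l := by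
  have hinv : realTensor F u * (realTensor F u)⁻¹ = 1 :=
    Matrix.mul_nonsing_inv _ (h.realTensor_det_ne_zero hu).isUnit
  have key : ∀ m, ∑ k, realTensor F u l k * (realTensor F u)⁻¹ k m = if l = m then 1 else 0 :=
    fun m => by
      have := congrFun (congrFun hinv l) m
      rwa [Matrix.mul_apply, Matrix.one_apply] at this
  rw [dirD_vert_expand, coord_ofCoord]
  have e : ∀ k, dirD (0, basisVec k) (dirD (0, basisVec l) (sqF F)) u
      = 2 * realTensor F u l k := fun k => by
    rw [realTensor_apply, h.hess_comm hu]; ring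
  simp only [e, smul_eq_mul]
  calc ∑ k, (r * ∑ m, (realTensor F u)⁻¹ k m * R m) * (2 * realTensor F u l k)
      = ∑ k, ∑ m, 2 * r * R m * (realTensor F u l k * (realTensor F u)⁻¹ k m) := by
        refine Finset.sum_congr rfl fun k _ => ?_
        rw [Finset.mul_sum, Finset.sum_mul]
        exact Finset.sum_congr rfl fun m _ => by ring
    _ = ∑ m, 2 * r * R m * ∑ k, (realTensor F u l k * (realTensor F u)⁻¹ k m) := by
        rw [Finset.sum_comm]
        simp only [Finset.mul_sum]
    _ = 2 * r * R l := by simp [key]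

theorem sprayVec_eqn (h : IsLocalMetric Ω F) (hu : u ∈ Ω ×ˢ {v : Model n | v ≠ 0})
    (c : Model n) :
    2 * dirD (0, sprayVec F u) (dirD (0, c) (sqF F)) u
      = dirD (u.2, 0) (dirD (0, c) (sqF F)) u - dirD (c, 0) (sqF F) u := by
  have hb : ∀ l, 2 * dirD (0, sprayVec F u) (dirD (0, basisVec l) (sqF F)) u
      = dirD (u.2, 0) (dirD (0, basisVec l) (sqF F)) u - dirD (basisVec l, 0) (sqF F) u := by
    intro l
    have := h.hess_raise hu (1 / 4)
      (fun l => (∑ a, dX a (dY l (sqF F)) u * coord u.2 a) - dX l (sqF F) u) l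
    have e : dirD (0, sprayVec F u) (dirD (0, basisVec l) (sqF F)) u = _ := this
    have e2 : ∑ a, dX a (dY l (sqF F)) u * coord u.2 a
        = dirD (u.2, 0) (dirD (0, basisVec l) (sqF F)) u := by
      rw [dirD_hor_expand u.2]
      exact Finset.sum_congr rfl fun a _ => by rw [smul_eq_mul, mul_comm]; rfl
    rw [e, e2]
    have e3 : dX l (sqF F) u = dirD (basisVec l, 0) (sqF F) u := rfl
    rw [e3]; ring
  rw [h.hess_expand hu, h.hess_expand hu, dirD_hor_expand c, Finset.mul_sum,
    ← Finset.sum_sub_distrib]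
  refine Finset.sum_congr rfl fun l _ => ?_
  have := hb l
  rw [smul_eq_mul]
  linear_combination coord c l * this

theorem smooth_sprayVec (h : IsLocalMetric Ω F) :
    ContDiffOn ℝ ∞ (sprayVec F) (Ω ×ˢ {v | v ≠ 0}) := by
  have hS := h.isOpen_slit
  have hinv : ∀ k l, ContDiffOn ℝ ∞ (fun w => (realTensor F w)⁻¹ k l) (Ω ×ˢ {v | v ≠ 0}) :=
    fun k l => contDiffOn_inv_entry (fun i j => contDiffOn_const.mul
      (smooth_dirD hS (smooth_dirD hS h.smooth_sq _) _))
      (fun w hw => h.realTensor_det_ne_zero hw) k l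
  have hc : ∀ a, ContDiff ℝ ∞ fun w : Model n × Model n => coord w.2 a := fun a => by
    rw [show (fun w : Model n × Model n => coord w.2 a) = fun w =>
      ((coordCLM a).comp (ContinuousLinearMap.snd ℝ (Model n) (Model n))) w from
      funext fun w => (coordCLM_apply a w.2).symm]
    exact ContinuousLinearMap.contDiff _
  have e : sprayVec F = fun w => ∑ k, realSpray F k w • basisVec k := rfl
  rw [e]
  refine ContDiffOn.sum fun k _ => ContDiffOn.fun_smul ?_ contDiffOn_const
  refine contDiffOn_const.mul (ContDiffOn.sum fun l _ => (hinv k l).mul (ContDiffOn.sub ?_ ?_))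
  · exact ContDiffOn.sum fun a _ =>
      (smooth_dirD hS (smooth_dirD hS h.smooth_sq _) _).mul (hc a).contDiffOn
  · exact smooth_dirD hS h.smooth_sq _

/-- The bridge from index formulas to invariant calculus: nondegeneracy comes from positive
definiteness, and degree two from homogeneity under positive real scalars. -/
theorem isSpray (h : IsLocalMetric Ω F) :
    IsSpray (Ω ×ˢ {v : Model n | v ≠ 0}) (sqF F) (sprayVec F) where
  isOpen := h.isOpen_slit
  cone := fun u hu c hc => ⟨hu.1, smul_ne_zero hc.ne' hu.2⟩
  smooth := h.smooth_sq
  smoothG := h.smooth_sprayVec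
  homog := fun u hu c hc => by
    have := h.homog u.1 hu.1 (c : ℂ) u.2
    have e : (c : ℂ) • u.2 = c • u.2 := by rw [smul_eq_re_add_im]; simp
    rw [e] at this
    rw [fibreScale_apply, sqF, sqF, this, mul_pow]
    simp
  eqn := fun u hu c => h.sprayVec_eqn hu c
  nondeg := fun u hu w hw => by
    by_contra hne
    exact (h.hess_pos hu hne).ne' (hw w)

/-- The metric is invariant under rotation of the fibres. -/
theorem dirD_rot (h : IsLocalMetric Ω F) (hu : u ∈ Ω ×ˢ {v : Model n | v ≠ 0}) :
    dirD (0, Complex.I • u.2) (sqF F) u = 0 := by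
  have h1 : HasDerivAt (fun t : ℝ => Complex.exp (t * Complex.I)) Complex.I 0 := by
    have := (((hasDerivAt_id (0 : ℝ)).ofReal_comp).mul_const Complex.I).cexp
    simpa using this
  have h2 : HasDerivAt (fun t : ℝ => ((u.1, Complex.exp (t * Complex.I) • u.2) :
      Model n × Model n)) (0, Complex.I • u.2) 0 := by
    have := (hasDerivAt_const (0 : ℝ) u.1).prodMk (h1.smul_const u.2)
    simpa using this
  have e : ((u.1, Complex.exp ((0 : ℝ) * Complex.I) • u.2) : Model n × Model n) = u := by simp
  have h3 : HasDerivAt (fun t : ℝ => sqF F (u.1, Complex.exp (t * Complex.I) • u.2))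
      (fderiv ℝ (sqF F) u (0, Complex.I • u.2)) 0 := by
    refine HasFDerivAt.comp_hasDerivAt (l := sqF F) (0 : ℝ) ?_ h2
    rw [e]; exact (diffAt_of_smooth h.isOpen_slit h.smooth_sq hu).hasFDerivAt
  have h4 : (fun t : ℝ => sqF F (u.1, Complex.exp (t * Complex.I) • u.2))
      = fun _ => sqF F u := by
    funext t
    rw [sqF, h.homog u.1 hu.1, Complex.norm_exp_ofReal_mul_I, one_mul, sqF]
  rw [h4] at h3
  exact h3.unique (hasDerivAt_const _ _)

theorem realNonlin_eq (h : IsLocalMetric Ω F) (hu : u ∈ Ω ×ˢ {v : Model n | v ≠ 0})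
    (k j : Fin n ⊕ Fin n) :
    realNonlin F k j u = coord (dirD (0, basisVec j) (sprayVec F) u) k := by
  rw [← coordCLM_apply, ← dirD_clm_comp (coordCLM k) (h.isSpray.diff h.smooth_sprayVec hu)]
  have e : (fun w => coordCLM k (sprayVec F w)) = realSpray F k := by
    funext w; rw [coordCLM_apply, sprayVec, coord_ofCoord]
  rw [e]; rfl

theorem deltaVec_eq (h : IsLocalMetric Ω F) (hu : u ∈ Ω ×ˢ {v : Model n | v ≠ 0})
    (j : Fin n ⊕ Fin n) :
    deltaVec F u j = (basisVec j, -dirD (0, basisVec j) (sprayVec F) u) := by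
  rw [deltaVec]
  congr 2
  rw [← ofCoord_coord (dirD (0, basisVec j) (sprayVec F) u)]
  congr 1
  funext k
  exact h.realNonlin_eq hu k j

theorem deltaX_eq (h : IsLocalMetric Ω F) (hu : u ∈ Ω ×ˢ {v : Model n | v ≠ 0})
    (j : Fin n ⊕ Fin n) (f : Model n × Model n → ℝ) :
    deltaX F j f u = dirD (basisVec j, -dirD (0, basisVec j) (sprayVec F) u) f u := by
  have e : ((basisVec j, -dirD (0, basisVec j) (sprayVec F) u) : Model n × Model n)
      = (basisVec j, 0) - (0, dirD (0, basisVec j) (sprayVec F) u) := by simp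
  rw [e, dirD_sub_dir, dirD_vert_expand (dirD (0, basisVec j) (sprayVec F) u), deltaX]
  congr 1
  exact Finset.sum_congr rfl fun k _ => by rw [h.realNonlin_eq hu, smul_eq_mul]; rfl

/-- Lowering the index removes the inverse matrix; the constants reflect that the fibre Hessian of
F² is twice the fundamental tensor. -/
theorem cartanHor_pairing (h : IsLocalMetric Ω F) (hu : u ∈ Ω ×ˢ {v : Model n | v ≠ 0})
    (j l s : Fin n ⊕ Fin n) :
    2 * dirD (0, ofCoord fun k => cartanHor F k j l u) (dirD (0, basisVec s) (sqF F)) u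
      = IsSpray.christoffel (sqF F) (sprayVec F) u (basisVec j) (basisVec l) (basisVec s) := by
  have := h.hess_raise hu (1 / 2) (fun s => deltaX F l (fun w => realTensor F w s j) u
      - deltaX F s (fun w => realTensor F w j l) u
      + deltaX F j (fun w => realTensor F w l s) u) s
  have e : dirD (0, ofCoord fun k => cartanHor F k j l u) (dirD (0, basisVec s) (sqF F)) u = _ :=
    this
  have e2 : ∀ a b p, dirD p (fun w => realTensor F w a b) u
      = (1 / 2) * dirD p (dirD (0, basisVec a) (dirD (0, basisVec b) (sqF F))) u := fun a b p =>
    dirD_const_mul (h.isSpray.diff (h.isSpray.smooth2 _ _) hu) _ p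
  rw [e, h.deltaX_eq hu, h.deltaX_eq hu, h.deltaX_eq hu, e2, e2, e2, IsSpray.christoffel]
  ring

theorem christoffel_expand (h : IsLocalMetric Ω F) (hu : u ∈ Ω ×ˢ {v : Model n | v ≠ 0})
    (a b c : Model n) :
    IsSpray.christoffel (sqF F) (sprayVec F) u a b c
      = ∑ l, coord b l * IsSpray.christoffel (sqF F) (sprayVec F) u a (basisVec l) c := by
  have hs := h.isSpray
  have e1 : ∀ f : Model n × Model n → ℝ, dirD (b, -dirD (0, b) (sprayVec F) u) f u
      = ∑ l, coord b l *
        dirD (basisVec l, -dirD (0, basisVec l) (sprayVec F) u) f u := by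
    intro f
    have : ((b, -dirD (0, b) (sprayVec F) u) : Model n × Model n)
        = ∑ l, coord b l • (basisVec l, -dirD (0, basisVec l) (sprayVec F) u) := by
      refine Prod.ext ?_ ?_
      · rw [Prod.fst_sum]; exact sum_coord_smul b
      · rw [Prod.snd_sum, dirD_vert_expand b, ← Finset.sum_neg_distrib]
        simp
    rw [this, dirD_sum_dir]
    simp only [dirD_smul_dir, smul_eq_mul]
  have e2 : ∀ p a, dirD p (dirD (0, b) (dirD (0, a) (sqF F))) u
      = ∑ l, coord b l * dirD p (dirD (0, basisVec l) (dirD (0, a) (sqF F))) u := by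
    intro p a
    rw [hs.comm12 hu, dirD_vert_expand]
    exact Finset.sum_congr rfl fun l _ => by rw [smul_eq_mul, hs.comm12 hu]
  simp only [IsSpray.christoffel, mul_add, mul_sub, Finset.sum_add_distrib, Finset.sum_sub_distrib]
  rw [e1, e2, hs.comm23 hu _ (0, a) (0, b), e2]
  congr 2
  exact Finset.sum_congr rfl fun l _ => by rw [hs.comm23 hu _ (0, a)]

theorem hess_ext (h : IsLocalMetric Ω F) (hu : u ∈ Ω ×ˢ {v : Model n | v ≠ 0}) {a b : Model n}
    (hab : ∀ s, dirD (0, a) (dirD (0, basisVec s) (sqF F)) u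
      = dirD (0, b) (dirD (0, basisVec s) (sqF F)) u) : a = b := by
  refine h.isSpray.eq_of_pairing hu fun c => ?_
  rw [h.hess_expand hu, h.hess_expand hu]
  simp only [hab]

/-- The Cartan coefficients contracted with the fibre variable are the nonlinear connection. -/
theorem cartanHor_contract (h : IsLocalMetric Ω F) (hu : u ∈ Ω ×ˢ {v : Model n | v ≠ 0})
    (k j : Fin n ⊕ Fin n) :
    ∑ l, cartanHor F k j l u * coord u.2 l
      = coord (dirD (0, basisVec j) (sprayVec F) u) k := by
  have key : (∑ l, coord u.2 l • ofCoord (fun k => cartanHor F k j l u) : Model n)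
      = dirD (0, basisVec j) (sprayVec F) u := by
    refine h.hess_ext hu fun s => ?_
    have h1 := h.isSpray.christoffel_snd hu (basisVec j) (basisVec s)
    rw [h.christoffel_expand hu] at h1
    simp only [← h.cartanHor_pairing hu] at h1
    have e : ((0, ∑ l, coord u.2 l • ofCoord (fun k => cartanHor F k j l u)) :
        Model n × Model n) = ∑ l, coord u.2 l • (0, ofCoord (fun k => cartanHor F k j l u)) := by
      refine Prod.ext ?_ ?_
      · simp [Prod.fst_sum]
      · simp [Prod.snd_sum]
    rw [e, dirD_sum_dir]
    simp only [dirD_smul_dir, smul_eq_mul]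
    have h2 : ∑ l, coord u.2 l * (2 * dirD (0, ofCoord fun k => cartanHor F k j l u)
        (dirD (0, basisVec s) (sqF F)) u) = 2 * ∑ l, coord u.2 l *
        dirD (0, ofCoord fun k => cartanHor F k j l u) (dirD (0, basisVec s) (sqF F)) u := by
      rw [Finset.mul_sum]; exact Finset.sum_congr rfl fun l _ => by ring
    rw [h2] at h1
    linarith
  rw [← key, ← coordCLM_apply, map_sum]
  refine Finset.sum_congr rfl fun l _ => ?_
  rw [map_smul, coordCLM_apply, coord_ofCoord, smul_eq_mul, mul_comm]

/-- The connection term in the equation of parallel transport. -/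
theorem parallel_term (h : IsLocalMetric Ω F) (hu : u ∈ Ω ×ˢ {v : Model n | v ≠ 0})
    (a : Model n) (k : Fin n ⊕ Fin n) :
    ∑ l, ∑ j, coord a l * cartanHor F k l j u * coord u.2 j
      = coord (dirD (0, a) (sprayVec F) u) k := by
  rw [dirD_vert_expand a, ← coordCLM_apply, map_sum]
  refine Finset.sum_congr rfl fun l _ => ?_
  rw [map_smul, coordCLM_apply, ← h.cartanHor_contract hu, smul_eq_mul, Finset.mul_sum]
  exact Finset.sum_congr rfl fun j _ => by ring

end IsLocalMetric

end Coordinates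

/-! ### The Chern–Finsler side -/

section ChernFinsler

variable {n : ℕ}

theorem I_smul_inl_vert (α : Fin n) :
    Complex.I • ((0, basisVec (Sum.inl α)) : Model n × Model n) = (0, basisVec (Sum.inr α)) := by
  rw [Prod.smul_mk, smul_zero, basisVec_inr]

theorem I_smul_inl_hor (α : Fin n) :
    Complex.I • ((basisVec (Sum.inl α), 0) : Model n × Model n) = (basisVec (Sum.inr α), 0) := by
  rw [Prod.smul_mk, smul_zero, basisVec_inr]

theorem dV_eq_wirt (α : Fin n) (f : Model n × Model n → ℂ) :
    dV α f = wirt (0, basisVec (Sum.inl α)) f := by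
  funext u; rw [wirt, I_smul_inl_vert]; rfl

theorem dVbar_eq_wirtBar (α : Fin n) (f : Model n × Model n → ℂ) :
    dVbar α f = wirtBar (0, basisVec (Sum.inl α)) f := by
  funext u; rw [wirtBar, I_smul_inl_vert]; rfl

theorem dZ_eq_wirt (α : Fin n) (f : Model n × Model n → ℂ) :
    dZ α f = wirt (basisVec (Sum.inl α), 0) f := by
  funext u; rw [wirt, I_smul_inl_hor]; rfl

theorem complex_vert_expand (a : Model n) :
    ((0, a) : Model n × Model n) = ∑ α, a α • ((0, basisVec (Sum.inl α)) : Model n × Model n) := by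
  have h := congrArg (LinearMap.inr ℂ (Model n) (Model n)) (sum_smul_basisVec_inl a).symm
  rw [map_sum] at h
  simpa using h

theorem wirt_vert_expand (a : Model n) (f : Model n × Model n → ℂ) (u : Model n × Model n) :
    wirt (0, a) f u = ∑ α, a α * dV α f u := by
  rw [complex_vert_expand a, wirt_sum_dir]
  simp only [wirt_smul_dir, dV_eq_wirt]

theorem wirtBar_vert_expand (a : Model n) (f : Model n × Model n → ℂ) (u : Model n × Model n) :
    wirtBar (0, a) f u = ∑ α, starRingEnd ℂ (a α) * dVbar α f u := by
  rw [complex_vert_expand a, wirtBar_sum_dir]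
  simp only [wirtBar_smul_dir, dVbar_eq_wirtBar]

/-- The complex nonlinear connection applied to `∂/∂z^μ`. -/
noncomputable def chernVec (F : Model n × Model n → ℝ) (μ : Fin n) (u : Model n × Model n) :
    Model n := WithLp.toLp 2 fun α => chernNonlin F α μ u

theorem chernVec_apply (F : Model n × Model n → ℝ) (μ α : Fin n) (u : Model n × Model n) :
    chernVec F μ u α = chernNonlin F α μ u := rfl

theorem deltaZ_eq_wirt (F : Model n × Model n → ℝ) (μ : Fin n) (f : Model n × Model n → ℂ)
    (u : Model n × Model n) :
    deltaZ F μ f u = wirt (basisVec (Sum.inl μ), -chernVec F μ u) f u := by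
  have e : ((basisVec (Sum.inl μ), -chernVec F μ u) : Model n × Model n)
      = (basisVec (Sum.inl μ), 0) + -(0, chernVec F μ u) := by simp
  rw [e, wirt_add_dir, wirt_neg_dir, wirt_vert_expand, ← dZ_eq_wirt, ← sub_eq_add_neg]
  rfl

/-- The fibre coordinate `v^α`. -/
noncomputable def fibreCoord (α : Fin n) : Model n × Model n →L[ℝ] ℂ :=
  ((EuclideanSpace.proj (𝕜 := ℂ) α).comp
    (ContinuousLinearMap.snd ℂ (Model n) (Model n))).restrictScalars ℝ

theorem wirt_fibreCoord (α : Fin n) (p u : Model n × Model n) :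
    wirt p (fun w : Model n × Model n => w.2 α) u = p.2 α := by
  have h : ∀ q : Model n × Model n, dirD q (fun w : Model n × Model n => w.2 α) u = q.2 α :=
    fun q => dirD_clm (fibreCoord α) q u
  rw [wirt_of_hol, h]
  rw [h, h]; simp

theorem wirtBar_fibreCoord (α : Fin n) (p u : Model n × Model n) :
    wirtBar p (fun w : Model n × Model n => w.2 α) u = 0 := by
  have h : ∀ q : Model n × Model n, dirD q (fun w : Model n × Model n => w.2 α) u = q.2 α :=
    fun q => dirD_clm (fibreCoord α) q u
  rw [wirtBar_of_hol]
  rw [h, h]; simp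

theorem wirt_conj_fibreCoord (α : Fin n) (p u : Model n × Model n) :
    wirt p (fun w : Model n × Model n => starRingEnd ℂ (w.2 α)) u = 0 := by
  have h : ∀ q : Model n × Model n,
      dirD q (fun w : Model n × Model n => starRingEnd ℂ (w.2 α)) u = starRingEnd ℂ (q.2 α) :=
    fun q => dirD_clm ((Complex.conjCLE : ℂ →L[ℝ] ℂ).comp (fibreCoord α)) q u
  rw [wirt_of_antihol]
  rw [h, h]; simp

theorem differentiableAt_fibreCoord (α : Fin n) (u : Model n × Model n) :
    DifferentiableAt ℝ (fun w : Model n × Model n => w.2 α) u :=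
  (fibreCoord α).differentiableAt

theorem differentiableAt_conj_fibreCoord (α : Fin n) (u : Model n × Model n) :
    DifferentiableAt ℝ (fun w : Model n × Model n => starRingEnd ℂ (w.2 α)) u :=
  ((Complex.conjCLE : ℂ →L[ℝ] ℂ).comp (fibreCoord α)).differentiableAt

/-- Solving a linear system with the inverse matrix. -/
theorem vecMul_eq_iff {ι : Type*} [Fintype ι] [DecidableEq ι] {A : Matrix ι ι ℂ}
    (hA : A.det ≠ 0) (x y : ι → ℂ) :
    (∀ τ, ∑ α, y α * A α τ = x τ) ↔ ∀ α, y α = ∑ τ, A⁻¹ τ α * x τ := by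
  have h1 : A * A⁻¹ = 1 := Matrix.mul_nonsing_inv _ hA.isUnit
  have h2 : A⁻¹ * A = 1 := Matrix.nonsing_inv_mul _ hA.isUnit
  have e1 : (∀ τ, ∑ α, y α * A α τ = x τ) ↔ Matrix.vecMul y A = x := by
    rw [funext_iff]; rfl
  have e2 : (∀ α, y α = ∑ τ, A⁻¹ τ α * x τ) ↔ y = Matrix.vecMul x A⁻¹ := by
    rw [funext_iff]
    refine forall_congr' fun α => ?_
    simp only [Matrix.vecMul, dotProduct, mul_comm]
  rw [e1, e2]
  constructor
  · rintro rfl; rw [Matrix.vecMul_vecMul, h1, Matrix.vecMul_one]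
  · rintro rfl; rw [Matrix.vecMul_vecMul, h2, Matrix.vecMul_one]

theorem sqFC_eq (F : Model n × Model n → ℝ) : sqFC F = fun w => ((sqF F w : ℝ) : ℂ) := rfl

theorem complexTensor_apply (F : Model n × Model n → ℝ) (u : Model n × Model n) (α β : Fin n) :
    complexTensor F u α β
      = wirt (0, basisVec (Sum.inl α)) (wirtBar (0, basisVec (Sum.inl β)) (sqFC F)) u := by
  rw [← dVbar_eq_wirtBar, ← dV_eq_wirt]; rfl

namespace IsLocalMetric

variable {Ω : Set (Model n)} {F : Model n × Model n → ℝ} {u : Model n × Model n}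

theorem smooth_sqFC (h : IsLocalMetric Ω F) : ContDiffOn ℝ ∞ (sqFC F) (Ω ×ˢ {v | v ≠ 0}) :=
  Complex.ofRealCLM.contDiff.comp_contDiffOn h.smooth_sq

theorem smooth_dVbar (h : IsLocalMetric Ω F) (τ : Fin n) :
    ContDiffOn ℝ ∞ (dVbar τ (sqFC F)) (Ω ×ˢ {v | v ≠ 0}) := by
  rw [dVbar_eq_wirtBar]; exact smooth_wirtBar h.isOpen_slit h.smooth_sqFC _

theorem smooth_dV (h : IsLocalMetric Ω F) (τ : Fin n) :
    ContDiffOn ℝ ∞ (dV τ (sqFC F)) (Ω ×ˢ {v | v ≠ 0}) := by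
  rw [dV_eq_wirt]; exact smooth_wirt h.isOpen_slit h.smooth_sqFC _

theorem smooth_complexTensor (h : IsLocalMetric Ω F) (β τ : Fin n) :
    ContDiffOn ℝ ∞ (fun w => complexTensor F w β τ) (Ω ×ˢ {v | v ≠ 0}) := by
  simp only [complexTensor, Matrix.of_apply, dV_eq_wirt]
  exact smooth_wirt h.isOpen_slit (h.smooth_dVbar τ) _

/-- The real part is Euler's identity in the radial direction v; the imaginary part is the
derivative along iv, which vanishes by rotation invariance. -/
theorem wirtBar_euler (h : IsLocalMetric Ω F) (hu : u ∈ Ω ×ˢ {v : Model n | v ≠ 0}) :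
    ∑ τ, starRingEnd ℂ (u.2 τ) * dVbar τ (sqFC F) u = sqFC F u := by
  rw [← wirtBar_vert_expand, sqFC_eq, wirtBar_ofReal (h.isSpray.diff h.smooth_sq hu),
    h.isSpray.euler hu, Prod.smul_mk, smul_zero, h.dirD_rot hu]
  simp

theorem wirt_euler (h : IsLocalMetric Ω F) (hu : u ∈ Ω ×ˢ {v : Model n | v ≠ 0}) :
    ∑ β, u.2 β * dV β (sqFC F) u = sqFC F u := by
  rw [← wirt_vert_expand, sqFC_eq, wirt_ofReal (h.isSpray.diff h.smooth_sq hu),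
    h.isSpray.euler hu, Prod.smul_mk, smul_zero, h.dirD_rot hu]
  simp

/-- A (1,0) derivative of the complex Euler identity: the coefficients v̄^τ are antiholomorphic and
are not differentiated. -/
theorem wirt_contract (h : IsLocalMetric Ω F) (hu : u ∈ Ω ×ˢ {v : Model n | v ≠ 0})
    (p : Model n × Model n) :
    ∑ τ, starRingEnd ℂ (u.2 τ) * wirt p (dVbar τ (sqFC F)) u = wirt p (sqFC F) u := by
  rw [← wirt_congr h.isOpen_slit (fun w hw => h.wirtBar_euler hw) hu p,
    wirt_sum_mul (fun τ _ => differentiableAt_conj_fibreCoord τ u)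
      (fun τ _ => h.isSpray.diff (h.smooth_dVbar τ) hu)]
  simp only [wirt_conj_fibreCoord, zero_mul, zero_add]

/-- Obtained by applying ∂/∂v̄^τ to v^β G_β = F², where v^β is holomorphic. -/
theorem complexTensor_contract (h : IsLocalMetric Ω F) (hu : u ∈ Ω ×ˢ {v : Model n | v ≠ 0})
    (τ : Fin n) : ∑ β, u.2 β * complexTensor F u β τ = dVbar τ (sqFC F) u := by
  have e := wirtBar_congr h.isOpen_slit (fun w hw => h.wirt_euler hw) hu
    (0, basisVec (Sum.inl τ))
  rw [wirtBar_sum_mul (fun β _ => differentiableAt_fibreCoord β u)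
      (fun β _ => h.isSpray.diff (h.smooth_dV β) hu)] at e
  simp only [wirtBar_fibreCoord, zero_mul, zero_add] at e
  rw [dVbar_eq_wirtBar, ← e]
  refine Finset.sum_congr rfl fun β _ => ?_
  rw [complexTensor_apply, dV_eq_wirt, wirt_wirtBar_comm h.isOpen_slit h.smooth_sqFC hu]

/-- The Levi form on b is a quarter of the real fibre Hessian on b plus that on ib, so real strong
convexity makes it positive. -/
theorem complexTensor_det_ne_zero (h : IsLocalMetric Ω F)
    (hu : u ∈ Ω ×ˢ {v : Model n | v ≠ 0}) : (complexTensor F u).det ≠ 0 := by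
  intro hdet
  obtain ⟨a, ha, h0⟩ := Matrix.exists_vecMul_eq_zero_iff.2 hdet
  let b : Model n := WithLp.toLp 2 a
  have hb : b ≠ 0 := by
    intro hb
    apply ha
    funext i
    exact congrArg (fun x : Model n => x i) hb
  have e1 : ∀ τ, ∑ α, b α * complexTensor F u α τ = 0 := fun τ => congrFun h0 τ
  have e2 : wirt (0, b) (wirtBar (0, b) (sqFC F)) u = 0 := by
    have hexp : wirtBar (0, b) (sqFC F)
        = fun w => ∑ τ, starRingEnd ℂ (b τ) * dVbar τ (sqFC F) w :=
      funext fun w => wirtBar_vert_expand b _ w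
    have hc : ∀ (c : ℂ) (p : Model n × Model n), wirt p (fun _ => c) u = 0 := fun c p => by
      simp [wirt, dirD_const]
    rw [hexp, wirt_sum_mul (fun τ _ => differentiableAt_const _)
      (fun τ _ => h.isSpray.diff (h.smooth_dVbar τ) hu)]
    simp only [hc, zero_mul, zero_add]
    refine Finset.sum_eq_zero fun τ _ => ?_
    rw [wirt_vert_expand]
    have : ∑ α, b α * dV α (dVbar τ (sqFC F)) u = 0 := e1 τ
    rw [this, mul_zero]
  have hre := congrArg Complex.re e2
  rw [wirt, dirD_wirtBar h.isOpen_slit h.smooth_sqFC hu,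
    dirD_wirtBar h.isOpen_slit h.smooth_sqFC hu] at hre
  have hC : ∀ p q, dirD p (dirD q (sqFC F)) u = ((dirD p (dirD q (sqF F)) u : ℝ) : ℂ) := by
    intro p q
    rw [← dirD_ofReal (h.isSpray.diff (h.isSpray.smooth1 q) hu)]
    exact dirD_congr h.isOpen_slit
      (fun w hw => dirD_ofReal (h.isSpray.diff h.smooth_sq hw) q) hu p
  simp only [hC, Prod.smul_mk, smul_zero] at hre
  have p1 := h.hess_pos hu hb
  have p2 := h.hess_pos hu (smul_ne_zero Complex.I_ne_zero hb)
  simp at hre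
  linarith

theorem chernNonlin_lower (h : IsLocalMetric Ω F) (hu : u ∈ Ω ×ˢ {v : Model n | v ≠ 0})
    (μ τ : Fin n) :
    ∑ α, chernNonlin F α μ u * complexTensor F u α τ = dZ μ (dVbar τ (sqFC F)) u :=
  (vecMul_eq_iff (h.complexTensor_det_ne_zero hu) (fun τ => dZ μ (dVbar τ (sqFC F)) u)
    (fun α => chernNonlin F α μ u)).2 (fun _ => rfl) τ

/-- This is the defining property of the Chern–Finsler nonlinear connection: its horizontal lifts
annihilate the functions ∂F²/∂v̄^τ. -/
theorem deltaZ_dVbar (h : IsLocalMetric Ω F) (hu : u ∈ Ω ×ˢ {v : Model n | v ≠ 0})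
    (μ τ : Fin n) : deltaZ F μ (dVbar τ (sqFC F)) u = 0 := by
  rw [deltaZ, ← h.chernNonlin_lower hu, sub_eq_zero]
  rfl

/-- Contracting the previous vanishing with v̄^τ recovers F² by Euler, so F² is constant along the
complex horizontal directions. -/
theorem wirt_chernVec (h : IsLocalMetric Ω F) (hu : u ∈ Ω ×ˢ {v : Model n | v ≠ 0})
    (μ : Fin n) : wirt (basisVec (Sum.inl μ), -chernVec F μ u) (sqFC F) u = 0 := by
  rw [← h.wirt_contract hu]
  refine Finset.sum_eq_zero fun τ _ => ?_
  rw [← deltaZ_eq_wirt, h.deltaZ_dVbar hu, mul_zero]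

/-- Apply δ_μ to v^β G_{βτ̄} = ∂F²/∂v̄^τ: the right side gives zero, and δ_μ v^β is minus the
nonlinear coefficient Γ^β_{;μ}. -/
theorem chernHor_contract (h : IsLocalMetric Ω F) (hu : u ∈ Ω ×ˢ {v : Model n | v ≠ 0})
    (α μ : Fin n) : ∑ β, u.2 β * chernHor F α β μ u = chernNonlin F α μ u := by
  have key : ∀ τ, ∑ β, chernNonlin F β μ u * complexTensor F u β τ
      = ∑ β, u.2 β * deltaZ F μ (fun w => complexTensor F w β τ) u := by
    intro τ
    have e := wirt_congr h.isOpen_slit (fun w hw => h.complexTensor_contract hw τ) hu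
      (basisVec (Sum.inl μ), -chernVec F μ u)
    rw [← deltaZ_eq_wirt _ _ (dVbar τ (sqFC F)), h.deltaZ_dVbar hu,
      wirt_sum_mul (fun β _ => differentiableAt_fibreCoord β u)
      (fun β _ => h.isSpray.diff (h.smooth_complexTensor β τ) hu), Finset.sum_add_distrib] at e
    simp only [wirt_fibreCoord, ← deltaZ_eq_wirt] at e
    have e' : ∑ β, (-chernVec F μ u) β * complexTensor F u β τ
        = -∑ β, chernNonlin F β μ u * complexTensor F u β τ := by
      rw [← Finset.sum_neg_distrib]
      exact Finset.sum_congr rfl fun β _ => by rw [PiLp.neg_apply, chernVec_apply]; ring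
    rw [e'] at e
    linear_combination -e
  rw [(vecMul_eq_iff (h.complexTensor_det_ne_zero hu) _ (fun α => chernNonlin F α μ u)).1 key α]
  simp only [chernHor, Finset.mul_sum]
  rw [Finset.sum_comm]
  exact Finset.sum_congr rfl fun τ _ => Finset.sum_congr rfl fun β _ => by ring

end IsLocalMetric

end ChernFinsler

/-! ### Complex linearity of the nonlinear connection -/

section Equivalence

variable {n : ℕ}

namespace IsLocalMetric

variable {Ω : Set (Model n)} {F : Model n × Model n → ℝ} {u : Model n × Model n}

theorem dirD_proj {f : Model n × Model n → Model n} (hf : DifferentiableAt ℝ f u) (α : Fin n)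
    (p : Model n × Model n) : dirD p (fun w => f w α) u = (dirD p f u) α :=
  dirD_clm_comp ((EuclideanSpace.proj (𝕜 := ℂ) α).restrictScalars ℝ) hf p

/-- The nonlinear connection is complex linear. -/
def HasComplexNonlin (Ω : Set (Model n)) (F : Model n × Model n → ℝ) : Prop :=
  ∀ u ∈ Ω ×ˢ {v : Model n | v ≠ 0}, ∀ a,
    dirD (0, Complex.I • a) (sprayVec F) u = Complex.I • dirD (0, a) (sprayVec F) u

/-! ### From complex linearity of the nonlinear connection to the Kähler–Berwald property -/

section Backward

variable (h : IsLocalMetric Ω F) (hol : HasComplexNonlin Ω F)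
include h hol

/-- F² is constant along the real horizontal lifts of both ∂/∂x^μ and i∂/∂x^μ. Complex linearity
makes the second lift i times the first, so the two real equations form one complex equation. -/
theorem dZ_of_complexNonlin (hu : u ∈ Ω ×ˢ {v : Model n | v ≠ 0}) (μ : Fin n) :
    ∑ α, (dirD (0, basisVec (Sum.inl μ)) (sprayVec F) u) α * dV α (sqFC F) u
      = dZ μ (sqFC F) u := by
  set N := dirD (0, basisVec (Sum.inl μ)) (sprayVec F) u with hN
  have e : wirt (basisVec (Sum.inl μ), -N) (sqFC F) u = 0 := by
    rw [sqFC_eq, wirt_ofReal_eq_zero (h.isSpray.diff h.smooth_sq hu)]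
    have key : ∀ a : Model n, dirD (a, -dirD (0, a) (sprayVec F) u) (sqF F) u = 0 := by
      intro a
      have : ((a, -dirD (0, a) (sprayVec F) u) : Model n × Model n)
          = (a, 0) - (0, dirD (0, a) (sprayVec F) u) := by simp
      rw [this, dirD_sub_dir, h.isSpray.horizontal_deriv hu, sub_self]
    refine ⟨key _, ?_⟩
    rw [Prod.smul_mk, smul_neg, hN, ← hol u hu]
    exact key _
  have e' : ((basisVec (Sum.inl μ), -N) : Model n × Model n)
      = (basisVec (Sum.inl μ), 0) + -(0, N) := by simp
  rw [e', wirt_add_dir, wirt_neg_dir, wirt_vert_expand, ← dZ_eq_wirt] at e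
  linear_combination -e

omit hol in
theorem smooth_nonlin_apply (μ α : Fin n) :
    ContDiffOn ℝ ∞ (fun w => (dirD (0, basisVec (Sum.inl μ)) (sprayVec F) w) α)
      (Ω ×ˢ {v : Model n | v ≠ 0}) :=
  ((EuclideanSpace.proj (𝕜 := ℂ) α).restrictScalars ℝ).contDiff.comp_contDiffOn
    (smooth_dirD h.isOpen_slit h.smooth_sprayVec _)

theorem hol_nonlin_apply (hu : u ∈ Ω ×ˢ {v : Model n | v ≠ 0}) (μ α β : Fin n) :
    dirD (Complex.I • (0, basisVec (Sum.inl β)))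
        (fun w => (dirD (0, basisVec (Sum.inl μ)) (sprayVec F) w) α) u
      = Complex.I * dirD (0, basisVec (Sum.inl β))
        (fun w => (dirD (0, basisVec (Sum.inl μ)) (sprayVec F) w) α) u := by
  have d := h.isSpray.diff (smooth_dirD h.isOpen_slit h.smooth_sprayVec
    (0, basisVec (Sum.inl μ))) hu
  rw [dirD_proj d, dirD_proj d, Prod.smul_mk, smul_zero,
    dirD_hol h.isOpen_slit h.smooth_sprayVec (fun w hw => hol w hw (basisVec (Sum.inl β))) hu]
  rfl

/-- Apply ∂/∂v̄^τ to the preceding identity. The coefficients are fibre derivatives of a fibrewise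
holomorphic spray, so they are not differentiated; what remains is the linear system defining the
Chern–Finsler nonlinear connection. -/
theorem dZ_dVbar_of_complexNonlin (hu : u ∈ Ω ×ˢ {v : Model n | v ≠ 0}) (μ τ : Fin n) :
    ∑ α, (dirD (0, basisVec (Sum.inl μ)) (sprayVec F) u) α * complexTensor F u α τ
      = dZ μ (dVbar τ (sqFC F)) u := by
  have e := wirtBar_congr h.isOpen_slit (fun w hw => h.dZ_of_complexNonlin hol hw μ) hu
    (0, basisVec (Sum.inl τ))
  rw [wirtBar_sum_mul (fun α _ => h.isSpray.diff (h.smooth_nonlin_apply μ α) hu)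
    (fun α _ => h.isSpray.diff (h.smooth_dV α) hu)] at e
  simp only [wirtBar_of_hol (h.hol_nonlin_apply hol hu μ _ τ), zero_mul, zero_add] at e
  rw [dZ_eq_wirt, ← wirt_wirtBar_comm h.isOpen_slit h.smooth_sqFC hu, ← dVbar_eq_wirtBar,
    ← dZ_eq_wirt] at e
  rw [← e]
  refine Finset.sum_congr rfl fun α _ => ?_
  rw [complexTensor_apply, dV_eq_wirt, wirt_wirtBar_comm h.isOpen_slit h.smooth_sqFC hu]

theorem chernNonlin_of_complexNonlin (hu : u ∈ Ω ×ˢ {v : Model n | v ≠ 0}) (α μ : Fin n) :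
    chernNonlin F α μ u = (dirD (0, basisVec (Sum.inl μ)) (sprayVec F) u) α :=
  ((vecMul_eq_iff (h.complexTensor_det_ne_zero hu) (fun τ => dZ μ (dVbar τ (sqFC F)) u)
    (fun α => (dirD (0, basisVec (Sum.inl μ)) (sprayVec F) u) α)).1
      (h.dZ_dVbar_of_complexNonlin hol hu μ) α).symm

/-- If the nonlinear connection is complex linear, the Chern–Finsler coefficients are the second
fibre derivatives of the spray. -/
theorem chernHor_of_complexNonlin (hu : u ∈ Ω ×ˢ {v : Model n | v ≠ 0}) (α β μ : Fin n) :
    chernHor F α β μ u = (dirD (0, basisVec (Sum.inl β))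
      (dirD (0, basisVec (Sum.inl μ)) (sprayVec F)) u) α := by
  have hS := h.isOpen_slit
  have d := h.isSpray.diff (smooth_dirD h.isOpen_slit h.smooth_sprayVec
    (0, basisVec (Sum.inl μ))) hu
  refine ((vecMul_eq_iff (h.complexTensor_det_ne_zero hu)
    (fun τ => deltaZ F μ (fun w => complexTensor F w β τ) u)
    (fun α => (dirD (0, basisVec (Sum.inl β))
      (dirD (0, basisVec (Sum.inl μ)) (sprayVec F)) u) α)).1 (fun τ => ?_) α).symm
  -- Apply ∂/∂v^β to N^α_μ G_{ατ̄} = ∂²F²/∂z^μ∂v̄^τ. Since ∂G_{ατ̄}/∂v^β is symmetric in α and β,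
  -- the terms not containing ∂N assemble to δ_μ G_{βτ̄}.
  have e := wirt_congr hS (fun w hw => h.dZ_dVbar_of_complexNonlin hol hw μ τ) hu
    (0, basisVec (Sum.inl β))
  rw [wirt_sum_mul (fun α _ => h.isSpray.diff (h.smooth_nonlin_apply μ α) hu)
    (fun α _ => h.isSpray.diff (h.smooth_complexTensor α τ) hu), Finset.sum_add_distrib] at e
  simp only [wirt_of_hol (h.hol_nonlin_apply hol hu μ _ β), dirD_proj d] at e
  have c1 : wirt (0, basisVec (Sum.inl β)) (dZ μ (dVbar τ (sqFC F))) u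
      = dZ μ (fun w => complexTensor F w β τ) u := by
    rw [dZ_eq_wirt, wirt_comm hS (h.smooth_dVbar τ) hu, dZ_eq_wirt, ← dV_eq_wirt]; rfl
  have c2 : ∀ α, wirt (0, basisVec (Sum.inl β)) (fun w => complexTensor F w α τ) u
      = dV α (fun w => complexTensor F w β τ) u := by
    intro α
    have : ∀ γ, (fun w => complexTensor F w γ τ)
        = wirt (0, basisVec (Sum.inl γ)) (dVbar τ (sqFC F)) := fun γ => by
      rw [← dV_eq_wirt]; rfl
    rw [this, this, dV_eq_wirt, wirt_comm hS (h.smooth_dVbar τ) hu]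
  simp only [c1, c2, ← h.chernNonlin_of_complexNonlin hol hu] at e
  rw [deltaZ]
  linear_combination e

theorem chernHor_symm_of_complexNonlin (hu : u ∈ Ω ×ˢ {v : Model n | v ≠ 0}) (α β μ : Fin n) :
    chernHor F α β μ u = chernHor F α μ β u := by
  rw [h.chernHor_of_complexNonlin hol hu, h.chernHor_of_complexNonlin hol hu,
    dirD_comm h.isOpen_slit h.smooth_sprayVec hu]

/-- The second fibre derivatives of the spray are fibrewise holomorphic and of degree zero, so
Liouville's theorem applies on each punctured fibre. -/
theorem chernHor_const_of_complexNonlin {z v w : Model n} (hz : z ∈ Ω) (hv : v ≠ 0) (hw : w ≠ 0)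
    (α β μ : Fin n) : chernHor F α β μ (z, v) = chernHor F α β μ (z, w) := by
  have hS := h.isOpen_slit
  rw [h.chernHor_of_complexNonlin hol (u := (z, v)) ⟨hz, hv⟩,
    h.chernHor_of_complexNonlin hol (u := (z, w)) ⟨hz, hw⟩]
  have sm := smooth_dirD hS (smooth_dirD hS h.smooth_sprayVec (0, basisVec (Sum.inl μ)))
    (0, basisVec (Sum.inl β))
  have key := constant_of_homogeneous_zero
    (f := fun y => dirD (0, basisVec (Sum.inl β))
      (dirD (0, basisVec (Sum.inl μ)) (sprayVec F)) (z, y))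
    (sm.comp (contDiff_prodMk_right z).contDiffOn fun y hy => ⟨hz, hy⟩)
    (fun y hy c => ?_) (fun y hy c hc => ?_) hv hw
  · exact congrArg (fun x : Model n => x α) key
  · have d := h.isSpray.diff sm (u := (z, y)) ⟨hz, hy⟩
    have e := dirD_hol hS (smooth_dirD hS h.smooth_sprayVec (0, basisVec (Sum.inl μ)))
      (fun w hw => dirD_hol hS h.smooth_sprayVec (fun w hw => hol w hw c) hw
        (0, basisVec (Sum.inl μ))) (v := (z, y)) ⟨hz, hy⟩ (0, basisVec (Sum.inl β))
    rwa [dirD_vert_eq d, dirD_vert_eq d] at e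
  · exact h.isSpray.berwald_homog (u := (z, y)) ⟨hz, hy⟩ hc _ _

end Backward

end IsLocalMetric

/-- The complex bilinear map with the coefficients `Γ^α_{β;μ}` at `u`. -/
noncomputable def chernBilin (F : Model n × Model n → ℝ) (u : Model n × Model n) :
    Model n →ₗ[ℂ] Model n →ₗ[ℂ] Model n :=
  LinearMap.mk₂ ℂ
    (fun a b => ∑ β, ∑ μ, (a β * b μ) • (WithLp.toLp 2 fun α => chernHor F α β μ u : Model n))
    (fun a a' b => by simp only [PiLp.add_apply, add_mul, add_smul, Finset.sum_add_distrib])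
    (fun c a b => by simp only [PiLp.smul_apply, smul_eq_mul, mul_assoc, mul_smul, Finset.smul_sum])
    (fun a b b' => by simp only [PiLp.add_apply, mul_add, add_smul, Finset.sum_add_distrib])
    (fun c a b => by
      simp only [PiLp.smul_apply, smul_eq_mul, mul_left_comm _ c, mul_smul c, Finset.smul_sum])

theorem chernBilin_apply (F : Model n × Model n → ℝ) (u : Model n × Model n) (a b : Model n) :
    chernBilin F u a b
      = ∑ β, ∑ μ, (a β * b μ) • (WithLp.toLp 2 fun α => chernHor F α β μ u : Model n) := rfl

/-- The map `chernBilin` as a continuous real bilinear map. -/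
noncomputable def chernBilinReal (F : Model n × Model n → ℝ) (u : Model n × Model n) :
    Model n →L[ℝ] Model n →L[ℝ] Model n :=
  LinearMap.toContinuousLinearMap
    ((LinearMap.toContinuousLinearMap : (Model n →ₗ[ℝ] Model n) ≃ₗ[ℝ] _).toLinearMap ∘ₗ
      (LinearMap.mk₂ ℝ (fun a b => chernBilin F u a b)
        (fun a a' b => by rw [map_add]; rfl)
        (fun c a b => by
          rw [LinearMap.map_smul_of_tower]; rfl)
        (fun a b b' => map_add _ _ _)
        (fun c a b => LinearMap.map_smul_of_tower _ c b)))

theorem chernBilinReal_apply (F : Model n × Model n → ℝ) (u : Model n × Model n)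
    (a b : Model n) : chernBilinReal F u a b = chernBilin F u a b := rfl

namespace IsLocalMetric

variable {Ω : Set (Model n)} {F : Model n × Model n → ℝ}

/-! ### From the Kähler–Berwald property to the spray and the Cartan connection -/

section Forward

variable (h : IsLocalMetric Ω F) {z : Model n} (hz : z ∈ Ω)
  (hsymm : ∀ v ≠ 0, ∀ α β μ, chernHor F α β μ (z, v) = chernHor F α μ β (z, v))
  (hconst : ∀ v w : Model n, v ≠ 0 → w ≠ 0 → ∀ α β μ,
    chernHor F α β μ (z, v) = chernHor F α β μ (z, w))
  {v₀ : Model n} (hv₀ : v₀ ≠ 0)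

include hsymm hv₀ in
omit h in
theorem chernBilin_symm (a b : Model n) :
    chernBilin F (z, v₀) a b = chernBilin F (z, v₀) b a := by
  rw [chernBilin_apply, chernBilin_apply, Finset.sum_comm]
  refine Finset.sum_congr rfl fun β _ => Finset.sum_congr rfl fun μ _ => ?_
  rw [mul_comm]
  congr 2
  funext α
  exact hsymm v₀ hv₀ α _ _

include h hz hconst hv₀ in
-- The Berwald condition replaces the coefficients at y by those at the fixed vector v₀, so the
-- nonlinear connection becomes linear in y.
theorem chernVec_eq_chernBilin {y : Model n} (hy : y ≠ 0) (μ : Fin n) :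
    chernVec F μ (z, y) = chernBilin F (z, v₀) y (basisVec (Sum.inl μ)) := by
  ext α
  rw [chernVec_apply, ← h.chernHor_contract (u := (z, y)) ⟨hz, hy⟩, chernBilin_apply]
  simp only [basisVec_inl_apply, WithLp.ofLp_sum, Finset.sum_apply, PiLp.smul_apply, smul_eq_mul]
  refine Finset.sum_congr rfl fun β _ => ?_
  simp [hconst y v₀ hy hv₀]

include h hz hconst hv₀ in
-- This is the hypothesis `hB` of the Berwald section: the bilinear map is frozen at v₀, but the
-- identity holds on the whole punctured fibre and can be differentiated there.
theorem horizontal_deriv_chernBilin {y : Model n} (hy : y ≠ 0) (b : Model n) :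
    dirD (b, 0) (sqF F) (z, y) = dirD (0, chernBilinReal F (z, v₀) y b) (sqF F) (z, y) := by
  have hu : (z, y) ∈ Ω ×ˢ {v : Model n | v ≠ 0} := ⟨hz, hy⟩
  have e : ((b, -chernBilin F (z, v₀) y b) : Model n × Model n)
      = ∑ μ, b μ • (basisVec (Sum.inl μ), -chernVec F μ (z, y)) := by
    refine Prod.ext ?_ ?_
    · rw [Prod.fst_sum]; exact (sum_smul_basisVec_inl b).symm
    · rw [Prod.snd_sum]
      conv_lhs => rw [← sum_smul_basisVec_inl b]
      simp only [map_sum, map_smul, Prod.smul_mk, smul_neg, Finset.sum_neg_distrib,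
        h.chernVec_eq_chernBilin hz hconst hv₀ hy]
  have e2 : dirD (b, -chernBilin F (z, v₀) y b) (sqF F) (z, y) = 0 := by
    rw [e, dirD_sum_dir]
    refine Finset.sum_eq_zero fun μ _ => ?_
    have h1 := h.wirt_chernVec hu μ
    rw [sqFC_eq, wirt_ofReal_eq_zero (h.isSpray.diff h.smooth_sq hu)] at h1
    -- F² is real, so its vanishing (1,0) derivative kills the real derivatives along the lift and
    -- along i times the lift, hence along every complex multiple.
    rw [smul_eq_re_add_im, dirD_add_dir, dirD_smul_dir, dirD_smul_dir, h1.1, h1.2]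
    simp
  have e3 : ((b, -chernBilin F (z, v₀) y b) : Model n × Model n)
      = (b, 0) - (0, chernBilin F (z, v₀) y b) := by simp
  rw [e3, dirD_sub_dir, sub_eq_zero] at e2
  exact e2

include h hz hsymm hconst hv₀ in
theorem nonlin_eq_chernBilin (a : Model n) :
    dirD (0, a) (sprayVec F) (z, v₀) = chernBilin F (z, v₀) v₀ a :=
  h.isSpray.nonlin_eq_bilinear (T := {v | v ≠ 0}) (B := chernBilinReal F (z, v₀)) isOpen_ne
    (fun _ hy => ⟨hz, hy⟩) (chernBilin_symm hsymm hv₀)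
    (fun _ hy b => h.horizontal_deriv_chernBilin hz hconst hv₀ hy b) hv₀ a

include h hz hsymm hconst hv₀ in
theorem cartanHor_eq_chernBilin (k j l : Fin n ⊕ Fin n) :
    cartanHor F k j l (z, v₀) = coord (chernBilin F (z, v₀) (basisVec j) (basisVec l)) k := by
  have hu : (z, v₀) ∈ Ω ×ˢ {v : Model n | v ≠ 0} := ⟨hz, hv₀⟩
  have key : (ofCoord fun k => cartanHor F k j l (z, v₀))
      = chernBilin F (z, v₀) (basisVec j) (basisVec l) := by
    refine h.hess_ext hu fun s => ?_
    have e1 := h.cartanHor_pairing hu j l s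
    have e2 := h.isSpray.christoffel_eq_bilinear (T := {v | v ≠ 0})
      (B := chernBilinReal F (z, v₀)) isOpen_ne
      (fun _ hy => ⟨hz, hy⟩) (chernBilin_symm hsymm hv₀)
      (fun _ hy b => h.horizontal_deriv_chernBilin hz hconst hv₀ hy b) hv₀
      (basisVec j) (basisVec l) (basisVec s)
    rw [chernBilinReal_apply] at e2
    linarith
  rw [← key, coord_ofCoord]

end Forward

/-! ### The Cartan covariant derivative in horizontal directions -/

variable {u : Model n × Model n}

/-- A linear relation between the two components, so it suffices to check it on the generators. -/
theorem snd_of_mem_horizontalSpace (h : IsLocalMetric Ω F)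
    (hu : u ∈ Ω ×ˢ {v : Model n | v ≠ 0}) {X : Model n × Model n}
    (hX : X ∈ horizontalSpace F u) : X.2 = -dirD (0, X.1) (sprayVec F) u := by
  let L : Model n × Model n →ₗ[ℝ] Model n :=
    -((fderiv ℝ (sprayVec F) u : Model n × Model n →ₗ[ℝ] Model n) ∘ₗ
      LinearMap.inr ℝ (Model n) (Model n) ∘ₗ LinearMap.fst ℝ (Model n) (Model n))
  have : horizontalSpace F u ≤ LinearMap.eqLocus (LinearMap.snd ℝ (Model n) (Model n)) L := by
    rw [horizontalSpace, Submodule.span_le]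
    rintro _ ⟨j, rfl⟩
    rw [h.deltaVec_eq hu]
    rfl
  exact this hX

theorem mem_horizontalSpace (h : IsLocalMetric Ω F)
    (hu : u ∈ Ω ×ˢ {v : Model n | v ≠ 0}) (b : Model n) :
    (b, -dirD (0, b) (sprayVec F) u) ∈ horizontalSpace F u := by
  have : ((b, -dirD (0, b) (sprayVec F) u) : Model n × Model n)
      = ∑ l, coord b l • deltaVec F u l := by
    refine Prod.ext ?_ ?_
    · rw [Prod.fst_sum]; exact sum_coord_smul b
    · rw [Prod.snd_sum, dirD_vert_expand b, ← Finset.sum_neg_distrib]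
      simp [h.deltaVec_eq hu]
  rw [this]
  exact Submodule.sum_mem _ fun l _ => Submodule.smul_mem _ _ (Submodule.subset_span ⟨l, rfl⟩)

/-- The horizontal Cartan coefficients as a bilinear expression. -/
noncomputable def cartanBilin (F : Model n × Model n → ℝ) (u : Model n × Model n)
    (a b : Model n) : Model n :=
  ofCoord fun k => ∑ j, ∑ l, coord a j * cartanHor F k j l u * coord b l

/-- The forms δy^l vanish on horizontal vectors, so the vertical Cartan coefficients drop out. -/
theorem cartanCov_eq (h : IsLocalMetric Ω F) (hu : u ∈ Ω ×ˢ {v : Model n | v ≠ 0})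
    {X : Model n × Model n} (hX : X ∈ horizontalSpace F u) {Y : Model n × Model n → Model n}
    (hY : DifferentiableAt ℝ Y u) :
    cartanCov F u X Y = dirD X Y u + cartanBilin F u (Y u) X.1 := by
  have hd : ∀ l, deltaY F u X l = 0 := by
    intro l
    rw [deltaY, h.snd_of_mem_horizontalSpace hu hX, dirD_vert_expand, ← coordCLM_apply, map_neg,
      map_sum, neg_add_eq_zero]
    refine Finset.sum_congr rfl fun m _ => ?_
    rw [map_smul, coordCLM_apply, h.realNonlin_eq hu, smul_eq_mul, mul_comm]
  apply coord_injective
  intro k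
  rw [cartanCov, coord_ofCoord, ← coordCLM_apply k (_ + _), map_add,
    coordCLM_apply k (cartanBilin _ _ _ _), cartanBilin, coord_ofCoord, ← dirD_clm_comp (coordCLM k) hY]
  simp only [coordCLM_apply]
  congr 1
  refine Finset.sum_congr rfl fun j _ => ?_
  simp only [cartanForm, hd, mul_zero, add_zero, Finset.mul_sum, mul_assoc]

theorem cartanCov_I_smul_iff (h : IsLocalMetric Ω F) (hu : u ∈ Ω ×ˢ {v : Model n | v ≠ 0})
    {X : Model n × Model n} (hX : X ∈ horizontalSpace F u) {Y : Model n × Model n → Model n}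
    (hY : DifferentiableAt ℝ Y u) :
    cartanCov F u X (fun w => Complex.I • Y w) = Complex.I • cartanCov F u X Y ↔
      cartanBilin F u (Complex.I • Y u) X.1 = Complex.I • cartanBilin F u (Y u) X.1 := by
  rw [h.cartanCov_eq hu hX hY, h.cartanCov_eq hu hX (hY.fun_const_smul Complex.I), smul_add,
    dirD_const_I_smul hY, add_right_inj]

/-- This contraction is what extracts complex linearity of the nonlinear connection from ∇J = 0. -/
theorem cartanBilin_snd (h : IsLocalMetric Ω F) (hu : u ∈ Ω ×ˢ {v : Model n | v ≠ 0})
    (a : Model n) : cartanBilin F u a u.2 = dirD (0, a) (sprayVec F) u := by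
  rw [cartanBilin, ← ofCoord_coord (dirD (0, a) (sprayVec F) u)]
  congr 1
  funext k
  exact h.parallel_term hu a k

theorem cartanBilin_eq_of_cartanHor {B : Model n →ₗ[ℂ] Model n →ₗ[ℂ] Model n}
    (hB : ∀ k j l, cartanHor F k j l u = coord (B (basisVec j) (basisVec l)) k)
    (a b : Model n) : cartanBilin F u a b = B a b := by
  apply coord_injective
  intro k
  rw [cartanBilin, coord_ofCoord, ← coordCLM_apply]
  conv_rhs => rw [sum_coord_smul a, sum_coord_smul b]
  simp only [map_sum, LinearMap.sum_apply, LinearMap.map_smul_of_tower, LinearMap.smul_apply,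
    map_smul, smul_eq_mul, coordCLM_apply, hB]
  rw [Finset.sum_comm]
  exact Finset.sum_congr rfl fun j _ => Finset.sum_congr rfl fun l _ => by ring

end IsLocalMetric

end Equivalence

/-! ### Changes of charts -/

section Charts

variable {n : ℕ} {M : Type*} [TopologicalSpace M] [ChartedSpace (Model n) M]

/-- Regular curves are smooth for the real structure, so holomorphic charts must also be recognised
as real smooth charts. -/
theorem contDiffGroupoid_real {e : OpenPartialHomeomorph (Model n) (Model n)}
    (he : e ∈ contDiffGroupoid ω 𝓘(ℂ, Model n)) : e ∈ contDiffGroupoid ∞ 𝓘(ℝ, Model n) := by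
  rw [contDiffGroupoid, mem_groupoid_of_pregroupoid] at he ⊢
  simp only [contDiffPregroupoid, modelWithCornersSelf_coe, modelWithCornersSelf_coe_symm,
    Function.id_comp, Function.comp_id, preimage_id, range_id, inter_univ] at he ⊢
  exact ⟨(he.1.restrict_scalars ℝ).of_le le_top, (he.2.restrict_scalars ℝ).of_le le_top⟩

theorem mem_maximalAtlas_real {e : OpenPartialHomeomorph M (Model n)} (he : e ∈ holCharts n M) :
    e ∈ IsManifold.maximalAtlas 𝓘(ℝ, Model n) ∞ M := by
  rw [holCharts, IsManifold.maximalAtlas, mem_maximalAtlas_iff] at he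
  rw [IsManifold.maximalAtlas, mem_maximalAtlas_iff]
  exact fun e' he' => ⟨contDiffGroupoid_real (he e' he').1, contDiffGroupoid_real (he e' he').2⟩

variable {e e' : OpenPartialHomeomorph M (Model n)}

/-- The domain of the change of coordinates from `e` to `e'`. -/
def overlap (e e' : OpenPartialHomeomorph M (Model n)) : Set (Model n) :=
  e.target ∩ e.symm ⁻¹' e'.source

/-- The change of coordinates from `e` to `e'`. -/
noncomputable def transition (e e' : OpenPartialHomeomorph M (Model n)) (z : Model n) : Model n := e' (e.symm z)

omit [ChartedSpace (Model n) M] in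
theorem isOpen_overlap (e e' : OpenPartialHomeomorph M (Model n)) : IsOpen (overlap e e') :=
  (e.symm ≫ₕ e').open_source

theorem transition_contDiffOn_complex (he : e ∈ holCharts n M) (he' : e' ∈ holCharts n M) :
    ContDiffOn ℂ ω (transition e e') (overlap e e') := by
  have h := IsManifold.compatible_of_mem_maximalAtlas he he'
  rw [contDiffGroupoid, mem_groupoid_of_pregroupoid] at h
  simp only [contDiffPregroupoid, modelWithCornersSelf_coe, modelWithCornersSelf_coe_symm,
    Function.id_comp, Function.comp_id, preimage_id, range_id, inter_univ] at h
  exact h.1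

theorem transition_contDiffOn (he : e ∈ holCharts n M) (he' : e' ∈ holCharts n M) :
    ContDiffOn ℝ ∞ (transition e e') (overlap e e') :=
  ((transition_contDiffOn_complex he he').restrict_scalars ℝ).of_le le_top

theorem dirD_transition_eq (he : e ∈ holCharts n M) (he' : e' ∈ holCharts n M) {z : Model n}
    (hz : z ∈ overlap e e') (v : Model n) :
    dirD v (transition e e') z = fderiv ℂ (transition e e') z v := by
  have hd : DifferentiableAt ℂ (transition e e') z :=
    ((transition_contDiffOn_complex he he').contDiffAt
      ((isOpen_overlap e e').mem_nhds hz)).differentiableAt (by simp)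
  rw [dirD, hd.fderiv_restrictScalars ℝ]
  rfl

theorem mdifferentiableAt_chart (he : e ∈ holCharts n M) {p : M} (hp : p ∈ e.source) :
    MDifferentiableAt 𝓘(ℂ, Model n) 𝓘(ℂ, Model n) e p :=
  ((contMDiffOn_of_mem_maximalAtlas he).contMDiffAt (e.open_source.mem_nhds hp)).mdifferentiableAt
    (by simp)

theorem mdifferentiableAt_chart_symm (he : e ∈ holCharts n M) {z : Model n} (hz : z ∈ e.target) :
    MDifferentiableAt 𝓘(ℂ, Model n) 𝓘(ℂ, Model n) e.symm z :=
  ((contMDiffOn_symm_of_mem_maximalAtlas he).contMDiffAt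
    (e.open_target.mem_nhds hz)).mdifferentiableAt (by simp)

/-- The components in `e'` of a vector given by its components in `e`. -/
theorem comp_mfderiv_symm (he : e ∈ holCharts n M) (he' : e' ∈ holCharts n M) {z : Model n}
    (hz : z ∈ overlap e e') (v : Model n) :
    comp e' (e.symm z) (mfderiv 𝓘(ℂ, Model n) 𝓘(ℂ, Model n) e.symm z v)
      = dirD v (transition e e') z := by
  have h := mfderiv_comp z (mdifferentiableAt_chart he' hz.2)
    (mdifferentiableAt_chart_symm he hz.1)
  rw [dirD_transition_eq he he' hz, ← mfderiv_eq_fderiv]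
  have h' : mfderiv 𝓘(ℂ, Model n) 𝓘(ℂ, Model n) (transition e e') z = _ := h
  rw [h']
  rfl

omit [ChartedSpace (Model n) M] in
theorem transition_symm (e e' : OpenPartialHomeomorph M (Model n)) {z : Model n}
    (hz : z ∈ overlap e e') : transition e' e (transition e e' z) = z := by
  rw [transition, transition, e'.left_inv hz.2, e.right_inv hz.1]

omit [ChartedSpace (Model n) M] in
theorem transition_mem_overlap (e e' : OpenPartialHomeomorph M (Model n)) {z : Model n}
    (hz : z ∈ overlap e e') : transition e e' z ∈ overlap e' e := by
  refine ⟨e'.map_source hz.2, ?_⟩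
  rw [mem_preimage, transition, e'.left_inv hz.2]
  exact e.map_target hz.1

theorem dirD_transition_inv (he : e ∈ holCharts n M) (he' : e' ∈ holCharts n M) {z : Model n}
    (hz : z ∈ overlap e e') (v : Model n) :
    dirD (dirD v (transition e e') z) (transition e' e) (transition e e' z) = v := by
  rw [← dirD_comp (diffAt_of_smooth (isOpen_overlap e' e) (transition_contDiffOn he' he)
      (transition_mem_overlap e e' hz))
    (diffAt_of_smooth (isOpen_overlap e e') (transition_contDiffOn he he') hz),
    dirD_congr (isOpen_overlap e e') (fun w hw => transition_symm e e' hw) hz]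
  exact dirD_clm (ContinuousLinearMap.id ℝ (Model n)) v z

theorem dirD_transition_ne_zero (he : e ∈ holCharts n M) (he' : e' ∈ holCharts n M) {z : Model n}
    (hz : z ∈ overlap e e') {v : Model n} (hv : v ≠ 0) : dirD v (transition e e') z ≠ 0 := by
  intro h0
  have := dirD_transition_inv he he' hz v
  rw [h0, dirD_zero_dir] at this
  exact hv this.symm

theorem dirD_transition_surjective (he : e ∈ holCharts n M) (he' : e' ∈ holCharts n M)
    {z : Model n} (hz : z ∈ overlap e e') :
    Function.Surjective fun v => dirD v (transition e e') z := by
  intro w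
  have := dirD_transition_inv he' he (transition_mem_overlap e e' hz) w
  rw [transition_symm e e' hz] at this
  exact ⟨_, this⟩

/-- The expressions of `F` in two charts correspond. -/
theorem localExpr_transition (he : e ∈ holCharts n M) (he' : e' ∈ holCharts n M)
    (F : TangentBundle 𝓘(ℂ, Model n) M → ℝ) {u : Model n × Model n} (hu : u.1 ∈ overlap e e') :
    localExpr F e u = localExpr F e' (tangentLift (transition e e') u) := by
  have hd : MDifferentiableAt 𝓘(ℂ, Model n) 𝓘(ℂ, Model n) (transition e e') u.1 :=
    (mdifferentiableAt_chart he' hu.2).comp u.1 (mdifferentiableAt_chart_symm he hu.1)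
  have hev : e.symm =ᶠ[nhds u.1] e'.symm ∘ transition e e' := by
    filter_upwards [(isOpen_overlap e e').mem_nhds hu] with w hw
    exact (e'.left_inv hw.2).symm
  have h1 : (mfderiv 𝓘(ℂ, Model n) 𝓘(ℂ, Model n) e.symm u.1 : Model n →L[ℂ] Model n)
      = mfderiv 𝓘(ℂ, Model n) 𝓘(ℂ, Model n) (e'.symm ∘ transition e e') u.1 := hev.mfderiv_eq
  -- The two vectors lie over base points that are equal but written differently; comparing them in
  -- the total space of the tangent bundle avoids transporting between fibres.
  have h2 : tangentMap 𝓘(ℂ, Model n) 𝓘(ℂ, Model n) e.symm (⟨u.1, u.2⟩ : TangentBundle _ _)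
      = tangentMap 𝓘(ℂ, Model n) 𝓘(ℂ, Model n) (e'.symm ∘ transition e e')
        (⟨u.1, u.2⟩ : TangentBundle _ _) := by
    refine Bundle.TotalSpace.ext hev.eq_of_nhds ?_
    refine heq_of_eq ?_
    exact congrArg (fun L : Model n →L[ℂ] Model n => L u.2) h1
  have h3 := tangentMap_comp_at (I := 𝓘(ℂ, Model n))
    (⟨u.1, u.2⟩ : TangentBundle 𝓘(ℂ, Model n) (Model n))
    (mdifferentiableAt_chart_symm he' (transition_mem_overlap e e' hu).1) hd
  have h4 : tangentMap 𝓘(ℂ, Model n) 𝓘(ℂ, Model n) (transition e e')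
      (⟨u.1, u.2⟩ : TangentBundle 𝓘(ℂ, Model n) (Model n))
      = ⟨(tangentLift (transition e e') u).1, (tangentLift (transition e e') u).2⟩ := by
    refine Bundle.TotalSpace.ext rfl (heq_of_eq ?_)
    have : mfderiv 𝓘(ℂ, Model n) 𝓘(ℂ, Model n) (transition e e') u.1
        = fderiv ℂ (transition e e') u.1 := mfderiv_eq_fderiv
    change mfderiv 𝓘(ℂ, Model n) 𝓘(ℂ, Model n) (transition e e') u.1 u.2
      = dirD u.2 (transition e e') u.1
    rw [this, dirD_transition_eq he he' hu]
    rfl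
  rw [h4] at h3
  exact congrArg F (h2.trans h3)

theorem IsStronglyConvex.isLocalMetric {F : TangentBundle 𝓘(ℂ, Model n) M → ℝ}
    (hF : IsStronglyConvex F) (he : e ∈ holCharts n M) :
    IsLocalMetric e.target (localExpr F e) where
  isOpen := e.open_target
  smooth := hF.smooth e he
  homog := fun z _ c v => by
    rw [localExpr, localExpr, ← hF.homog]
    exact congrArg (fun x => F ⟨e.symm z, x⟩)
      ((mfderiv 𝓘(ℂ, Model n) 𝓘(ℂ, Model n) e.symm z).map_smul c v)
  posDef := hF.posDef e he

/-- Transformation of the nonlinear connection under a change of charts. -/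
theorem IsStronglyConvex.nonlin_transition {F : TangentBundle 𝓘(ℂ, Model n) M → ℝ}
    (hF : IsStronglyConvex F) (he : e ∈ holCharts n M) (he' : e' ∈ holCharts n M)
    {z v : Model n} (hz : z ∈ overlap e e') (hv : v ≠ 0) (a : Model n) :
    dirD (0, dirD a (transition e e') z) (sprayVec (localExpr F e'))
        (transition e e' z, dirD v (transition e e') z)
      = dirD (dirD (0, a) (sprayVec (localExpr F e)) (z, v)) (transition e e') z
        - dirD v (dirD a (transition e e')) z := by
  have h := (hF.isLocalMetric he).isSpray.mono
    (S' := overlap e e' ×ˢ {v : Model n | v ≠ 0}) ((isOpen_overlap e e').prod isOpen_ne)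
    (prod_mono inter_subset_left subset_rfl)
    (fun u hu c hc => ⟨hu.1, smul_ne_zero hc.ne' hu.2⟩)
  exact h.transform_nonlin (hF.isLocalMetric he').isSpray (isOpen_overlap e e')
    (transition_contDiffOn he he') (fun u hu => hu.1)
    (fun u hu => ⟨(transition_mem_overlap e e' hu.1).1,
      dirD_transition_ne_zero he he' hu.1 hu.2⟩)
    (fun u hu => by rw [sqF, sqF, localExpr_transition he he' F hu.1])
    (fun u hu => dirD_transition_surjective he he' hu.1) (u := (z, v)) ⟨hz, hv⟩ a

end Charts

/-! ### Parallel fields along curves -/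

section Parallel

variable {n : ℕ} {M : Type*} [TopologicalSpace M] [ChartedSpace (Model n) M]
  {e : OpenPartialHomeomorph M (Model n)} {F : TangentBundle 𝓘(ℂ, Model n) M → ℝ} {σ : ℝ → M}

theorem comp_add (e : OpenPartialHomeomorph M (Model n)) (p : M)
    (v w : TangentSpace 𝓘(ℂ, Model n) p) : comp e p (v + w) = comp e p v + comp e p w :=
  map_add _ _ _

theorem comp_neg (e : OpenPartialHomeomorph M (Model n)) (p : M)
    (v : TangentSpace 𝓘(ℂ, Model n) p) : comp e p (-v) = -comp e p v :=
  map_neg _ _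

theorem comp_zero (e : OpenPartialHomeomorph M (Model n)) (p : M) :
    comp e p (0 : TangentSpace 𝓘(ℂ, Model n) p) = 0 :=
  map_zero _

theorem complexJ_apply (p : M) (v : TangentSpace 𝓘(ℂ, Model n) p) :
    complexJ p v = Complex.I • v := rfl

theorem comp_complexJ (e : OpenPartialHomeomorph M (Model n)) (p : M)
    (v : TangentSpace 𝓘(ℂ, Model n) p) : comp e p (complexJ p v) = Complex.I • comp e p v :=
  (mfderiv 𝓘(ℂ, Model n) 𝓘(ℂ, Model n) e p).map_smul Complex.I v

theorem comp_injective (he : e ∈ holCharts n M) {p : M} (hp : p ∈ e.source) :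
    Function.Injective (comp e p) := by
  have hp' := e.map_source hp
  have h := mfderiv_comp p (g := e.symm) (mdifferentiableAt_chart_symm he hp')
    (mdifferentiableAt_chart he hp)
  have hev : (e.symm ∘ e) =ᶠ[nhds p] id := by
    filter_upwards [e.open_source.mem_nhds hp] with w hw
    exact e.left_inv hw
  have h2 : (mfderiv 𝓘(ℂ, Model n) 𝓘(ℂ, Model n) (e.symm ∘ e) p : Model n →L[ℂ] Model n)
      = mfderiv 𝓘(ℂ, Model n) 𝓘(ℂ, Model n) (id : M → M) p := hev.mfderiv_eq
  intro v w hvw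
  have h3 : ∀ x : TangentSpace 𝓘(ℂ, Model n) p,
      (mfderiv 𝓘(ℂ, Model n) 𝓘(ℂ, Model n) e.symm (e p) (comp e p x) : Model n) = x := by
    intro x
    have e1 : (mfderiv 𝓘(ℂ, Model n) 𝓘(ℂ, Model n) (e.symm ∘ e) p : Model n →L[ℂ] Model n) x
        = mfderiv 𝓘(ℂ, Model n) 𝓘(ℂ, Model n) e.symm (e p) (comp e p x) := by
      rw [h]; rfl
    rw [← e1, h2, mfderiv_id]; rfl
  have h4 := h3 v
  rw [hvw] at h4
  exact h4.symm.trans (h3 w)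

theorem hasDerivWithinAt_coord_iff {x : ℝ → Model n} {x' : Model n} {s : Set ℝ} {t : ℝ} :
    (∀ k, HasDerivWithinAt (fun r => coord (x r) k) (coord x' k) s t) ↔
      HasDerivWithinAt x x' s t := by
  constructor
  · intro h
    have := HasDerivWithinAt.fun_sum (u := Finset.univ)
      fun k _ => (h k).smul_const (basisVec k : Model n)
    rw [← ofCoord_coord x', show x = fun r => ofCoord (coord (x r)) from
      funext fun r => (ofCoord_coord (x r)).symm]
    exact this
  · intro h k
    have : HasDerivWithinAt (fun r => coordCLM k (x r)) (coordCLM k x') s t :=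
      (coordCLM k).hasFDerivAt.comp_hasDerivWithinAt t h
    simpa only [coordCLM_apply] using this

/-- The Cartan coefficients enter only contracted with the velocity, so the parallel equation is
linear in V with coefficient N taken at the velocity. -/
theorem IsStronglyConvex.isParallel_iff (hF : IsStronglyConvex F) (hσ : IsRegularCurve n σ)
    (V : ∀ t, TangentSpace 𝓘(ℂ, Model n) (σ t)) :
    IsParallel F σ V ↔ ∀ e ∈ holCharts n M, ∀ t ∈ Icc (0 : ℝ) 1, σ t ∈ e.source →
      HasDerivWithinAt (fun s => comp e (σ s) (V s))
        (-dirD (0, comp e (σ t) (V t)) (sprayVec (localExpr F e)) (e (σ t), velocity e σ t))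
        (Icc 0 1) t := by
  refine forall₂_congr fun e he => forall₂_congr fun t ht => forall_congr' fun hs => ?_
  rw [← hasDerivWithinAt_coord_iff]
  refine forall_congr' fun k => ?_
  have hu : (e (σ t), velocity e σ t) ∈ e.target ×ˢ {v : Model n | v ≠ 0} :=
    ⟨e.map_source hs, hσ.regular e he t ht hs⟩
  have := (hF.isLocalMetric he).parallel_term hu (comp e (σ t) (V t)) k
  rw [this, ← coordCLM_apply k (-_), map_neg, coordCLM_apply]

theorem IsStronglyConvex.isParallel_add (hF : IsStronglyConvex F) (hσ : IsRegularCurve n σ)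
    {V W : ∀ t, TangentSpace 𝓘(ℂ, Model n) (σ t)} (hV : IsParallel F σ V)
    (hW : IsParallel F σ W) : IsParallel F σ fun t => V t + W t := by
  rw [hF.isParallel_iff hσ] at *
  intro e he t ht hs
  have := (hV e he t ht hs).fun_add (hW e he t ht hs)
  rw [← neg_add, ← dirD_add_dir, Prod.mk_add_mk, add_zero] at this
  simp only [comp_add]
  exact this

theorem IsStronglyConvex.isParallel_neg (hF : IsStronglyConvex F) (hσ : IsRegularCurve n σ)
    {V : ∀ t, TangentSpace 𝓘(ℂ, Model n) (σ t)} (hV : IsParallel F σ V) :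
    IsParallel F σ fun t => -V t := by
  rw [hF.isParallel_iff hσ] at *
  intro e he t ht hs
  have := (hV e he t ht hs).fun_neg
  rw [← dirD_neg_dir, Prod.neg_mk, neg_zero] at this
  simp only [comp_neg]
  exact this

/-- If the nonlinear connection is complex linear, then `J` preserves parallel fields. -/
theorem IsStronglyConvex.isParallel_complexJ (hF : IsStronglyConvex F)
    (hol : ∀ e ∈ holCharts n M, IsLocalMetric.HasComplexNonlin e.target (localExpr F e))
    (hσ : IsRegularCurve n σ) {V : ∀ t, TangentSpace 𝓘(ℂ, Model n) (σ t)}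
    (hV : IsParallel F σ V) : IsParallel F σ fun t => complexJ (σ t) (V t) := by
  rw [hF.isParallel_iff hσ] at *
  intro e he t ht hs
  have hu : (e (σ t), velocity e σ t) ∈ e.target ×ˢ {v : Model n | v ≠ 0} :=
    ⟨e.map_source hs, hσ.regular e he t ht hs⟩
  have := (hV e he t ht hs).const_smul Complex.I
  simp only [comp_complexJ]
  rw [hol e he _ hu, ← smul_neg]
  exact this

theorem contDiffOn_chart_curve (he : e ∈ holCharts n M) (hσ : IsRegularCurve n σ) :
    ContDiffOn ℝ ∞ (fun s => e (σ s)) (Icc 0 1 ∩ σ ⁻¹' e.source) := by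
  rw [← contMDiffOn_iff_contDiffOn]
  exact (contMDiffOn_of_mem_maximalAtlas (mem_maximalAtlas_real he)).comp
    (hσ.smooth.mono inter_subset_left) inter_subset_right

/-- Uniqueness of parallel fields in a chart. -/
theorem IsStronglyConvex.parallel_unique_chart (hF : IsStronglyConvex F)
    (hσ : IsRegularCurve n σ) {V : ∀ t, TangentSpace 𝓘(ℂ, Model n) (σ t)}
    (hV : IsParallel F σ V) (he : e ∈ holCharts n M) {O : Set ℝ} (hO : IsOpen O)
    (hsrc : ∀ t ∈ Icc (0 : ℝ) 1 ∩ O, σ t ∈ e.source) {a b : ℝ} (hab : Icc a b ⊆ Icc 0 1 ∩ O)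
    {s t : ℝ} (hs : s ∈ Icc a b) (ht : t ∈ Icc a b) (h0 : V s = 0) : V t = 0 := by
  rw [hF.isParallel_iff hσ] at hV
  have hm := hF.isLocalMetric he
  have hsm : ContDiffOn ℝ ∞ (fun s => e (σ s)) (Icc 0 1 ∩ O) :=
    (contDiffOn_chart_curve he hσ).mono fun r hr => ⟨hr.1, hsrc r hr⟩
  have hvel : ContinuousOn (velocity e σ) (Icc 0 1 ∩ O) := by
    -- `velocity` is a derivative within [0,1], while smoothness in the chart holds only on [0,1] ∩
    -- O; since O is open, the two one-sided notions agree.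
    have h1 := hsm.continuousOn_derivWithin ((uniqueDiffOn_Icc zero_lt_one).inter hO) (by simp)
    refine h1.congr fun r hr => ?_
    rw [derivWithin_inter (hO.mem_nhds hr.2)]; rfl
  let U : ℝ → Model n × Model n := fun r => (e (σ r), velocity e σ r)
  have hU : MapsTo U (Icc a b) (e.target ×ˢ {v : Model n | v ≠ 0}) := fun r hr =>
    ⟨e.map_source (hsrc r (hab hr)), hσ.regular e he r (hab hr).1 (hsrc r (hab hr))⟩
  have hUc : ContinuousOn U (Icc a b) := (hsm.continuousOn.prodMk hvel).mono hab
  have hN : ContinuousOn (fun r => fderiv ℝ (sprayVec (localExpr F e)) (U r)) (Icc a b) :=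
    (smooth_fderiv hm.isOpen_slit hm.smooth_sprayVec).continuousOn.comp hUc hU
  obtain ⟨K, hK⟩ := isCompact_Icc.exists_bound_of_continuousOn hN
  let L : ℝ → Model n →L[ℝ] Model n := fun r =>
    -(fderiv ℝ (sprayVec (localExpr F e)) (U r) ∘L ContinuousLinearMap.inr ℝ (Model n) (Model n))
  let x : ℝ → Model n := fun r => comp e (σ r) (V r)
  have hx : ∀ r ∈ Icc a b, HasDerivWithinAt x (L r (x r)) (Icc 0 1) r := fun r hr =>
    hV e he r (hab hr).1 (hsrc r (hab hr))
  have hL : ∀ r ∈ Icc a b, LipschitzOnWith K.toNNReal (fun y => L r y) univ := by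
    intro r hr
    refine LipschitzWith.lipschitzOnWith ((L r).lipschitz.weaken ?_)
    rw [← NNReal.coe_le_coe, coe_nnnorm]
    refine le_trans ?_ (Real.le_coe_toNNReal K)
    rw [norm_neg]
    refine (ContinuousLinearMap.opNorm_comp_le _ _).trans ?_
    refine (mul_le_of_le_one_right (norm_nonneg _)
      (ContinuousLinearMap.norm_inr_le_one ℝ (Model n) (Model n))).trans (hK r hr)
  have hxc : ContinuousOn x (Icc a b) := fun r hr =>
    (hx r hr).continuousWithinAt.mono fun q hq => (hab hq).1
  have hx0 : x s = 0 := by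
    change comp e (σ s) (V s) = 0
    rw [h0, comp_zero]
  have key : x t = 0 := by
    -- The field solves a linear equation with bounded coefficients, so it agrees with the zero
    -- solution forwards and backwards from s. Only one-sided derivatives are needed, which covers
    -- the endpoints of [0,1].
    rcases le_total s t with hst | hst
    · have sub : Icc s t ⊆ Icc a b := Icc_subset_Icc hs.1 ht.2
      have := ODE_solution_unique_of_mem_Icc_right (v := fun r y => L r y) (s := fun _ => univ)
        (K := K.toNNReal) (f := x) (g := fun _ => 0) (a := s) (b := t)
        (fun r hr => hL r (sub (Ico_subset_Icc_self hr))) (hxc.mono sub)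
        (fun r hr => (hx r (sub (Ico_subset_Icc_self hr))).mono_of_mem_nhdsWithin
          (Icc_mem_nhdsGE_of_mem ⟨(hab (sub (Ico_subset_Icc_self hr))).1.1,
            hr.2.trans_le (hab ht).1.2⟩))
        (fun _ _ => trivial) continuousOn_const
        (fun r _ => by simpa using hasDerivWithinAt_const r (Ici r) (0 : Model n))
        (fun _ _ => trivial) hx0
      exact this ⟨hst, le_rfl⟩
    · have sub : Icc t s ⊆ Icc a b := Icc_subset_Icc ht.1 hs.2
      have := ODE_solution_unique_of_mem_Icc_left (v := fun r y => L r y) (s := fun _ => univ)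
        (K := K.toNNReal) (f := x) (g := fun _ => 0) (a := t) (b := s)
        (fun r hr => hL r (sub (Ioc_subset_Icc_self hr))) (hxc.mono sub)
        (fun r hr => (hx r (sub (Ioc_subset_Icc_self hr))).mono_of_mem_nhdsWithin
          (Icc_mem_nhdsLE_of_mem ⟨(hab ht).1.1.trans_lt hr.1,
            (hab (sub (Ioc_subset_Icc_self hr))).1.2⟩))
        (fun _ _ => trivial) continuousOn_const
        (fun r _ => by simpa using hasDerivWithinAt_const r (Iic r) (0 : Model n))
        (fun _ _ => trivial) hx0
      exact this ⟨le_rfl, hst⟩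
  exact comp_injective he (hsrc t (hab ht)) (key.trans (comp_zero e (σ t)).symm)

variable [IsManifold 𝓘(ℂ, Model n) ω M]

/-- A parallel field that vanishes somewhere vanishes identically. -/
theorem IsStronglyConvex.parallel_eq_zero (hF : IsStronglyConvex F)
    (hσ : IsRegularCurve n σ) {V : ∀ t, TangentSpace 𝓘(ℂ, Model n) (σ t)}
    (hV : IsParallel F σ V) {s t : ℝ} (hs : s ∈ Icc (0 : ℝ) 1) (ht : t ∈ Icc (0 : ℝ) 1)
    (h0 : V s = 0) : V t = 0 := by
  -- Vanishing at r and at q is equivalent for nearby points, by uniqueness in a chart;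
  -- connectedness of [0,1] spreads the equivalence.
  refine (isPreconnected_Icc.induction₂ (s := Icc (0 : ℝ) 1)
    (fun r q => (V r = 0 ↔ V q = 0)) (fun r hr => ?_) (fun _ _ _ _ _ _ h1 h2 => h1.trans h2)
    (fun _ _ _ _ h => h.symm) hs ht).1 h0
  let e := chartAt (Model n) (σ r)
  have he : e ∈ holCharts n M := IsManifold.chart_mem_maximalAtlas (σ r)
  have h1 : σ ⁻¹' e.source ∈ nhdsWithin r (Icc 0 1) :=
    hσ.smooth.continuousOn r hr (e.open_source.mem_nhds (mem_chart_source _ (σ r)))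
  obtain ⟨δ, hδ, hsub⟩ := Metric.mem_nhdsWithin_iff.1 h1
  have hO : ∀ t ∈ Icc (0 : ℝ) 1 ∩ Metric.ball r δ, σ t ∈ e.source := fun t ht =>
    hsub ⟨ht.2, ht.1⟩
  filter_upwards [self_mem_nhdsWithin, mem_nhdsWithin_of_mem_nhds (Metric.ball_mem_nhds r hδ)]
    with q hq hq'
  have hab : Icc (min r q) (max r q) ⊆ Icc 0 1 ∩ Metric.ball r δ := by
    intro x hx
    refine ⟨⟨(le_min hr.1 hq.1).trans hx.1, hx.2.trans (max_le hr.2 hq.2)⟩, ?_⟩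
    exact (convex_ball r δ).ordConnected.uIcc_subset (Metric.mem_ball_self hδ) hq' hx
  have hr' : r ∈ Icc (min r q) (max r q) := ⟨min_le_left _ _, le_max_left _ _⟩
  have hq'' : q ∈ Icc (min r q) (max r q) := ⟨min_le_right _ _, le_max_right _ _⟩
  exact ⟨hF.parallel_unique_chart hσ hV he Metric.isOpen_ball hO hab hr' hq'',
    hF.parallel_unique_chart hσ hV he Metric.isOpen_ball hO hab hq'' hr'⟩

/-! ### Types of complexified vectors -/

omit [IsManifold 𝓘(ℂ, Model n) ω M]

theorem complexTangent_ext {p : M} {a b c d : TangentSpace 𝓘(ℂ, Model n) p} :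
    ((1 : ℂ) ⊗ₜ[ℝ] a + Complex.I ⊗ₜ[ℝ] b : ComplexTangent n p)
      = (1 : ℂ) ⊗ₜ[ℝ] c + Complex.I ⊗ₜ[ℝ] d ↔ a = c ∧ b = d := by
  constructor
  · intro h
    -- Applying a real functional to the scalar factor; the functionals Re and Im recover the two
    -- components.
    let f (g : ℂ →ₗ[ℝ] ℝ) : ComplexTangent n p →ₗ[ℝ] TangentSpace 𝓘(ℂ, Model n) p :=
      TensorProduct.lift ((LinearMap.lsmul ℝ (TangentSpace 𝓘(ℂ, Model n) p)) ∘ₗ g)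
    have hf : ∀ g z x, f g (z ⊗ₜ[ℝ] x) = g z • x := fun g z x => TensorProduct.lift.tmul _ _
    have h1 := congrArg (f Complex.reLm) h
    have h2 := congrArg (f Complex.imLm) h
    simp only [map_add, hf] at h1 h2
    simp at h1 h2
    exact ⟨h1, h2⟩
  · rintro ⟨rfl, rfl⟩; rfl

theorem isType10_iff {p : M} (a b : TangentSpace 𝓘(ℂ, Model n) p) :
    IsType10 p ((1 : ℂ) ⊗ₜ[ℝ] a + Complex.I ⊗ₜ[ℝ] b) ↔
      complexJ p a = -b ∧ complexJ p b = a := by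
  rw [IsType10, map_add, LinearMap.baseChange_tmul, LinearMap.baseChange_tmul, smul_add,
    TensorProduct.smul_tmul', TensorProduct.smul_tmul', smul_eq_mul, smul_eq_mul, mul_one,
    Complex.I_mul_I, TensorProduct.neg_tmul, ← TensorProduct.tmul_neg,
    add_comm (Complex.I ⊗ₜ[ℝ] a), complexTangent_ext]

theorem isType01_iff {p : M} (a b : TangentSpace 𝓘(ℂ, Model n) p) :
    IsType01 p ((1 : ℂ) ⊗ₜ[ℝ] a + Complex.I ⊗ₜ[ℝ] b) ↔
      complexJ p a = b ∧ complexJ p b = -a := by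
  rw [IsType01, map_add, LinearMap.baseChange_tmul, LinearMap.baseChange_tmul, smul_add,
    TensorProduct.smul_tmul', TensorProduct.smul_tmul', smul_eq_mul, smul_eq_mul, mul_one,
    Complex.I_mul_I, TensorProduct.neg_tmul, neg_add, neg_neg, ← TensorProduct.tmul_neg,
    add_comm (Complex.I ⊗ₜ[ℝ] (-a)), complexTangent_ext]

theorem complexJ_complexJ (p : M) (v : TangentSpace 𝓘(ℂ, Model n) p) :
    complexJ p (complexJ p v) = -v := by
  rw [complexJ_apply, complexJ_apply, smul_smul, Complex.I_mul_I, neg_one_smul]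

/-- If `J` preserves parallel fields, parallel transport preserves types. -/
theorem IsStronglyConvex.preservesTypes [IsManifold 𝓘(ℂ, Model n) ω M] (hF : IsStronglyConvex F)
    (hσ : IsRegularCurve n σ)
    (hJ : ∀ V : ∀ t, TangentSpace 𝓘(ℂ, Model n) (σ t), IsParallel F σ V →
      IsParallel F σ fun t => complexJ (σ t) (V t)) : PreservesTypes F σ := by
  rintro W ⟨X, Y, hX, hY, hW⟩ s hs t ht
  rw [hW s hs, hW t ht, isType10_iff, isType10_iff, isType01_iff, isType01_iff]
  constructor
  · rintro ⟨h1, -⟩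
    -- Type (1,0) of X + iY means JX + Y = 0. This combination is parallel, so vanishing at s forces
    -- vanishing at t.
    have h2 : complexJ (σ t) (X t) + Y t = 0 := hF.parallel_eq_zero hσ
      (hF.isParallel_add hσ (hJ X hX) hY) hs ht (by rw [h1, neg_add_cancel])
    have h3 := eq_neg_of_add_eq_zero_left h2
    refine ⟨h3, ?_⟩
    rw [← neg_neg (Y t), ← h3, map_neg, complexJ_complexJ, neg_neg]
  · rintro ⟨h1, -⟩
    have h2 : complexJ (σ t) (X t) + -Y t = 0 := hF.parallel_eq_zero hσ
      (hF.isParallel_add hσ (hJ X hX) (hF.isParallel_neg hσ hY)) hs ht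
      (by rw [h1, add_neg_cancel])
    have h3 := add_neg_eq_zero.1 h2
    refine ⟨h3, ?_⟩
    rw [← h3, complexJ_complexJ]

end Parallel

/-! ### Existence of parallel fields along coordinate lines -/

section Existence

/-- Solutions of a linear differential equation with small coefficients. -/
theorem exists_linear_ode {E : Type*} [NormedAddCommGroup E] [NormedSpace ℝ E] [CompleteSpace E]
    {A : ℝ → E →L[ℝ] E} (hA : ContinuousOn A (Icc 0 1)) (hb : ∀ t ∈ Icc (0 : ℝ) 1, ‖A t‖ ≤ 1 / 2)
    (x₀ : E) : ∃ y : ℝ → E, y 0 = x₀ ∧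
      ∀ t ∈ Icc (0 : ℝ) 1, HasDerivWithinAt y (A t (y t)) (Icc 0 1) t := by
  -- On the ball of radius ‖x₀‖ about x₀ one has ‖x‖ ≤ 2‖x₀‖, so the coefficient bound ½ limits the
  -- speed to ‖x₀‖ and the solution stays in the ball for unit time.
  have hP : IsPicardLindelof (fun t x => A t x)
      (⟨0, left_mem_Icc.2 zero_le_one⟩ : Icc (0 : ℝ) 1) x₀ ‖x₀‖₊ 0 ‖x₀‖₊ (1 / 2) :=
    { lipschitzOnWith := fun t ht => by
        refine LipschitzWith.lipschitzOnWith ((A t).lipschitz.weaken ?_)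
        rw [← NNReal.coe_le_coe, coe_nnnorm]
        simpa using hb t ht
      continuousOn := fun x _ => hA.clm_apply continuousOn_const
      norm_le := fun t ht x hx => by
        rw [coe_nnnorm]
        have h1 : ‖x‖ ≤ 2 * ‖x₀‖ := by
          have h2 := norm_sub_norm_le x x₀
          rw [mem_closedBall_iff_norm, coe_nnnorm] at hx
          linarith
        have h3 := (A t).le_of_opNorm_le (hb t ht) x
        linarith
      mul_max_le := by simp }
  obtain ⟨y, hy0, hy⟩ := hP.exists_eq_forall_mem_Icc_hasDerivWithinAt
    (x := x₀) (by simp)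
  exact ⟨y, hy0, hy⟩

theorem hasDerivAt_line {E : Type*} [NormedAddCommGroup E] [NormedSpace ℝ E] (z w : E) (t : ℝ) :
    HasDerivAt (fun s : ℝ => z + s • w) w t := by
  simpa using ((hasDerivAt_id t).smul_const w).const_add z

theorem hasDerivWithinAt_dirD_line {E : Type*} [NormedAddCommGroup E] [NormedSpace ℝ E]
    {φ : E → E} {O : Set E} (hO : IsOpen O) (hφ : ContDiffOn ℝ ∞ φ O) {z w : E} {t : ℝ}
    (hz : z + t • w ∈ O) {y : ℝ → E} {y' : E} {s : Set ℝ} (hy : HasDerivWithinAt y y' s t) :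
    HasDerivWithinAt (fun r => dirD (y r) φ (z + r • w))
      (dirD w (dirD (y t) φ) (z + t • w) + dirD y' φ (z + t • w)) s t := by
  rw [dirD_dirD_eq hO hφ hz]
  have h1 : HasDerivWithinAt (fun r : ℝ => fderiv ℝ φ (z + r • w))
      (fderiv ℝ (fderiv ℝ φ) (z + t • w) w) s t :=
    (diffAt_of_smooth hO (smooth_fderiv hO hφ) hz).hasFDerivAt.comp_hasDerivWithinAt t
      (hasDerivAt_line z w t).hasDerivWithinAt
  exact h1.clm_apply hy

variable {n : ℕ} {M : Type*} [TopologicalSpace M] [ChartedSpace (Model n) M]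
  {e e' : OpenPartialHomeomorph M (Model n)} {F : TangentBundle 𝓘(ℂ, Model n) M → ℝ}

omit [ChartedSpace (Model n) M] in
theorem dirD_transition_self {z : Model n} (hz : z ∈ overlap e e) (v : Model n) :
    dirD v (transition e e) z = v := by
  rw [dirD_congr (f := transition e e) (g := fun x => x) (isOpen_overlap e e)
    (fun x hx => e.right_inv hx.1) hz]
  exact dirD_clm (ContinuousLinearMap.id ℝ (Model n)) v z

/-- The coordinate line through `z` in the direction `w`. -/
noncomputable def coordLine (e : OpenPartialHomeomorph M (Model n)) (z w : Model n) (t : ℝ) : M :=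
  e.symm (z + t • w)

/-- The vector field along a coordinate line with the components `y` in the chart. -/
noncomputable def lineField (e : OpenPartialHomeomorph M (Model n)) (z w : Model n)
    (y : ℝ → Model n) (t : ℝ) : TangentSpace 𝓘(ℂ, Model n) (coordLine e z w t) :=
  mfderiv 𝓘(ℂ, Model n) 𝓘(ℂ, Model n) e.symm (z + t • w) (y t)

/-! ### Coordinate lines and the parallel fields along them -/

section Line

variable {z w : Model n} (he : e ∈ holCharts n M) (hw : w ≠ 0)
  (hline : ∀ t ∈ Icc (0 : ℝ) 1, z + t • w ∈ e.target)
include he hline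

theorem velocity_coordLine (he' : e' ∈ holCharts n M) {t : ℝ} (ht : t ∈ Icc (0 : ℝ) 1)
    (hs : coordLine e z w t ∈ e'.source) :
    velocity e' (coordLine e z w) t = dirD w (transition e e') (z + t • w) := by
  have hz : z + t • w ∈ overlap e e' := ⟨hline t ht, hs⟩
  have h1 := (diffAt_of_smooth (isOpen_overlap e e') (transition_contDiffOn he he')
    hz).hasFDerivAt.comp_hasDerivWithinAt t (hasDerivAt_line z w t).hasDerivWithinAt
    (s := Icc 0 1)
  exact h1.derivWithin (uniqueDiffOn_Icc zero_lt_one t ht)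

include hw in
theorem isRegularCurve_coordLine : IsRegularCurve n (coordLine e z w) where
  smooth := by
    refine (contMDiffOn_symm_of_mem_maximalAtlas (mem_maximalAtlas_real he)).comp
      (f := fun s : ℝ => z + s • w) ?_ hline
    rw [contMDiffOn_iff_contDiffOn]
    exact ContDiff.contDiffOn (by fun_prop)
  regular := fun e' he' t ht hs => by
    rw [velocity_coordLine he hline he' ht hs]
    exact dirD_transition_ne_zero he he' ⟨hline t ht, hs⟩ hw

omit hline in
theorem comp_lineField (he' : e' ∈ holCharts n M) (y : ℝ → Model n) {t : ℝ}
    (hz : z + t • w ∈ overlap e e') :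
    comp e' (coordLine e z w t) (lineField e z w y t)
      = dirD (y t) (transition e e') (z + t • w) :=
  comp_mfderiv_symm he he' hz (y t)

include hw in
/-- A solution of the parallel equation in one chart defines a parallel field. -/
theorem IsStronglyConvex.isParallel_of_chart (hF : IsStronglyConvex F) {y : ℝ → Model n}
    (hy : ∀ t ∈ Icc (0 : ℝ) 1, HasDerivWithinAt y
      (-dirD (0, y t) (sprayVec (localExpr F e)) (z + t • w, w)) (Icc 0 1) t) :
    IsParallel F (coordLine e z w) (lineField e z w y) := by
  refine (hF.isParallel_iff (isRegularCurve_coordLine he hw hline) _).2 ?_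
  intro e' he' t ht hs
  have hz : z + t • w ∈ overlap e e' := ⟨hline t ht, hs⟩
  have hφ := transition_contDiffOn he he'
  have hO := isOpen_overlap e e'
  have hd := hasDerivWithinAt_dirD_line hO hφ hz (hy t ht)
  have hev : (fun s => comp e' (coordLine e z w s) (lineField e z w y s))
      =ᶠ[nhdsWithin t (Icc 0 1)] fun s => dirD (y s) (transition e e') (z + s • w) := by
    have hc : Continuous fun s : ℝ => z + s • w := by fun_prop
    filter_upwards [mem_nhdsWithin_of_mem_nhds ((hO.preimage hc).mem_nhds hz)] with s hs'
    exact comp_lineField he he' y hs'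
  have key := hd.congr_of_eventuallyEq hev (comp_lineField he he' y hz)
  -- The second-derivative term in the transformation law cancels the one produced by
  -- differentiating the transition map along the line, so the equation holds in every chart.
  have htr := hF.nonlin_transition he he' hz hw (y t)
  rw [comp_lineField he he' y hz, velocity_coordLine he hline he' ht hs]
  have e0 : e' (coordLine e z w t) = transition e e' (z + t • w) := rfl
  rw [e0, htr, neg_sub, sub_eq_add_neg, ← dirD_neg_dir]
  exact key

end Line

/-- Through each tangent direction there is a coordinate line along which all initial values
extend to parallel fields. -/
theorem IsStronglyConvex.exists_parallel (hF : IsStronglyConvex F) (he : e ∈ holCharts n M)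
    {z v : Model n} (hz : z ∈ e.target) (hv : v ≠ 0) :
    ∃ c : ℝ, 0 < c ∧ (∀ t ∈ Icc (0 : ℝ) 1, z + t • c • v ∈ e.target) ∧
      ∀ x₀ : Model n, ∃ V : ∀ t, TangentSpace 𝓘(ℂ, Model n) (coordLine e z (c • v) t),
        IsParallel F (coordLine e z (c • v)) V ∧ comp e (coordLine e z (c • v) 0) (V 0) = x₀ := by
  have hm := hF.isLocalMetric he
  set G := sprayVec (localExpr F e) with hG
  have hcont := (smooth_fderiv hm.isOpen_slit hm.smooth_sprayVec).continuousOn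
  have hcz : ContinuousAt (fun x : Model n => fderiv ℝ G (x, v)) z := by
    have h1 : ContinuousAt (fderiv ℝ G) (z, v) :=
      hcont.continuousAt (hm.isOpen_slit.mem_nhds ⟨hz, hv⟩)
    exact ContinuousAt.comp (f := fun x : Model n => (x, v)) h1 (by fun_prop)
  set K := ‖fderiv ℝ G (z, v)‖ + 1 with hK
  have hKpos : 0 < K := by positivity
  have hev : ∀ᶠ x in nhds z, x ∈ e.target ∧ ‖fderiv ℝ G (x, v)‖ < K :=
    (e.open_target.eventually_mem hz).and (hcz.norm.eventually_lt_const (lt_add_one _))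
  obtain ⟨ε, hε, hball⟩ := Metric.eventually_nhds_iff.1 hev
  have hvpos : 0 < ‖v‖ := norm_pos_iff.2 hv
  -- The first bound gives cK ≤ ½, as required by `exists_linear_ode`; the second keeps the line in
  -- the ball where the chart and the bound K are valid.
  set c := min (1 / (2 * K)) (ε / (2 * ‖v‖)) with hc
  have hcpos : 0 < c := by positivity
  have hcK : c * K ≤ 1 / 2 := by
    calc c * K ≤ 1 / (2 * K) * K := by gcongr; exact min_le_left _ _
      _ = 1 / 2 := by field_simp
  have hcv : c * ‖v‖ < ε := by
    calc c * ‖v‖ ≤ ε / (2 * ‖v‖) * ‖v‖ := by gcongr; exact min_le_right _ _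
      _ = ε / 2 := by field_simp
      _ < ε := by linarith
  have hdist : ∀ t ∈ Icc (0 : ℝ) 1, dist (z + t • c • v) z < ε := by
    intro t ht
    rw [dist_eq_norm, add_sub_cancel_left, norm_smul, norm_smul, Real.norm_of_nonneg ht.1,
      Real.norm_of_nonneg hcpos.le]
    refine lt_of_le_of_lt ?_ hcv
    exact mul_le_of_le_one_left (by positivity) ht.2
  have hline : ∀ t ∈ Icc (0 : ℝ) 1, z + t • c • v ∈ e.target := fun t ht =>
    (hball (hdist t ht)).1
  have hcv0 : c • v ≠ 0 := smul_ne_zero hcpos.ne' hv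
  refine ⟨c, hcpos, hline, fun x₀ => ?_⟩
  let A : ℝ → Model n →L[ℝ] Model n := fun t =>
    -(fderiv ℝ G (z + t • c • v, c • v) ∘L ContinuousLinearMap.inr ℝ (Model n) (Model n))
  have hAc : ContinuousOn A (Icc 0 1) := by
    refine ContinuousOn.neg (ContinuousOn.clm_comp ?_ continuousOn_const)
    refine hcont.comp (f := fun t : ℝ => (z + t • c • v, c • v))
      (Continuous.continuousOn (by fun_prop)) fun t ht => ⟨hline t ht, hcv0⟩
  have hAb : ∀ t ∈ Icc (0 : ℝ) 1, ‖A t‖ ≤ 1 / 2 := by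
    intro t ht
    refine ContinuousLinearMap.opNorm_le_bound _ (by norm_num) fun a => ?_
    -- N has degree one in the fibre variable, so shortening the velocity by c shrinks the
    -- coefficients by the same factor.
    have h1 : A t a = -(c • fderiv ℝ G (z + t • c • v, v) (0, a)) :=
      congrArg Neg.neg (hm.isSpray.nonlin_homog (u := (z + t • c • v, v)) ⟨hline t ht, hv⟩ hcpos a)
    rw [h1, norm_neg, norm_smul, Real.norm_of_nonneg hcpos.le]
    have h2 : ‖fderiv ℝ G (z + t • c • v, v) (0, a)‖ ≤ K * ‖a‖ := by
      have := (fderiv ℝ G (z + t • c • v, v)).le_of_opNorm_le (hball (hdist t ht)).2.le (0, a)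
      simpa [Prod.norm_def] using this
    calc c * ‖fderiv ℝ G (z + t • c • v, v) (0, a)‖ ≤ c * (K * ‖a‖) := by gcongr
      _ = c * K * ‖a‖ := by ring
      _ ≤ 1 / 2 * ‖a‖ := by gcongr
  obtain ⟨y, hy0, hy⟩ := exists_linear_ode hAc hAb x₀
  refine ⟨_, hF.isParallel_of_chart he hcv0 hline (y := y) hy, ?_⟩
  have hz0 : z + (0 : ℝ) • c • v ∈ overlap e e := by
    refine ⟨hline 0 (left_mem_Icc.2 zero_le_one), e.map_target ?_⟩
    exact hline 0 (left_mem_Icc.2 zero_le_one)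
  refine (comp_lineField he he y hz0).trans ?_
  rw [dirD_transition_self hz0, hy0]

/-- If parallel transport preserves types, the nonlinear connection is complex linear. -/
theorem IsStronglyConvex.hasComplexNonlin_of_preservesTypes (hF : IsStronglyConvex F)
    (hT : ∀ σ : ℝ → M, IsRegularCurve n σ → PreservesTypes F σ) (he : e ∈ holCharts n M) :
    IsLocalMetric.HasComplexNonlin e.target (localExpr F e) := by
  rintro ⟨z, v⟩ ⟨hz, hv⟩ a
  change z ∈ e.target at hz
  change v ≠ 0 at hv
  have hm := hF.isLocalMetric he
  obtain ⟨c, hc, hline, hex⟩ := hF.exists_parallel he hz hv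
  have hcv : c • v ≠ 0 := smul_ne_zero hc.ne' hv
  have hσ := isRegularCurve_coordLine he hcv hline
  obtain ⟨V, hV, hV0⟩ := hex a
  obtain ⟨V', hV', hV'0⟩ := hex (Complex.I • a)
  have h0 : (0 : ℝ) ∈ Icc (0 : ℝ) 1 := left_mem_Icc.2 zero_le_one
  have hsrc : coordLine e z (c • v) 0 ∈ e.source := e.map_target (hline 0 h0)
  have hJ0 : complexJ (coordLine e z (c • v) 0) (V 0) = V' 0 := by
    apply comp_injective he hsrc
    rw [comp_complexJ, hV0, hV'0]
  have hJ : ∀ t ∈ Icc (0 : ℝ) 1, complexJ (coordLine e z (c • v) t) (V t) = V' t := by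
    intro t ht
    -- With JV = V' at time 0, the parallel field V - iV' has type (1,0) there; keeping this type
    -- means JV = V' throughout.
    have := (hT _ hσ (fun t => (1 : ℂ) ⊗ₜ[ℝ] V t + Complex.I ⊗ₜ[ℝ] (-V' t))
      ⟨V, fun t => -V' t, hV, hF.isParallel_neg hσ hV', fun _ _ => rfl⟩ 0 h0 t ht).1
    rw [isType10_iff, isType10_iff] at this
    have h1 := (this ⟨by rw [neg_neg, hJ0], by rw [← hJ0, map_neg, complexJ_complexJ, neg_neg]⟩).1
    rwa [neg_neg] at h1
  rw [hF.isParallel_iff hσ] at hV hV'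
  have d1 := (hV e he 0 h0 hsrc).const_smul Complex.I
  have d2 := hV' e he 0 h0 hsrc
  -- The components of V' are i times those of V, so the two parallel equations give two values for
  -- one derivative at time 0.
  have d3 := d2.congr_of_mem (f₁ := fun s => Complex.I • comp e (coordLine e z (c • v) s) (V s))
    (fun s hs => by rw [← hJ s hs, comp_complexJ]) h0
  have hD := (uniqueDiffOn_Icc zero_lt_one 0 h0).eq_deriv _ d1 d3
  rw [velocity_coordLine he hline he h0 hsrc, hV0, hV'0, smul_neg, neg_inj] at hD
  have hz0 : z + (0 : ℝ) • c • v ∈ overlap e e := ⟨hline 0 h0, hsrc⟩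
  have e1 : dirD (c • v) (transition e e) (z + (0 : ℝ) • c • v) = c • v :=
    dirD_transition_self hz0 _
  have e2 : e (coordLine e z (c • v) 0) = z := by
    rw [coordLine, e.right_inv (hline 0 h0), zero_smul, add_zero]
  rw [e1, e2] at hD
  -- Degree-one homogeneity returns from the shortened velocity c • v to v.
  have hh := fun b => hm.isSpray.nonlin_homog (u := (z, v)) ⟨hz, hv⟩ hc b
  simp only [fibreScale_apply] at hh
  rw [hh, hh, smul_comm] at hD
  exact (smul_right_injective (Model n) hc.ne' hD).symm

end Existence

end ComplexFinsler

open ComplexFinsler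

/-! ### The equivalence, through 1 → 3 → 2 → 1 and 1 ↔ 4 -/

theorem theorem1p2 {n : ℕ} {M : Type*} [TopologicalSpace M]
    [ChartedSpace (Model n) M] [IsManifold 𝓘(ℂ, Model n) ω M]
    (F : TangentBundle 𝓘(ℂ, Model n) M → ℝ)
    (hF : IsStronglyConvex F) (hK : IsWeaklyKahler F) :
    List.TFAE
      [IsStronglyConvexKahlerBerwald F,
       ∀ σ : ℝ → M, IsRegularCurve n σ → PreservesTypes F σ,
       ∀ σ : ℝ → M, IsRegularCurve n σ →
         ∀ V : ∀ t, TangentSpace 𝓘(ℂ, Model n) (σ t),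
           IsParallel F σ V → IsParallel F σ (fun t => complexJ (σ t) (V t)),
       IsHorizontallyParallelJ F] := by
  have hol_berwald :
      (∀ e ∈ holCharts n M, IsLocalMetric.HasComplexNonlin e.target (localExpr F e)) →
        IsStronglyConvexKahlerBerwald F := fun hol =>
    ⟨hF, fun e he u hu α β μ =>
      (hF.isLocalMetric he).chernHor_symm_of_complexNonlin (hol e he) hu α β μ,
      fun e he z hz v w hv hw α β μ =>
      (hF.isLocalMetric he).chernHor_const_of_complexNonlin (hol e he) hz hv hw α β μ⟩
  tfae_have 1 → 3 := by
    rintro ⟨-, hs, hb⟩ σ hσ V hV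
    refine hF.isParallel_complexJ (fun e he u hu a => ?_) hσ hV
    have h := (hF.isLocalMetric he).nonlin_eq_chernBilin hu.1
      (fun v hv => hs e he (u.1, v) ⟨hu.1, hv⟩) (hb e he u.1 hu.1) hu.2
    rw [h, h, map_smul]
  tfae_have 3 → 2 := fun h σ hσ => hF.preservesTypes hσ (h σ hσ)
  tfae_have 2 → 1 := fun h =>
    hol_berwald fun e he => hF.hasComplexNonlin_of_preservesTypes h he
  tfae_have 1 → 4 := by
    rintro ⟨-, hs, hb⟩ e he u hu X hX Y hY
    have hm := hF.isLocalMetric he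
    rw [hm.cartanCov_I_smul_iff hu hX (diffAt_of_smooth hm.isOpen_slit hY hu)]
    have h := IsLocalMetric.cartanBilin_eq_of_cartanHor (hm.cartanHor_eq_chernBilin hu.1
      (fun v hv => hs e he (u.1, v) ⟨hu.1, hv⟩) (hb e he u.1 hu.1) hu.2)
    rw [h, h, map_smul, LinearMap.smul_apply]
  tfae_have 4 → 1 := by
    intro h
    refine hol_berwald fun e he u hu a => ?_
    have hm := hF.isLocalMetric he
    -- On the horizontal lift of the fibre variable the Cartan coefficients reduce to N, so constant
    -- fields Y already yield N(ia) = iN(a).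
    have hX := hm.mem_horizontalSpace hu u.2
    have h1 := h e he u hu _ hX (fun _ => a) contDiffOn_const
    rwa [hm.cartanCov_I_smul_iff hu hX (differentiableAt_const a), hm.cartanBilin_snd hu,
      hm.cartanBilin_snd hu] at h1
  tfae_finish
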